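/- Let $k$ be a field and $X$ a well-ordered set. A Poisson algebra over $k$ is a $k$-vector space with bilinear operations $\cdot$ and $(-,-)$ such that $\cdot$ is associative and commutative (no unit is required), $(-,-)$ is a Lie bracket, and $(x,y\cdot z)=(x,y)\cdot z+y\cdot(x,z)$. It is metabelian if $P^2\cdot P^2+(P^2,P^2)=0$, where $P^2=P\cdot P+(P,P)$. Let $\mathcal{MP}_k(X)$ be the free metabelian Poisson algebra over $k$ generated by $X$. For $S\subseteq\mathcal{MP}_k(X)$ let $\mathrm{Id}(S)$ be the ideal generated by $S$ and $\mathcal{MP}_k(X\mid S)=\mathcal{MP}_k(X)/\mathrm{Id}(S)$. Write $[f,a_1,\dots,a_n]_{\mathrm L}=(\dots((f,a_1),a_2),\dots,a_n)$, with $[f]_{\mathrm L}=f$. **Monomials.** $\mathrm{MPB}_k(X)$ is the linear basis of $\mathcal{MP}_k(X)$ consisting of the following elements, with all $a_i\in X$: * $[a_1,\dots,a_n]_{\mathrm L}$ with $n\ge1$, $a_2\le\dots\le a_n$, and $a_1>a_2$ if $n\ge2$; * $a_1\cdots a_t$ with $t\in\{2,3\}$ and $a_1\le\dots\le a_t$;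 * $[a_1,a_2]_{\mathrm L}\cdot a_3$ with $a_1>a_2$; * if $\operatorname{char}k\ne2$: $[a_1,a_2,a_3]_{\mathrm L}\cdot a_4$ with $a_2<a_1\le a_4$ and $a_2\le a_3<a_4$; * if $\operatorname{char}k=2$: $[a_1,\dots,a_n]_{\mathrm L}\cdot a_{n+1}$ with $n\ge3$, $a_1>a_2$ and $a_2\le\dots\le a_{n+1}$. For such a monomial $W$ with letters $a_1,\dots,a_n$ from left to right, let $\ell(W)=n$ and let $\mathrm{Pb}(W)$ be its number of Poisson brackets. Monomials are ordered by comparing $(\ell(W),\mathrm{Pb}(W),a_1,\dots,a_n)$ lexicographically. For $f\ne0$, $\bar f$ is the largest monomial occurring in $f$ with nonzero coefficient; $f$ is monic if that coefficient is $1$. Put $\bar0=0$, which is smaller than every monomial. A set $S$ is monic if all its elements are monic (in particular nonzero). **Normal $S$-polynomials.** These are the elements $s\in S$, and the elements $[s,a_1,\dots,a_n]_{\mathrm L}$ with $s\in S$, $\ell(\bar s)\ge5$, $n\ge1$ and $a_i\in X$. **Multiplication compositions.** These are $s\cdot a$, $s\cdot(a_1,a_2)$ and $(s,(a_1,a_2))$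 for $s\in S$ and $a,a_1,a_2\in X$ with $a_1>a_2$, and also $(s,a)$ if $\ell(\bar s)\le4$. Such a composition $h$ is trivial if it is a linear combination of normal $S$-polynomials $g$ with $\bar g\le\bar h$. **General compositions.** These are the following elements, for $s_1,s_2\in S$: * $s_1-s_2$ if $\bar s_1=\bar s_2$; it is a composition with respect to $W=\bar s_1$; * if either $\bar s_1=[a,a_1,\dots,a_n]_{\mathrm L}$ and $\bar s_2=[a,b_1,\dots,b_m]_{\mathrm L}$, or $\bar s_1=[a,a_1,\dots,a_{n-1}]_{\mathrm L}\cdot a_n$ and $\bar s_2=[a,b_1,\dots,b_{m-1}]_{\mathrm L}\cdot b_m$, with $n,m\ge4$ and the same first letter $a$: the element $[s_1,a'_1,\dots,a'_p]_{\mathrm L}-[s_2,b'_1,\dots,b'_q]_{\mathrm L}$, where $p,q\ge0$, $a'_1\le\dots\le a'_p$ and $b'_1\le\dots\le b'_q$ are letters, $a_1\cdots a_na'_1\cdots a'_p=b_1\cdots b_mb'_1\cdots b'_q$ in the free commutative monoid on $X$, and no $a'_i$ equals any $b'_j$; it is a composition with respect to $W=\overline{[s_1,a'_1,\dots,a'_p]_{\mathrm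 L}}$. A general composition with respect to $W$ is trivial if it is a linear combination of normal $S$-polynomials $g$ with $\bar g<W$. **Theorem (Composition-Diamond lemma for metabelian Poisson algebras).** Let $S$ be a monic subset of $\mathcal{MP}_k(X)$. The following are equivalent: 1. All multiplication compositions and all general compositions of $S$ are trivial. 2. $S$ is a Gröbner–Shirshov basis for $\mathcal{MP}_k(X\mid S)$; that is, for every nonzero $f\in\mathrm{Id}(S)$ there is a normal $S$-polynomial $h$ with $\bar f=\bar h$. 3. The images of the elements of $\mathrm{Irr}(S)=\{W\in\mathrm{MPB}_k(X)\mid W\ne\bar h\text{ for every normal }S\text{-polynomial }h\}$ in $\mathcal{MP}_k(X\mid S)$ are linearly independent and span it, i.e. $\mathrm{Irr}(S)$ is a linear basis of $\mathcal{MP}_k(X\mid S)$. -/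

import Mathlib

/-!
# Metabelian Poisson algebras, their free objects, and Groebner-Shirshov bases
-/

namespace MetabelianPoisson

universe u v w

/-- A (not necessarily unital) Poisson algebra over `k`: a commutative associative `k`-algebra with a
Lie bracket which is `k`-bilinear and satisfies the Leibniz identity. -/
class PoissonAlgebra (k : Type u) (P : Type v) [Field k] [NonUnitalCommRing P] [Module k P]
    extends Bracket P P where
  smul_mul : ∀ (c : k) (x y : P), (c • x) * y = c • (x * y)
  add_lie : ∀ x y z : P, ⁅x + y, z⁆ = ⁅x, z⁆ + ⁅y, z⁆
  lie_add : ∀ x y z : P, ⁅x, y + z⁆ = ⁅x, y⁆ + ⁅x, z⁆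
  smul_lie : ∀ (c : k) (x y : P), ⁅c • x, y⁆ = c • ⁅x, y⁆
  lie_smul : ∀ (c : k) (x y : P), ⁅x, c • y⁆ = c • ⁅x, y⁆
  lie_self : ∀ x : P, ⁅x, x⁆ = 0
  jacobi : ∀ x y z : P, ⁅⁅x, y⁆, z⁆ + ⁅⁅y, z⁆, x⁆ + ⁅⁅z, x⁆, y⁆ = 0
  leibniz : ∀ x y z : P, ⁅x, y * z⁆ = ⁅x, y⁆ * z + y * ⁅x, z⁆

/-- The subspace `P² = P · P + (P, P)`. -/
def square (k : Type u) (P : Type v) [Field k] [NonUnitalCommRing P] [Module k P]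
    [PoissonAlgebra k P] : Submodule k P :=
  Submodule.span k {z | ∃ x y : P, z = x * y} ⊔ Submodule.span k {z | ∃ x y : P, z = ⁅x, y⁆}

/-- `P` is metabelian: `P² · P² + (P², P²) = 0`. -/
def IsMetabelian (k : Type u) (P : Type v) [Field k] [NonUnitalCommRing P] [Module k P]
    [PoissonAlgebra k P] : Prop :=
  ∀ x ∈ square k P, ∀ y ∈ square k P, x * y = 0 ∧ ⁅x, y⁆ = 0

/-! ### The free metabelian Poisson algebra -/

/-- Formal expressions in the letters of `X` and the operations of a Poisson algebra. -/
inductive Pre (k : Type u) (X : Type v) : Type (max u v)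
  | var : X → Pre k X
  | zero : Pre k X
  | add : Pre k X → Pre k X → Pre k X
  | smul : k → Pre k X → Pre k X
  | mul : Pre k X → Pre k X → Pre k X
  | lie : Pre k X → Pre k X → Pre k X

/-- The expressions that are a product or a bracket of two expressions. -/
inductive Pre.IsProduct {k : Type u} {X : Type v} : Pre k X → Prop
  | mul (x y : Pre k X) : Pre.IsProduct (Pre.mul x y)
  | lie (x y : Pre k X) : Pre.IsProduct (Pre.lie x y)

/-- The identities of metabelian Poisson algebras, closed under the operations. -/
inductive Rel (k : Type u) (X : Type v) [Field k] : Pre k X → Pre k X → Prop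
  -- compatibility with the operations
  | add_congr_left {x y : Pre k X} (z : Pre k X) : Rel k X x y → Rel k X (.add x z) (.add y z)
  | add_congr_right {x y : Pre k X} (z : Pre k X) : Rel k X x y → Rel k X (.add z x) (.add z y)
  | smul_congr {x y : Pre k X} (c : k) : Rel k X x y → Rel k X (.smul c x) (.smul c y)
  | mul_congr_left {x y : Pre k X} (z : Pre k X) : Rel k X x y → Rel k X (.mul x z) (.mul y z)
  | mul_congr_right {x y : Pre k X} (z : Pre k X) : Rel k X x y → Rel k X (.mul z x) (.mul z y)
  | lie_congr_left {x y : Pre k X} (z : Pre k X) : Rel k X x y → Rel k X (.lie x z) (.lie y z)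
  | lie_congr_right {x y : Pre k X} (z : Pre k X) : Rel k X x y → Rel k X (.lie z x) (.lie z y)
  -- vector space
  | add_assoc (x y z : Pre k X) : Rel k X (.add (.add x y) z) (.add x (.add y z))
  | add_comm (x y : Pre k X) : Rel k X (.add x y) (.add y x)
  | zero_add (x : Pre k X) : Rel k X (.add .zero x) x
  | one_smul (x : Pre k X) : Rel k X (.smul 1 x) x
  | mul_smul (c d : k) (x : Pre k X) : Rel k X (.smul (c * d) x) (.smul c (.smul d x))
  | smul_add (c : k) (x y : Pre k X) : Rel k X (.smul c (.add x y)) (.add (.smul c x) (.smul c y))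
  | add_smul (c d : k) (x : Pre k X) : Rel k X (.smul (c + d) x) (.add (.smul c x) (.smul d x))
  | zero_smul (x : Pre k X) : Rel k X (.smul 0 x) .zero
  -- commutative associative algebra
  | add_mul (x y z : Pre k X) : Rel k X (.mul (.add x y) z) (.add (.mul x z) (.mul y z))
  | smul_mul (c : k) (x y : Pre k X) : Rel k X (.mul (.smul c x) y) (.smul c (.mul x y))
  | mul_comm (x y : Pre k X) : Rel k X (.mul x y) (.mul y x)
  | mul_assoc (x y z : Pre k X) : Rel k X (.mul (.mul x y) z) (.mul x (.mul y z))
  -- Lie algebra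
  | add_lie (x y z : Pre k X) : Rel k X (.lie (.add x y) z) (.add (.lie x z) (.lie y z))
  | lie_add (x y z : Pre k X) : Rel k X (.lie x (.add y z)) (.add (.lie x y) (.lie x z))
  | smul_lie (c : k) (x y : Pre k X) : Rel k X (.lie (.smul c x) y) (.smul c (.lie x y))
  | lie_smul (c : k) (x y : Pre k X) : Rel k X (.lie x (.smul c y)) (.smul c (.lie x y))
  | lie_self (x : Pre k X) : Rel k X (.lie x x) .zero
  | jacobi (x y z : Pre k X) :
      Rel k X (.add (.add (.lie (.lie x y) z) (.lie (.lie y z) x)) (.lie (.lie z x) y)) .zero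
  -- Leibniz identity
  | leibniz (x y z : Pre k X) :
      Rel k X (.lie x (.mul y z)) (.add (.mul (.lie x y) z) (.mul y (.lie x z)))
  -- metabelian identities
  | mul_zero {x y : Pre k X} : x.IsProduct → y.IsProduct → Rel k X (.mul x y) .zero
  | lie_zero {x y : Pre k X} : x.IsProduct → y.IsProduct → Rel k X (.lie x y) .zero

/-- The free metabelian Poisson algebra over the field `k` generated by `X`. -/
def MP (k : Type u) (X : Type v) [Field k] : Type (max u v) := Quot (Rel k X)

namespace MP

variable {k : Type u} {X : Type v} [Field k]

/-- The class of an expression. -/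
def mk (x : Pre k X) : MP k X := Quot.mk _ x

/-- The letter `a` as an element of the free algebra. -/
def ι (a : X) : MP k X := mk (.var a)

theorem ind {p : MP k X → Prop} (h : ∀ x, p (mk x)) (f : MP k X) : p f := Quot.ind h f

theorem sound {x y : Pre k X} (h : Rel k X x y) : mk x = mk y := Quot.sound h

instance : Zero (MP k X) := ⟨mk .zero⟩

instance : Add (MP k X) :=
  ⟨Quot.map₂ Pre.add (fun z _ _ h => .add_congr_right z h) (fun _ _ z h => .add_congr_left z h)⟩

instance : Mul (MP k X) :=
  ⟨Quot.map₂ Pre.mul (fun z _ _ h => .mul_congr_right z h) (fun _ _ z h => .mul_congr_left z h)⟩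

instance : Bracket (MP k X) (MP k X) :=
  ⟨Quot.map₂ Pre.lie (fun z _ _ h => .lie_congr_right z h) (fun _ _ z h => .lie_congr_left z h)⟩

instance : SMul k (MP k X) :=
  ⟨fun c => Quot.map (Pre.smul c) (fun _ _ h => .smul_congr c h)⟩

instance : Neg (MP k X) := ⟨fun f => (-1 : k) • f⟩

theorem mk_zero : (mk .zero : MP k X) = 0 := rfl
theorem mk_add (x y : Pre k X) : mk (.add x y) = mk x + mk y := rfl
theorem mk_mul (x y : Pre k X) : mk (.mul x y) = mk x * mk y := rfl
theorem mk_lie (x y : Pre k X) : mk (.lie x y) = ⁅mk x, mk y⁆ := rfl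
theorem mk_smul (c : k) (x : Pre k X) : mk (.smul c x) = c • mk x := rfl

protected theorem zero_smul (f : MP k X) : (0 : k) • f = 0 := by
  induction f using ind with | h x => exact sound (.zero_smul x)

protected theorem add_comm (f g : MP k X) : f + g = g + f := by
  induction f using ind with | h x =>
  induction g using ind with | h y => exact sound (.add_comm x y)

protected theorem zero_add (f : MP k X) : 0 + f = f := by
  induction f using ind with | h x => exact sound (.zero_add x)

protected theorem one_smul (f : MP k X) : (1 : k) • f = f := by
  induction f using ind with | h x => exact sound (.one_smul x)

protected theorem add_smul (c d : k) (f : MP k X) : (c + d) • f = c • f + d • f := by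
  induction f using ind with | h x => exact sound (.add_smul c d x)

protected theorem mul_comm (f g : MP k X) : f * g = g * f := by
  induction f using ind with | h x =>
  induction g using ind with | h y => exact sound (.mul_comm x y)

protected theorem add_mul (f g h : MP k X) : (f + g) * h = f * h + g * h := by
  induction f using ind with | h x =>
  induction g using ind with | h y =>
  induction h using ind with | h z => exact sound (.add_mul x y z)

protected theorem smul_mul (c : k) (f g : MP k X) : (c • f) * g = c • (f * g) := by
  induction f using ind with | h x =>
  induction g using ind with | h y => exact sound (.smul_mul c x y)

protected theorem mul_smul (c d : k) (f : MP k X) : (c * d) • f = c • (d • f) := by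
  induction f using ind with | h x => exact sound (.mul_smul c d x)

protected theorem smul_zero (c : k) : c • (0 : MP k X) = 0 := by
  have h := MP.mul_smul c 0 (0 : MP k X)
  rw [mul_zero, MP.zero_smul] at h
  exact h.symm

protected theorem zero_mul (f : MP k X) : 0 * f = 0 := by
  have h := MP.smul_mul 0 (0 : MP k X) f
  rwa [MP.zero_smul, MP.zero_smul] at h

instance : NonUnitalCommRing (MP k X) where
  add_assoc f g h := by
    induction f using ind with | h x =>
    induction g using ind with | h y =>
    induction h using ind with | h z => exact sound (.add_assoc x y z)
  zero_add := MP.zero_add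
  add_zero f := by rw [MP.add_comm, MP.zero_add]
  add_comm := MP.add_comm
  neg_add_cancel f := by
    change (-1 : k) • f + f = 0
    conv_lhs => rw [← MP.one_smul f, ← MP.mul_smul, ← MP.add_smul]
    simp [MP.zero_smul]
  nsmul := nsmulRec
  zsmul := zsmulRec
  mul_assoc f g h := by
    induction f using ind with | h x =>
    induction g using ind with | h y =>
    induction h using ind with | h z => exact sound (.mul_assoc x y z)
  mul_comm := MP.mul_comm
  right_distrib := MP.add_mul
  left_distrib f g h := by rw [MP.mul_comm, MP.add_mul, MP.mul_comm g, MP.mul_comm h]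
  zero_mul := MP.zero_mul
  mul_zero f := by rw [MP.mul_comm, MP.zero_mul]

instance : Module k (MP k X) where
  one_smul := MP.one_smul
  mul_smul := MP.mul_smul
  smul_zero := MP.smul_zero
  smul_add c f g := by
    induction f using ind with | h x =>
    induction g using ind with | h y => exact sound (.smul_add c x y)
  add_smul := MP.add_smul
  zero_smul := MP.zero_smul

instance : PoissonAlgebra k (MP k X) where
  smul_mul := MP.smul_mul
  add_lie f g h := by
    induction f using ind with | h x =>
    induction g using ind with | h y =>
    induction h using ind with | h z => exact sound (.add_lie x y z)
  lie_add f g h := by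
    induction f using ind with | h x =>
    induction g using ind with | h y =>
    induction h using ind with | h z => exact sound (.lie_add x y z)
  smul_lie c f g := by
    induction f using ind with | h x =>
    induction g using ind with | h y => exact sound (.smul_lie c x y)
  lie_smul c f g := by
    induction f using ind with | h x =>
    induction g using ind with | h y => exact sound (.lie_smul c x y)
  lie_self f := by
    induction f using ind with | h x => exact sound (.lie_self x)
  jacobi f g h := by
    induction f using ind with | h x =>
    induction g using ind with | h y =>
    induction h using ind with | h z => exact sound (.jacobi x y z)
  leibniz f g h := by
    induction f using ind with | h x =>
    induction g using ind with | h y =>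
    induction h using ind with | h z => exact sound (.leibniz x y z)

theorem square_eq_span : square k (MP k X) =
    Submodule.span k {f | ∃ x : Pre k X, x.IsProduct ∧ f = mk x} := by
  unfold square
  rw [← Submodule.span_union]
  congr 1
  ext f
  constructor
  · rintro (⟨g, h, rfl⟩ | ⟨g, h, rfl⟩)
    · induction g using ind with | h x =>
      induction h using ind with | h y => exact ⟨_, .mul x y, rfl⟩
    · induction g using ind with | h x =>
      induction h using ind with | h y => exact ⟨_, .lie x y, rfl⟩
  · rintro ⟨x, hx, rfl⟩
    cases hx with
    | mul x y => exact Or.inl ⟨mk x, mk y, rfl⟩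
    | lie x y => exact Or.inr ⟨mk x, mk y, rfl⟩

/-- The algebra `MP k X` is metabelian. -/
theorem isMetabelian : IsMetabelian k (MP k X) := by
  intro f hf g hg
  rw [square_eq_span] at hf hg
  induction hf, hg using Submodule.span_induction₂ with
  | mem_mem f g hf hg =>
    obtain ⟨x, hx, rfl⟩ := hf
    obtain ⟨y, hy, rfl⟩ := hg
    exact ⟨sound (.mul_zero hx hy), sound (.lie_zero hx hy)⟩
  | zero_left g _ =>
    refine ⟨zero_mul _, ?_⟩
    rw [← zero_smul k (0 : MP k X), PoissonAlgebra.smul_lie, zero_smul, zero_smul]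
  | zero_right f _ =>
    refine ⟨mul_zero _, ?_⟩
    rw [← zero_smul k (0 : MP k X), PoissonAlgebra.lie_smul, zero_smul, zero_smul]
  | add_left f f' g _ _ _ h h' =>
    rw [add_mul, PoissonAlgebra.add_lie (k := k), h.1, h.2, h'.1, h'.2]; simp
  | add_right f g g' _ _ _ h h' =>
    rw [mul_add, PoissonAlgebra.lie_add (k := k), h.1, h.2, h'.1, h'.2]; simp
  | smul_left c f g _ _ h =>
    rw [MP.smul_mul, PoissonAlgebra.smul_lie, h.1, h.2]; simp
  | smul_right c f g _ _ h =>
    rw [mul_comm, MP.smul_mul, mul_comm, PoissonAlgebra.lie_smul, h.1, h.2]; simp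

/-- Evaluation of expressions in a Poisson algebra. -/
def evalPre {P : Type w} [NonUnitalCommRing P] [Module k P] [PoissonAlgebra k P] (φ : X → P) :
    Pre k X → P
  | .var a => φ a
  | .zero => 0
  | .add x y => evalPre φ x + evalPre φ y
  | .smul c x => c • evalPre φ x
  | .mul x y => evalPre φ x * evalPre φ y
  | .lie x y => ⁅evalPre φ x, evalPre φ y⁆

theorem evalPre_mem_square {P : Type w} [NonUnitalCommRing P] [Module k P] [PoissonAlgebra k P]
    (φ : X → P) {x : Pre k X} (hx : x.IsProduct) : evalPre φ x ∈ square k P := by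
  cases hx with
  | mul x y => exact Submodule.mem_sup_left (Submodule.subset_span ⟨_, _, rfl⟩)
  | lie x y => exact Submodule.mem_sup_right (Submodule.subset_span ⟨_, _, rfl⟩)

theorem evalPre_rel {P : Type w} [NonUnitalCommRing P] [Module k P] [PoissonAlgebra k P]
    (hP : IsMetabelian k P) (φ : X → P) {x y : Pre k X} (h : Rel k X x y) :
    evalPre φ x = evalPre φ y := by
  induction h with
  | add_congr_left z _ ih => simp only [evalPre, ih]
  | add_congr_right z _ ih => simp only [evalPre, ih]
  | smul_congr c _ ih => simp only [evalPre, ih]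
  | mul_congr_left z _ ih => simp only [evalPre, ih]
  | mul_congr_right z _ ih => simp only [evalPre, ih]
  | lie_congr_left z _ ih => simp only [evalPre, ih]
  | lie_congr_right z _ ih => simp only [evalPre, ih]
  | add_assoc x y z => exact _root_.add_assoc _ _ _
  | add_comm x y => exact _root_.add_comm _ _
  | zero_add x => exact _root_.zero_add _
  | one_smul x => exact _root_.one_smul _ _
  | mul_smul c d x => exact SemigroupAction.mul_smul _ _ _
  | smul_add c x y => exact _root_.smul_add _ _ _
  | add_smul c d x => exact _root_.add_smul _ _ _
  | zero_smul x => exact _root_.zero_smul _ _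
  | add_mul x y z => exact _root_.add_mul _ _ _
  | smul_mul c x y => exact PoissonAlgebra.smul_mul _ _ _
  | mul_comm x y => exact _root_.mul_comm _ _
  | mul_assoc x y z => exact _root_.mul_assoc _ _ _
  | add_lie x y z => exact PoissonAlgebra.add_lie (k := k) _ _ _
  | lie_add x y z => exact PoissonAlgebra.lie_add (k := k) _ _ _
  | smul_lie c x y => exact PoissonAlgebra.smul_lie _ _ _
  | lie_smul c x y => exact PoissonAlgebra.lie_smul _ _ _
  | lie_self x => exact PoissonAlgebra.lie_self (k := k) _
  | jacobi x y z => exact PoissonAlgebra.jacobi (k := k) _ _ _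
  | leibniz x y z => exact PoissonAlgebra.leibniz (k := k) _ _ _
  | mul_zero hx hy => exact (hP _ (evalPre_mem_square φ hx) _ (evalPre_mem_square φ hy)).1
  | lie_zero hx hy => exact (hP _ (evalPre_mem_square φ hx) _ (evalPre_mem_square φ hy)).2

/-- The universal property: every map from `X` to a metabelian Poisson algebra extends uniquely to
a homomorphism of Poisson algebras on `MP k X`. -/
theorem existsUnique_lift {P : Type w} [NonUnitalCommRing P] [Module k P] [PoissonAlgebra k P]
    (hP : IsMetabelian k P) (φ : X → P) :
    ∃! F : MP k X →ₗ[k] P, (∀ a, F (ι a) = φ a) ∧ (∀ f g, F (f * g) = F f * F g) ∧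
      ∀ f g, F ⁅f, g⁆ = ⁅F f, F g⁆ := by
  refine ⟨{ toFun := Quot.lift (evalPre φ) fun _ _ h => evalPre_rel hP φ h
            map_add' := ?_, map_smul' := ?_ }, ⟨fun _ => rfl, ?_, ?_⟩, ?_⟩
  · intro f g
    induction f using ind with | h x =>
    induction g using ind with | h y => rfl
  · intro c f
    induction f using ind with | h x => rfl
  · intro f g
    induction f using ind with | h x =>
    induction g using ind with | h y => rfl
  · intro f g
    induction f using ind with | h x =>
    induction g using ind with | h y => rfl
  · rintro G ⟨h1, h2, h3⟩
    ext f
    induction f using ind with | h x =>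
    change G (mk x) = evalPre φ x
    induction x with
    | var a => exact h1 a
    | zero => rw [mk_zero, map_zero]; rfl
    | add x y hx hy => rw [mk_add, map_add, hx, hy]; rfl
    | smul c x hx => rw [mk_smul, map_smul, hx]; rfl
    | mul x y hx hy => rw [mk_mul, h2, hx, hy]; rfl
    | lie x y hx hy => rw [mk_lie, h3, hx, hy]; rfl

/-- `bracket f [a₁, …, aₙ]` is the left-normed bracket `(…((f, a₁), a₂), …, aₙ)`. -/
def bracket (f : MP k X) (as : List X) : MP k X := as.foldl (fun g a => ⁅g, ι a⁆) f

/-- The ideal of `MP k X` generated by `S`. -/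
def idealSpan (S : Set (MP k X)) : Submodule k (MP k X) :=
  sInf {I | S ⊆ I ∧ ∀ f ∈ I, ∀ g, f * g ∈ I ∧ ⁅f, g⁆ ∈ I}

end MP

/-! ### The monomial basis and its order -/

/-- Monomials: `lie a [a₂, …, aₙ]` stands for the left-normed bracket of `a, a₂, …, aₙ` (a letter if
the list is empty), `com a [a₂, …, aₙ]` for `a · a₂ ⋯ aₙ`, and `mix a [a₂, …, aₙ] b` for the product
of the left-normed bracket of `a, a₂, …, aₙ` by `b`. -/
inductive Word (X : Type v) : Type v
  | lie (a : X) (as : List X) : Word X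
  | com (a : X) (as : List X) : Word X
  | mix (a : X) (as : List X) (b : X) : Word X

namespace Word

variable {X : Type v}

/-- The letters of a monomial, from left to right. -/
def letters : Word X → List X
  | lie a as => a :: as
  | com a as => a :: as
  | mix a as b => a :: (as ++ [b])

/-- The length of a monomial. -/
def len (W : Word X) : ℕ := W.letters.length

/-- The number of Poisson brackets in a monomial. -/
def pb : Word X → ℕ
  | lie _ as => as.length
  | com _ _ => 0
  | mix _ as _ => as.length

/-- The weight `(ℓ(W), Pb(W), a₁, …, aₙ)`, in the lexicographic order. -/
def wt (W : Word X) : ℕ ×ₗ ℕ ×ₗ List X := toLex (W.len, toLex (W.pb, W.letters))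

/-- The element of the free algebra that a monomial stands for. -/
def eval (k : Type u) [Field k] : Word X → MP k X
  | lie a as => MP.bracket (MP.ι a) as
  | com a as => as.foldl (fun g c => g * MP.ι c) (MP.ι a)
  | mix a as b => MP.bracket (MP.ι a) as * MP.ι b

/-- The monomials that belong to the basis; those with four or more letters that involve both
operations depend on the characteristic of `k`. -/
inductive IsBasic (k : Type u) [Field k] [LinearOrder X] : Word X → Prop
  | letter (a : X) : IsBasic k (lie a [])
  | lie (a₁ a₂ : X) (as : List X) : a₂ < a₁ → (a₂ :: as).Pairwise (· ≤ ·) →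
      IsBasic k (lie a₁ (a₂ :: as))
  | com₂ (a₁ a₂ : X) : a₁ ≤ a₂ → IsBasic k (com a₁ [a₂])
  | com₃ (a₁ a₂ a₃ : X) : a₁ ≤ a₂ → a₂ ≤ a₃ → IsBasic k (com a₁ [a₂, a₃])
  | mix₃ (a₁ a₂ a₃ : X) : a₂ < a₁ → IsBasic k (mix a₁ [a₂] a₃)
  | mix₄ (a₁ a₂ a₃ a₄ : X) : ringChar k ≠ 2 → a₂ < a₁ → a₁ ≤ a₄ → a₂ ≤ a₃ → a₃ < a₄ →
      IsBasic k (mix a₁ [a₂, a₃] a₄)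
  | mix (a₁ a₂ a₃ : X) (as : List X) (b : X) : ringChar k = 2 → a₂ < a₁ →
      (a₂ :: a₃ :: (as ++ [b])).Pairwise (· ≤ ·) → IsBasic k (mix a₁ (a₂ :: a₃ :: as) b)

end Word

/-- The set of basis monomials of the free metabelian Poisson algebra. -/
def MPB (k : Type u) (X : Type v) [Field k] [LinearOrder X] : Type v :=
  {W : Word X // W.IsBasic k}

namespace MPB

variable {k : Type u} {X : Type v} [Field k] [LinearOrder X]

theorem wt_injective : Function.Injective fun W : MPB k X => W.1.wt := by
  rintro ⟨W, hW⟩ ⟨W', hW'⟩ h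
  apply Subtype.ext
  simp only [Word.wt, toLex_inj, Prod.mk.injEq] at h
  obtain ⟨h1, h2, h3⟩ := h
  cases hW <;> cases hW' <;> simp_all [Word.len, Word.pb, Word.letters]

/-- Monomials are compared through their weights. -/
noncomputable instance : LinearOrder (MPB k X) := LinearOrder.lift' _ wt_injective

end MPB

namespace MP

variable {k : Type u} {X : Type v} [Field k] [LinearOrder X]

/-- The coordinates of `f` in the basis `MPB k X`: the finitely supported family `α` with
`f = ∑ α_W W`. -/
noncomputable def coords (f : MP k X) : MPB k X →₀ k :=
  Function.invFun (Finsupp.linearCombination k fun W : MPB k X => W.1.eval k) f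

/-- The leading monomial of `f`, where `⊥` plays the role of the leading monomial of `0`. -/
noncomputable def lm (f : MP k X) : WithBot (MPB k X) := (coords f).support.max

/-- `f` is nonzero with leading coefficient `1`. -/
def IsMonic (f : MP k X) : Prop := ∃ W : MPB k X, lm f = W ∧ coords f W = 1

/-- Normal `S`-polynomials. -/
inductive IsNormal (S : Set (MP k X)) : MP k X → Prop
  | base (s : MP k X) : s ∈ S → IsNormal S s
  | bracket (s : MP k X) (as : List X) (W : MPB k X) : s ∈ S → lm s = W → 5 ≤ W.1.len →
      IsNormal S (bracket s as)

/-- Multiplication compositions of `S`. -/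
inductive IsMulComposition (S : Set (MP k X)) : MP k X → Prop
  | mul (s : MP k X) (a : X) : s ∈ S → IsMulComposition S (s * ι a)
  | mul_lie (s : MP k X) (a₁ a₂ : X) : s ∈ S → a₂ < a₁ →
      IsMulComposition S (s * ⁅(ι a₁ : MP k X), (ι a₂ : MP k X)⁆)
  | lie_lie (s : MP k X) (a₁ a₂ : X) : s ∈ S → a₂ < a₁ →
      IsMulComposition S ⁅s, ⁅(ι a₁ : MP k X), (ι a₂ : MP k X)⁆⁆
  | lie (s : MP k X) (a : X) (W : MPB k X) : s ∈ S → lm s = W → W.1.len ≤ 4 →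
      IsMulComposition S ⁅s, (ι a : MP k X)⁆

/-- `S` is trivial under multiplication compositions. -/
def TrivialUnderMulCompositions (S : Set (MP k X)) : Prop :=
  ∀ h, IsMulComposition S h → h ∈ Submodule.span k {g | IsNormal S g ∧ lm g ≤ lm h}

/-- `IsGenComposition S f W`: `f` is a general composition of `S` with respect to `W`. The least
common multiple of two commutative monomials, seen as multisets of letters, is given through the
two complementary factors `p` and `q`, which have no letter in common. -/
inductive IsGenComposition (S : Set (MP k X)) : MP k X → WithBot (MPB k X) → Prop
  | eq (s₁ s₂ : MP k X) : s₁ ∈ S → s₂ ∈ S → lm s₁ = lm s₂ → IsGenComposition S (s₁ - s₂) (lm s₁)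
  | lie (s₁ s₂ : MP k X) (W₁ W₂ : MPB k X) (a : X) (as bs : List X) (p q : Multiset X) :
      s₁ ∈ S → s₂ ∈ S → lm s₁ = W₁ → lm s₂ = W₂ →
      W₁.1 = Word.lie a as → W₂.1 = Word.lie a bs → 4 ≤ as.length → 4 ≤ bs.length →
      (as : Multiset X) + p = (bs : Multiset X) + q → (∀ c ∈ p, c ∉ q) →
      IsGenComposition S (bracket s₁ p.sort - bracket s₂ q.sort) (lm (bracket s₁ p.sort))
  | mix (s₁ s₂ : MP k X) (W₁ W₂ : MPB k X) (a : X) (as bs : List X) (c d : X) (p q : Multiset X) :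
      s₁ ∈ S → s₂ ∈ S → lm s₁ = W₁ → lm s₂ = W₂ →
      W₁.1 = Word.mix a as c → W₂.1 = Word.mix a bs d →
      4 ≤ (as ++ [c]).length → 4 ≤ (bs ++ [d]).length →
      ((as ++ [c] : List X) : Multiset X) + p = ((bs ++ [d] : List X) : Multiset X) + q →
      (∀ e ∈ p, e ∉ q) →
      IsGenComposition S (bracket s₁ p.sort - bracket s₂ q.sort) (lm (bracket s₁ p.sort))

/-- `S` is trivial under general compositions. -/
def TrivialUnderGenCompositions (S : Set (MP k X)) : Prop :=
  ∀ f W, IsGenComposition S f W → f ∈ Submodule.span k {g | IsNormal S g ∧ lm g < W}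

/-- `S` is a Groebner-Shirshov basis for the quotient of `MP k X` by the ideal `I`. -/
def IsGroebnerShirshovBasis (S : Set (MP k X)) (I : Submodule k (MP k X)) : Prop :=
  I = idealSpan S ∧ ∀ f ∈ I, f ≠ 0 → ∃ h, IsNormal S h ∧ lm f = lm h

/-- The basis monomials that are not leading monomials of normal `S`-polynomials. -/
def Irr (S : Set (MP k X)) : Set (MPB k X) :=
  {W | ∀ h, IsNormal S h → (W : WithBot (MPB k X)) ≠ lm h}

/-- The set `B` of monomials is a linear basis of the quotient of `MP k X` by the ideal `I`. -/
def IsBasisOfQuotient (B : Set (MPB k X)) (I : Submodule k (MP k X)) : Prop :=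
  LinearIndependent k (fun W : B => I.mkQ (W.1.1.eval k)) ∧
    Submodule.span k (Set.range fun W : B => I.mkQ (W.1.1.eval k)) = ⊤

end MP

end MetabelianPoisson

namespace MetabelianPoisson

universe u v w

/-! ### Calculus of brackets and products in the free algebra -/

namespace MP

variable {k : Type u} {X : Type v} [Field k]

/-! The theorem is Buchberger's argument with the letters of X as operators, resting on two facts:
the monomials really form a linear basis, and in length at least five a bracket with a letter acts
on them in an order-preserving way.

On P² brackets with letters commute, and (f, xy) = 0 gives (f, x)y = -(f, y)x for f in P². Hence [f,
x, y]z is symmetric in x, y and skew in y, z, so twice it vanishes. Away from characteristic 2 this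
kills mixed products of length at least five, and in length four [a, b, c]·d has the symmetries of a
curvature tensor. In characteristic 2 the signs disappear, and a product with a letter is as
symmetric as a bracket. So from length five on a monomial is a commutative word acting on (b, c),
and Jacobi's identity moves the smallest letter to second place (`run_mem_lenSpan`); this gives
spanning. Independence comes from explicit metabelian algebras V ⊕ M (`ExtensionDatum`) and the
universal property: polynomials, Magnus determinants and a variant of them in characteristic 2, and
products of minors yield functionals that are triangular for the order (`exists_dual`).

In length at least five, a bracket with a inserts a into the sorted tail of the leading monomial and
preserves strict inequalities (`lie_of_isLong`). Trivial multiplication compositions take care of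
the remaining operations, so Id(S) is the linear span of the normal polynomials (`idealSpan_le`).
Trivial general compositions make two normal polynomials with the same leading monomial agree up to
smaller ones (`IsNormal.sub_mem`): the letters common to both are split off, the rest is a
composition, and the common letters are put back. Reordering letters costs only short normal
polynomials (`bracket_perm_sub_mem`). A well-founded descent then finds the leading monomial of any
nonzero element of Id(S) among those of the normal polynomials (`exists_normal_of_mem_nspan`).

Conversely, division by normal polynomials writes each element of Id(S) through normal polynomials
not exceeding its leading monomial, and every composition lies in Id(S). Irreducible monomials
always span the quotient; they are independent exactly when no nonzero element of Id(S) has an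
irreducible leading monomial. -/

theorem add_lie (f g h : MP k X) : ⁅f + g, h⁆ = ⁅f, h⁆ + ⁅g, h⁆ :=
  PoissonAlgebra.add_lie (k := k) f g h

theorem lie_add (f g h : MP k X) : ⁅f, g + h⁆ = ⁅f, g⁆ + ⁅f, h⁆ :=
  PoissonAlgebra.lie_add (k := k) f g h

theorem smul_lie (c : k) (f g : MP k X) : ⁅c • f, g⁆ = c • ⁅f, g⁆ :=
  PoissonAlgebra.smul_lie c f g

theorem lie_smul (c : k) (f g : MP k X) : ⁅f, c • g⁆ = c • ⁅f, g⁆ :=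
  PoissonAlgebra.lie_smul c f g

theorem lie_self (f : MP k X) : ⁅f, f⁆ = 0 := PoissonAlgebra.lie_self (k := k) f

theorem jacobi (f g h : MP k X) : ⁅⁅f, g⁆, h⁆ + ⁅⁅g, h⁆, f⁆ + ⁅⁅h, f⁆, g⁆ = 0 :=
  PoissonAlgebra.jacobi (k := k) f g h

theorem leibniz (f g h : MP k X) : ⁅f, g * h⁆ = ⁅f, g⁆ * h + g * ⁅f, h⁆ :=
  PoissonAlgebra.leibniz (k := k) f g h

/-- The bracket as a bilinear map. -/
def lieₗ : MP k X →ₗ[k] MP k X →ₗ[k] MP k X :=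
  LinearMap.mk₂ k (fun f g => ⁅f, g⁆) add_lie smul_lie lie_add lie_smul

/-- The product as a bilinear map. -/
def mulₗ : MP k X →ₗ[k] MP k X →ₗ[k] MP k X :=
  LinearMap.mk₂ k (fun f g => f * g) add_mul MP.smul_mul mul_add fun c f g => by
    rw [mul_comm, MP.smul_mul, mul_comm]

theorem mulₗ_apply (f g : MP k X) : mulₗ f g = f * g := rfl

theorem zero_lie (f : MP k X) : ⁅(0 : MP k X), f⁆ = 0 := LinearMap.map_zero₂ lieₗ f

theorem lie_zero (f : MP k X) : ⁅f, (0 : MP k X)⁆ = 0 := map_zero (lieₗ f)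

theorem neg_lie (f g : MP k X) : ⁅-f, g⁆ = -⁅f, g⁆ := LinearMap.map_neg₂ lieₗ f g

theorem lie_neg (f g : MP k X) : ⁅f, -g⁆ = -⁅f, g⁆ := map_neg (lieₗ f) g

theorem sub_lie (f g h : MP k X) : ⁅f - g, h⁆ = ⁅f, h⁆ - ⁅g, h⁆ := LinearMap.map_sub₂ lieₗ f g h

theorem lie_skew (f g : MP k X) : ⁅f, g⁆ = -⁅g, f⁆ := by
  have h := lie_self (f + g)
  rw [add_lie, lie_add, lie_add, lie_self, lie_self] at h
  rw [eq_neg_iff_add_eq_zero]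
  simpa using h

/-- Jacobi's identity as a derivation rule for `⁅·, h⁆`. -/
theorem lie_lie_right (f g h : MP k X) : ⁅⁅f, g⁆, h⁆ = ⁅⁅f, h⁆, g⁆ - ⁅⁅g, h⁆, f⁆ := by
  have h1 := jacobi f g h
  rw [lie_skew h f, neg_lie] at h1
  linear_combination (norm := abel) h1

theorem lie_lie (f g h : MP k X) : ⁅f, ⁅g, h⁆⁆ = ⁅⁅f, g⁆, h⁆ - ⁅⁅f, h⁆, g⁆ := by
  rw [lie_lie_right f g h, lie_skew f ⁅g, h⁆]
  abel

theorem mul_lie (f g h : MP k X) : ⁅f * g, h⁆ = ⁅f, h⁆ * g + f * ⁅g, h⁆ := by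
  rw [lie_skew, leibniz, lie_skew h f, lie_skew h g]
  noncomm_ring

/-- A subspace which is stable under the operations with letters is an ideal. -/
theorem mul_lie_mem_of_letters {U : Submodule k (MP k X)} (hm : ∀ f ∈ U, ∀ a, f * ι a ∈ U)
    (hl : ∀ f ∈ U, ∀ a, ⁅f, (ι a : MP k X)⁆ ∈ U) (g : MP k X) :
    ∀ f ∈ U, f * g ∈ U ∧ ⁅f, g⁆ ∈ U := by
  induction g using ind with | h x =>
  induction x with
  | var a => exact fun f hf => ⟨hm f hf a, hl f hf a⟩
  | zero => exact fun f _ => by rw [mk_zero, mul_zero, lie_zero]; exact ⟨U.zero_mem, U.zero_mem⟩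
  | add x y hx hy =>
    intro f hf
    rw [mk_add, mul_add, lie_add]
    exact ⟨U.add_mem (hx f hf).1 (hy f hf).1, U.add_mem (hx f hf).2 (hy f hf).2⟩
  | smul c x hx =>
    intro f hf
    rw [mk_smul, lie_smul, ← mulₗ_apply, map_smul]
    exact ⟨U.smul_mem c (hx f hf).1, U.smul_mem c (hx f hf).2⟩
  | mul x y hx hy =>
    intro f hf
    rw [mk_mul, ← mul_assoc, leibniz, _root_.mul_comm (mk x)]
    exact ⟨(hy _ (hx f hf).1).1, U.add_mem (hy _ (hx f hf).2).1 (hx _ (hy f hf).2).1⟩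
  | lie x y hx hy =>
    intro f hf
    rw [mk_lie, lie_lie]
    refine ⟨?_, U.sub_mem (hy _ (hx f hf).2).2 (hx _ (hy f hf).2).2⟩
    -- The Leibniz identity reduces the product with a bracket to operations with x and y
    -- separately.
    have h : f * ⁅mk x, mk y⁆ = ⁅f * mk x, mk y⁆ - ⁅f, mk y⁆ * mk x := by
      rw [mul_lie]; abel
    rw [h]
    exact U.sub_mem (hy _ (hx f hf).1).2 (hx _ (hy f hf).2).1

/-! ### Operators on the square -/

theorem mul_mem_square (f g : MP k X) : f * g ∈ square k (MP k X) :=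
  Submodule.mem_sup_left (Submodule.subset_span ⟨f, g, rfl⟩)

theorem lie_mem_square (f g : MP k X) : ⁅f, g⁆ ∈ square k (MP k X) :=
  Submodule.mem_sup_right (Submodule.subset_span ⟨f, g, rfl⟩)

section Square

variable {f : MP k X} (hf : f ∈ square k (MP k X)) (x y z : MP k X)

include hf

theorem mul_eq_zero_of_square {g : MP k X} (hg : g ∈ square k (MP k X)) : f * g = 0 :=
  (isMetabelian f hf g hg).1

theorem lie_eq_zero_of_square {g : MP k X} (hg : g ∈ square k (MP k X)) : ⁅f, g⁆ = 0 :=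
  (isMetabelian f hf g hg).2

theorem lie_lie_comm : ⁅⁅f, x⁆, y⁆ = ⁅⁅f, y⁆, x⁆ := by
  rw [← sub_eq_zero, ← lie_lie, lie_eq_zero_of_square hf (lie_mem_square x y)]

theorem mul_mul_eq_zero : f * x * y = 0 := by
  rw [mul_assoc, mul_eq_zero_of_square hf (mul_mem_square x y)]

theorem mul_lie_comm : ⁅f * x, y⁆ = ⁅f, y⁆ * x := by
  rw [mul_lie, mul_eq_zero_of_square hf (lie_mem_square x y), add_zero]

/-- Both f and x · y lie in P², so their bracket vanishes; the Leibniz identity splits it into two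
terms. -/
theorem lie_mul_skew : ⁅f, x⁆ * y = -(⁅f, y⁆ * x) := by
  have h := lie_eq_zero_of_square hf (mul_mem_square x y)
  rw [leibniz, _root_.mul_comm x] at h
  exact eq_neg_of_add_eq_zero_left h

/-- The expression is symmetric in x, y and skew in y, z. Sorting the letters along two different
chains of transpositions gives opposite signs. -/
theorem two_smul_lie_lie_mul : (2 : k) • (⁅⁅f, x⁆, y⁆ * z) = 0 := by
  have h1 := lie_mul_skew (lie_mem_square f x) y z
  have h2 := lie_mul_skew (lie_mem_square f z) x y
  have h3 := lie_mul_skew (lie_mem_square f y) z x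
  rw [lie_lie_comm hf z x] at h2
  rw [lie_lie_comm hf y z] at h3
  rw [lie_lie_comm hf y x] at h3
  rw [two_smul]
  linear_combination (norm := abel) h1 - h2 + h3

theorem lie_lie_mul_eq_zero (h2 : (2 : k) ≠ 0) : ⁅⁅f, x⁆, y⁆ * z = 0 :=
  (smul_eq_zero.mp (two_smul_lie_lie_mul hf x y z)).resolve_left h2

end Square

theorem bracket_nil (f : MP k X) : bracket f [] = f := rfl

theorem bracket_cons (f : MP k X) (a : X) (as : List X) :
    bracket f (a :: as) = bracket ⁅f, (ι a : MP k X)⁆ as := rfl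

theorem bracket_append (f : MP k X) (as bs : List X) :
    bracket f (as ++ bs) = bracket (bracket f as) bs := List.foldl_append

theorem bracket_concat (f : MP k X) (as : List X) (a : X) :
    bracket f (as ++ [a]) = ⁅bracket f as, (ι a : MP k X)⁆ := bracket_append f as [a]

/-- The iterated bracket as a linear map. -/
def bracketₗ (as : List X) : MP k X →ₗ[k] MP k X where
  toFun f := bracket f as
  map_add' f g := by
    induction as generalizing f g with
    | nil => rfl
    | cons a as ih => rw [bracket_cons, add_lie, ih]; rfl
  map_smul' c f := by
    induction as generalizing f with
    | nil => rfl
    | cons a as ih => rw [bracket_cons, smul_lie, ih]; rfl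

theorem bracket_sub (f g : MP k X) (as : List X) :
    bracket (f - g) as = bracket f as - bracket g as := map_sub (bracketₗ as) f g

theorem bracket_mem_square {f : MP k X} (hf : f ∈ square k (MP k X)) (as : List X) :
    bracket f as ∈ square k (MP k X) := by
  induction as generalizing f with
  | nil => exact hf
  | cons a as ih => exact ih (lie_mem_square _ _)

/-- The commutator of the operators of two letters is the bracket with an element of P², which is
zero on P². -/
theorem bracket_perm {f : MP k X} (hf : f ∈ square k (MP k X)) {as bs : List X}
    (h : as.Perm bs) : bracket f as = bracket f bs := by
  induction h generalizing f with
  | nil => rfl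
  | cons a _ ih => exact ih (lie_mem_square _ _)
  | swap a b l => rw [bracket_cons, bracket_cons, lie_lie_comm hf]; rfl
  | trans _ _ ih1 ih2 => rw [ih1 hf, ih2 hf]

theorem bracket_lie {f : MP k X} (hf : f ∈ square k (MP k X)) (as : List X) (a : X) :
    bracket ⁅f, (ι a : MP k X)⁆ as = ⁅bracket f as, (ι a : MP k X)⁆ := by
  rw [← bracket_cons, ← bracket_concat]
  exact bracket_perm hf (List.perm_append_singleton a as).symm

/-- The action on `f` of a list of letters, either through brackets only, or with the first letter
acting through the product. -/
def run : Bool → MP k X → List X → MP k X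
  | false, f, l => bracket f l
  | true, _, [] => 0
  | true, f, d :: l => bracket f l * ι d

theorem run_sub (ε : Bool) (f g : MP k X) (l : List X) :
    run ε (f - g) l = run ε f l - run ε g l := by
  cases ε with
  | false => exact bracket_sub f g l
  | true =>
    cases l with
    | nil => exact (sub_zero 0).symm
    | cons d l => simp only [run, bracket_sub, sub_mul]

theorem neg_eq_self_of_two (h2 : (2 : k) = 0) (f : MP k X) : -f = f := by
  rw [neg_eq_iff_add_eq_zero, ← two_smul k, h2, zero_smul]

/-- In characteristic 2 the sign of `lie_mul_skew` disappears, so the multiplying letter can be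
exchanged with a bracketing one. -/
theorem run_perm {ε : Bool} (hε : ε = true → (2 : k) = 0) {f : MP k X}
    (hf : f ∈ square k (MP k X)) {l l' : List X} (h : l.Perm l') : run ε f l = run ε f l' := by
  cases ε with
  | false => exact bracket_perm hf h
  | true =>
    induction h with
    | nil => rfl
    | cons a h _ => simp only [run, bracket_perm hf h]
    | swap a b l =>
      simp only [run, bracket_cons, bracket_lie hf]
      rw [lie_mul_skew (bracket_mem_square hf l), neg_eq_self_of_two (hε rfl)]
    | trans _ _ ih1 ih2 => rw [ih1, ih2]

/-- A further letter is needed to carry the multiplication: `run true _ []` is the default value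
zero. -/
theorem run_cons {ε : Bool} (hε : ε = true → (2 : k) = 0) {f : MP k X}
    (hf : f ∈ square k (MP k X)) (a : X) {l : List X} (hl : l ≠ []) :
    run ε f (a :: l) = run ε ⁅f, (ι a : MP k X)⁆ l := by
  cases ε with
  | false => rfl
  | true =>
    cases l with
    | nil => exact absurd rfl hl
    | cons d l => rw [run_perm hε hf (List.Perm.swap d a l)]; rfl

theorem lie_run {ε : Bool} {f : MP k X}
    (hf : f ∈ square k (MP k X)) (a : X) {l : List X} (hl : l ≠ []) :
    ⁅run ε f l, (ι a : MP k X)⁆ = run ε f (l ++ [a]) := by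
  cases ε with
  | false => exact (bracket_concat f l a).symm
  | true =>
    cases l with
    | nil => exact absurd rfl hl
    | cons d l =>
      simp only [run, List.cons_append, bracket_concat]
      rw [mul_lie_comm (bracket_mem_square hf l)]

end MP

theorem ringChar_eq_two_iff (k : Type u) [Field k] : ringChar k = 2 ↔ (2 : k) = 0 := by
  constructor
  · intro h
    have h1 := ringChar.Nat.cast_ringChar (R := k)
    rw [h] at h1
    exact_mod_cast h1
  · intro h
    have h1 : ringChar k ∣ 2 := (ringChar.spec k 2).mp (by exact_mod_cast h)
    exact ((Nat.dvd_prime Nat.prime_two).mp h1).resolve_left CharP.ringChar_ne_one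

namespace MP

variable {k : Type u} {X : Type v} [Field k]

theorem run_lie_lie_right (ε : Bool) (f g h : MP k X) (l : List X) :
    run ε ⁅⁅f, g⁆, h⁆ l = run ε ⁅⁅f, h⁆, g⁆ l - run ε ⁅⁅g, h⁆, f⁆ l := by
  rw [lie_lie_right, run_sub]

/-- This is how a smaller letter a enters the initial bracket. In the product case the
multiplication is first shifted to a letter of l, which is why l must be nonempty. -/
theorem run_jacobi {ε : Bool} (hε : ε = true → (2 : k) = 0) (x y a : X) {l : List X}
    (hl : ε = true → l ≠ []) :
    run ε ⁅(ι x : MP k X), (ι y : MP k X)⁆ (a :: l) =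
      run ε ⁅(ι x : MP k X), (ι a : MP k X)⁆ (y :: l) -
        run ε ⁅(ι y : MP k X), (ι a : MP k X)⁆ (x :: l) := by
  cases ε with
  | false => exact run_lie_lie_right false _ _ _ l
  | true =>
    simp only [run_cons hε (lie_mem_square _ _) _ (hl rfl)]
    exact run_lie_lie_right true _ _ _ l

/-! ### Curvature symmetries of mixed products of length four -/

section Curvature

variable (a b c d : MP k X)

theorem lie_lie_mul_skew_right : ⁅⁅a, b⁆, c⁆ * d = -(⁅⁅a, b⁆, d⁆ * c) :=
  lie_mul_skew (lie_mem_square a b) c d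

theorem lie_lie_mul_skew_left : ⁅⁅a, b⁆, c⁆ * d = -(⁅⁅b, a⁆, c⁆ * d) := by
  rw [lie_skew a b, neg_lie, neg_mul]

theorem lie_lie_mul_cyclic : ⁅⁅a, b⁆, c⁆ * d + ⁅⁅b, c⁆, a⁆ * d + ⁅⁅c, a⁆, b⁆ * d = 0 := by
  rw [← add_mul, ← add_mul, jacobi, zero_mul]

/-- Skewness in both pairs and the cyclic identity imply pair symmetry, as for the Riemann tensor: a
signed sum of four cyclic identities gives twice the claim. -/
theorem lie_lie_mul_pair_symm (h2 : (2 : k) ≠ 0) : ⁅⁅a, b⁆, c⁆ * d = ⁅⁅c, d⁆, a⁆ * b := by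
  have e1 := lie_lie_mul_cyclic a b c d
  have e2 := lie_lie_mul_cyclic b c d a
  have e3 := lie_lie_mul_cyclic c d a b
  have e4 := lie_lie_mul_cyclic d a b c
  rw [lie_lie_mul_skew_left c a b d] at e1
  rw [lie_lie_mul_skew_right b c d a, lie_lie_mul_skew_right c d b a,
    lie_lie_mul_skew_left d b c a, lie_lie_mul_skew_right b d c a] at e2
  rw [lie_lie_mul_skew_left d a c b, lie_lie_mul_skew_right a d c b,
    lie_lie_mul_skew_right a c d b] at e3
  rw [lie_lie_mul_skew_left d a b c, lie_lie_mul_skew_right a b d c] at e4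
  rw [← sub_eq_zero]
  refine (smul_eq_zero.mp ?_).resolve_left h2
  rw [two_smul]
  linear_combination (norm := abel) e1 - e3 - e4 + e2

end Curvature

/-! ### Straightening of long monomials -/

variable [LinearOrder X]

/-- `run` multiplies by the first letter of the list, the mixed monomial by its largest letter;
`run_perm` reconciles them. In the product case this family of monomials starts with four letters,
whence two letters in l. -/
theorem exists_word_of_sorted {ε : Bool} {b c : X} {l : List X} (hcb : c < b)
    (hl : (c :: l).Pairwise (· ≤ ·)) (hε : ε = true → (2 : k) = 0 ∧ 2 ≤ l.length) :
    ∃ W : MPB k X, W.1.letters = b :: c :: l ∧ W.1.pb + ε.toNat = l.length + 1 ∧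
      W.1.eval k = run ε ⁅(ι b : MP k X), (ι c : MP k X)⁆ l := by
  cases ε with
  | false => exact ⟨⟨.lie b (c :: l), .lie b c l hcb hl⟩, rfl, rfl, rfl⟩
  | true =>
    obtain ⟨h2, hlen⟩ := hε rfl
    obtain ⟨e, l, rfl⟩ := List.exists_cons_of_length_pos (by omega : 0 < l.length)
    have hne : l ≠ [] := by rintro rfl; simp at hlen
    obtain ⟨l, d, rfl⟩ := (List.eq_nil_or_concat l).resolve_left hne
    rw [List.concat_eq_append] at hl ⊢
    refine ⟨⟨.mix b (c :: e :: l) d, .mix b c e l d ((ringChar_eq_two_iff k).mpr h2) hcb hl⟩,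
      ?_, ?_, ?_⟩
    · simp [Word.letters]
    · simp [Word.pb]
    · rw [← List.cons_append, run_perm (fun _ => h2) (lie_mem_square _ _)
        (List.perm_append_singleton d (e :: l))]
      rfl

theorem exists_word_of_min {ε : Bool} {b c : X} {l : List X} (hcb : c < b)
    (hl : ∀ x ∈ l, c ≤ x) (hε : ε = true → (2 : k) = 0 ∧ 2 ≤ l.length) :
    ∃ W : MPB k X, W.1.letters = b :: (c ::ₘ (l : Multiset X)).sort ∧
      W.1.pb + ε.toNat = l.length + 1 ∧
      W.1.eval k = run ε ⁅(ι b : MP k X), (ι c : MP k X)⁆ l := by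
  have hs : (c ::ₘ (l : Multiset X)).sort = c :: (l : Multiset X).sort :=
    Multiset.sort_cons _ _ _ (by simpa using hl)
  have hp : ((l : Multiset X).sort).Perm l := by
    rw [← Multiset.coe_eq_coe, Multiset.sort_eq]
  have hsort : (c :: (l : Multiset X).sort).Pairwise (· ≤ ·) := by
    rw [← hs]; exact Multiset.pairwise_sort _ _
  obtain ⟨W, h1, h2, h3⟩ := exists_word_of_sorted (k := k) hcb hsort
    (fun h => by rw [hp.length_eq]; exact hε h)
  refine ⟨W, by rw [h1, hs], by rw [h2, hp.length_eq], ?_⟩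
  rw [h3, run_perm (fun h => (hε h).1) (lie_mem_square _ _) hp]

/-- From five letters on, only brackets and, in characteristic 2, mixed monomials survive, and `run`
treats both uniformly. -/
theorem exists_run_of_five_le {W : MPB k X} (hW : 5 ≤ W.1.len) :
    ∃ (ε : Bool) (b c : X) (l : List X), c < b ∧ (c :: l).Pairwise (· ≤ ·) ∧
      (ε = true → (2 : k) = 0) ∧ 3 ≤ l.length ∧ W.1.letters = b :: c :: l ∧
      W.1.pb + ε.toNat = l.length + 1 ∧
      W.1.eval k = run ε ⁅(ι b : MP k X), (ι c : MP k X)⁆ l := by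
  suffices h : ∃ (ε : Bool) (b c : X) (l : List X), c < b ∧ (c :: l).Pairwise (· ≤ ·) ∧
      (ε = true → (2 : k) = 0) ∧ 3 ≤ l.length ∧ W.1.letters = b :: c :: l ∧
      W.1.pb + ε.toNat = l.length + 1 by
    obtain ⟨ε, b, c, l, h1, h2, h3, h4, h5, h6⟩ := h
    refine ⟨ε, b, c, l, h1, h2, h3, h4, h5, h6, ?_⟩
    obtain ⟨V, h7, h8, h9⟩ := exists_word_of_sorted (k := k) h1 h2
      (fun h => ⟨h3 h, by omega⟩)
    have : W = V := MPB.wt_injective (by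
      simp only [Word.wt, Word.len, h5, h7]
      rw [show W.1.pb = V.1.pb by omega])
    rw [this, h9]
  obtain ⟨W, hb⟩ := W
  cases hb with
  | letter a => simp [Word.len, Word.letters] at hW
  | lie b c l h1 h2 =>
    refine ⟨false, b, c, l, h1, h2, by simp, ?_, rfl, rfl⟩
    simpa [Word.len, Word.letters] using hW
  | com₂ => simp [Word.len, Word.letters] at hW
  | com₃ => simp [Word.len, Word.letters] at hW
  | mix₃ => simp [Word.len, Word.letters] at hW
  | mix₄ => simp [Word.len, Word.letters] at hW
  | mix b c e l d h0 h1 h2 =>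
    refine ⟨true, b, c, e :: (l ++ [d]), h1, h2, fun _ => (ringChar_eq_two_iff k).mp h0, ?_, ?_, ?_⟩
    · simp [Word.len, Word.letters] at hW ⊢
      omega
    · simp [Word.letters]
    · simp [Word.pb]

/-- The span of the basis monomials of length at most `n`. -/
def lenSpan (k : Type u) (X : Type v) [Field k] [LinearOrder X] (n : ℕ) : Submodule k (MP k X) :=
  Submodule.span k {f | ∃ W : MPB k X, W.1.len ≤ n ∧ f = W.1.eval k}

theorem eval_mem_lenSpan (W : MPB k X) {n : ℕ} (h : W.1.len ≤ n) :
    W.1.eval k ∈ lenSpan k X n := Submodule.subset_span ⟨W, h, rfl⟩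

theorem eval_mem_lenSpan' {W : Word X} (hW : W.IsBasic k) {n : ℕ} (h : W.len ≤ n) :
    W.eval k ∈ lenSpan k X n := eval_mem_lenSpan ⟨W, hW⟩ h

theorem lenSpan_mono {m n : ℕ} (h : m ≤ n) : lenSpan k X m ≤ lenSpan k X n :=
  Submodule.span_mono fun _ ⟨W, hW, e⟩ => ⟨W, hW.trans h, e⟩

theorem run_mem_lenSpan_of_min {ε : Bool} {b c : X} {l : List X} {n : ℕ}
    (hl : ∀ x ∈ l, c ≤ x) (hcb : c ≤ b) (hε : ε = true → (2 : k) = 0 ∧ 2 ≤ l.length)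
    (hn : l.length + 2 ≤ n) :
    run ε ⁅(ι b : MP k X), (ι c : MP k X)⁆ l ∈ lenSpan k X n := by
  rcases hcb.eq_or_lt with rfl | hcb
  · rw [lie_self]
    have := run_sub ε (0 : MP k X) 0 l
    rw [sub_self, sub_self] at this
    rw [this]
    exact Submodule.zero_mem _
  · obtain ⟨W, h1, -, h3⟩ := exists_word_of_min (k := k) hcb hl hε
    rw [← h3]
    refine eval_mem_lenSpan W ?_
    simp only [Word.len, h1, List.length_cons, Multiset.length_sort, Multiset.card_cons,
      Multiset.coe_card]
    exact hn

/-- If y is not minimal, Jacobi's identity with the smallest letter of l leaves two terms having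
that letter in second place. -/
theorem run_mem_lenSpan {ε : Bool} (x y : X) {l : List X} {n : ℕ}
    (hε : ε = true → (2 : k) = 0 ∧ 2 ≤ l.length) (hn : l.length + 2 ≤ n) :
    run ε ⁅(ι x : MP k X), (ι y : MP k X)⁆ l ∈ lenSpan k X n := by
  wlog hxy : y ≤ x generalizing x y
  · have := this y x (le_of_not_ge hxy)
    have h := run_sub ε (0 : MP k X) ⁅(ι y : MP k X), (ι x : MP k X)⁆ l
    rw [zero_sub, ← lie_skew] at h
    have h0 := run_sub ε (0 : MP k X) 0 l
    rw [sub_self, sub_self] at h0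
    rw [h, h0, zero_sub]
    exact Submodule.neg_mem _ this
  by_cases hmin : ∀ z ∈ l, y ≤ z
  · exact run_mem_lenSpan_of_min hmin hxy hε hn
  have hp : ((l : Multiset X).sort).Perm l := by
    rw [← Multiset.coe_eq_coe, Multiset.sort_eq]
  rw [← run_perm (fun h => (hε h).1) (lie_mem_square _ _) hp]
  have hs : ((l : Multiset X).sort).Pairwise (· ≤ ·) := Multiset.pairwise_sort _ _
  have hmin' : ¬ ∀ z ∈ (l : Multiset X).sort, y ≤ z := by simpa using hmin
  rw [← hp.length_eq] at hε hn
  generalize (l : Multiset X).sort = s at hs hmin' hε hn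
  cases s with
  | nil => simp at hmin'
  | cons a s =>
    rw [List.pairwise_cons] at hs
    have hay : a < y := by
      by_contra hay
      refine hmin' fun z hz => (le_of_not_gt hay).trans ?_
      rcases List.mem_cons.mp hz with rfl | hz
      exacts [le_rfl, hs.1 z hz]
    rw [run_jacobi (fun h => (hε h).1) x y a (fun h => by
      rintro rfl; simpa using (hε h).2)]
    refine Submodule.sub_mem _ (run_mem_lenSpan_of_min ?_ (hay.le.trans hxy) hε hn)
      (run_mem_lenSpan_of_min ?_ hay.le hε hn)
    · simpa using ⟨hay.le, hs.1⟩
    · simpa using ⟨hay.le.trans hxy, hs.1⟩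

/-! ### Straightening in length four -/

theorem mix_mem_lenSpan (h2 : (2 : k) ≠ 0) (a b c d : X) :
    ⁅⁅(ι a : MP k X), (ι b : MP k X)⁆, (ι c : MP k X)⁆ * ι d ∈ lenSpan k X 4 := by
  have hk : ringChar k ≠ 2 := fun h => h2 ((ringChar_eq_two_iff k).mp h)
  have basic : ∀ a b c d : X, b < a → a ≤ d → b ≤ c → c < d →
      ⁅⁅(ι a : MP k X), (ι b : MP k X)⁆, (ι c : MP k X)⁆ * ι d ∈ lenSpan k X 4 :=
    fun a b c d h1 h2 h3 h4 => eval_mem_lenSpan' (.mix₄ a b c d hk h1 h2 h3 h4) (le_refl 4)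
  wlog hba : b < a generalizing a b
  · rcases (le_of_not_gt hba).eq_or_lt with rfl | hab
    · rw [lie_self, zero_lie, zero_mul]
      exact Submodule.zero_mem _
    · rw [lie_lie_mul_skew_left]
      exact Submodule.neg_mem _ (this b a hab)
  wlog hcd : c < d generalizing c d
  · rcases (le_of_not_gt hcd).eq_or_lt with rfl | hdc
    · rw [lie_lie_mul_pair_symm _ _ _ _ h2, lie_self, zero_lie, zero_mul]
      exact Submodule.zero_mem _
    · rw [lie_lie_mul_skew_right]
      exact Submodule.neg_mem _ (this d c hdc)
  have swap : ∀ a b c d : X, ⁅⁅(ι a : MP k X), (ι b : MP k X)⁆, (ι c : MP k X)⁆ * ι d =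
      ⁅⁅(ι d : MP k X), (ι c : MP k X)⁆, (ι b : MP k X)⁆ * ι a := fun a b c d => by
    rw [lie_lie_mul_pair_symm _ _ _ _ h2, lie_lie_mul_skew_left, lie_lie_mul_skew_right, neg_neg]
  wlog hbc : b ≤ c generalizing a b c d
  · rw [swap]
    exact this d c hcd b a hba (le_of_not_ge hbc)
  rcases hbc.eq_or_lt with rfl | hbc'
  · rcases le_total a d with had | hda
    · exact basic _ _ _ _ hba had le_rfl hcd
    · rw [swap]
      exact basic _ _ _ _ hcd hda le_rfl hba
  rcases le_or_gt a d with had | hda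
  · exact basic _ _ _ _ hba had hbc hcd
  -- The remaining case is b < c < d < a. The cyclic identity puts the largest letter a last in both
  -- terms, which makes them basic.
  have e : ⁅⁅(ι a : MP k X), (ι b : MP k X)⁆, (ι c : MP k X)⁆ * ι d =
      ⁅⁅(ι d : MP k X), (ι b : MP k X)⁆, (ι c : MP k X)⁆ * ι a -
        ⁅⁅(ι c : MP k X), (ι b : MP k X)⁆, (ι d : MP k X)⁆ * ι a := by
    have h := lie_lie_mul_cyclic (ι a : MP k X) (ι b) (ι c) (ι d)
    rw [lie_lie_mul_skew_left (ι b) (ι c), lie_lie_mul_skew_right (ι c) (ι b),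
      lie_lie_mul_skew_left (ι c) (ι a), swap a c b d] at h
    linear_combination (norm := abel) h
  rw [e]
  exact Submodule.sub_mem _ (basic _ _ _ _ (hbc'.trans hcd) hda.le hbc (hcd.trans hda))
    (basic _ _ _ _ hbc' (hcd.trans hda).le (hbc'.trans hcd).le hda)

/-! ### The basis monomials span -/

theorem ι_mul_ι_mem (a b : X) : (ι a * ι b : MP k X) ∈ lenSpan k X 2 := by
  rcases le_total a b with h | h
  · exact eval_mem_lenSpan' (.com₂ a b h) (le_refl 2)
  · rw [_root_.mul_comm]
    exact eval_mem_lenSpan' (.com₂ b a h) (le_refl 2)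

theorem lie_mul_ι_mem (a b c : X) : ⁅(ι a : MP k X), (ι b : MP k X)⁆ * ι c ∈ lenSpan k X 3 := by
  rcases lt_trichotomy a b with h | rfl | h
  · rw [lie_skew, neg_mul]
    exact Submodule.neg_mem _ (eval_mem_lenSpan' (.mix₃ b a c h) (le_refl 3))
  · rw [lie_self, zero_mul]
    exact Submodule.zero_mem _
  · exact eval_mem_lenSpan' (.mix₃ a b c h) (le_refl 3)

theorem ι_mul_ι_mul_ι_mem (a b c : X) : (ι a * ι b * ι c : MP k X) ∈ lenSpan k X 3 := by
  have basic : ∀ a b c : X, a ≤ b → b ≤ c → (ι a * ι b * ι c : MP k X) ∈ lenSpan k X 3 :=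
    fun a b c h1 h2 => eval_mem_lenSpan' (.com₃ a b c h1 h2) (le_refl 3)
  wlog hab : a ≤ b generalizing a b
  · rw [_root_.mul_comm (ι a : MP k X)]
    exact this b a (le_of_not_ge hab)
  rcases le_total b c with hbc | hcb
  · exact basic a b c hab hbc
  rw [_root_.mul_right_comm]
  rcases le_total a c with hac | hca
  · exact basic a c b hac hcb
  · rw [_root_.mul_comm (ι a : MP k X)]
    exact basic c a b hca hab

theorem eval_mul_mem (W : MPB k X) (a : X) :
    W.1.eval k * ι a ∈ lenSpan k X (W.1.len + 1) := by
  obtain ⟨W, hW⟩ := W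
  cases hW with
  | letter b => exact ι_mul_ι_mem b a
  | lie b c l h1 h3 =>
    change bracket ⁅(ι b : MP k X), (ι c : MP k X)⁆ l * ι a ∈ lenSpan k X (l.length + 2 + 1)
    match l with
    | [] => exact lie_mul_ι_mem b c a
    | d :: l =>
      by_cases h2 : (2 : k) = 0
      · exact run_mem_lenSpan (ε := true) (l := a :: d :: l) b c (fun _ => ⟨h2, by simp⟩) (by simp)
      match l with
      | [] => exact mix_mem_lenSpan h2 b c d a
      | e :: l =>
        -- With d and e moved outermost, the double bracket and the product with a are skew enough
        -- to vanish.
        have : bracket ⁅(ι b : MP k X), (ι c : MP k X)⁆ (d :: e :: l) * ι a = 0 := by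
          have hsq := lie_mem_square (ι b : MP k X) (ι c)
          rw [bracket_cons, bracket_lie hsq, bracket_cons, bracket_lie hsq,
            lie_lie_mul_eq_zero (bracket_mem_square hsq l) _ _ _ h2]
        rw [this]
        exact Submodule.zero_mem _
  | com₂ b c => exact ι_mul_ι_mul_ι_mem b c a
  | com₃ b c d =>
    change ι b * ι c * ι d * ι a ∈ _
    rw [mul_mul_eq_zero (mul_mem_square _ _)]
    exact Submodule.zero_mem _
  | mix₃ b c d =>
    change ⁅(ι b : MP k X), (ι c : MP k X)⁆ * ι d * ι a ∈ _
    rw [mul_mul_eq_zero (lie_mem_square _ _)]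
    exact Submodule.zero_mem _
  | mix₄ b c d e =>
    change ⁅⁅(ι b : MP k X), (ι c : MP k X)⁆, (ι d : MP k X)⁆ * ι e * ι a ∈ _
    rw [mul_mul_eq_zero (lie_mem_square _ _)]
    exact Submodule.zero_mem _
  | mix b c d l e =>
    change bracket ⁅⁅(ι b : MP k X), (ι c : MP k X)⁆, (ι d : MP k X)⁆ l * ι e * ι a ∈ _
    rw [mul_mul_eq_zero (bracket_mem_square (lie_mem_square _ _) _)]
    exact Submodule.zero_mem _

theorem eval_lie_mem (W : MPB k X) (a : X) :
    ⁅W.1.eval k, (ι a : MP k X)⁆ ∈ lenSpan k X (W.1.len + 1) := by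
  by_cases h5 : 5 ≤ W.1.len
  · obtain ⟨ε, b, c, l, -, -, h3, h4, h5, -, h7⟩ := exists_run_of_five_le h5
    rw [h7, lie_run (lie_mem_square _ _) a (by rintro rfl; simp at h4)]
    refine run_mem_lenSpan b c (fun h => ⟨h3 h, ?_⟩) ?_ <;> simp [Word.len, h5]; omega
  obtain ⟨W, hW⟩ := W
  cases hW with
  | letter b => exact run_mem_lenSpan (ε := false) (l := []) b a (by simp) (le_refl 2)
  | lie b c l h1 h3 =>
    change ⁅bracket ⁅(ι b : MP k X), (ι c : MP k X)⁆ l, (ι a : MP k X)⁆ ∈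
      lenSpan k X (l.length + 2 + 1)
    rw [← bracket_concat]
    exact run_mem_lenSpan (ε := false) b c (by simp) (by simp)
  | com₂ b c =>
    change ⁅(ι b * ι c : MP k X), (ι a : MP k X)⁆ ∈ lenSpan k X 3
    rw [mul_lie, _root_.mul_comm (ι b : MP k X)]
    exact Submodule.add_mem _ (lie_mul_ι_mem _ _ _) (lie_mul_ι_mem _ _ _)
  | com₃ b c d =>
    change ⁅(ι b * ι c * ι d : MP k X), (ι a : MP k X)⁆ ∈ lenSpan k X 4
    rw [mul_lie_comm (mul_mem_square _ _), mul_lie, add_mul,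
      mul_mul_eq_zero (lie_mem_square _ _), _root_.mul_comm (ι b : MP k X),
      mul_mul_eq_zero (lie_mem_square _ _), add_zero]
    exact Submodule.zero_mem _
  | mix₃ b c d =>
    change ⁅⁅(ι b : MP k X), (ι c : MP k X)⁆ * ι d, (ι a : MP k X)⁆ ∈ lenSpan k X 4
    rw [mul_lie_comm (lie_mem_square _ _)]
    by_cases h2 : (2 : k) = 0
    · exact run_mem_lenSpan (ε := true) (l := [d, a]) b c (fun _ => ⟨h2, by simp⟩) (by simp)
    · exact mix_mem_lenSpan h2 b c a d
  | mix₄ b c d e hk =>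
    change ⁅⁅⁅(ι b : MP k X), (ι c : MP k X)⁆, (ι d : MP k X)⁆ * ι e, (ι a : MP k X)⁆ ∈ _
    rw [mul_lie_comm (lie_mem_square _ _), lie_lie_mul_eq_zero (lie_mem_square _ _) _ _ _
      (fun h => hk ((ringChar_eq_two_iff k).mpr h))]
    exact Submodule.zero_mem _
  | mix b c d l e hk =>
    change ⁅bracket ⁅⁅(ι b : MP k X), (ι c : MP k X)⁆, (ι d : MP k X)⁆ l * ι e,
      (ι a : MP k X)⁆ ∈ _
    rw [mul_lie_comm (bracket_mem_square (lie_mem_square _ _) _), ← bracket_concat]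
    refine run_mem_lenSpan (ε := true) (l := e :: d :: (l ++ [a])) b c
      (fun _ => ⟨(ringChar_eq_two_iff k).mp hk, by simp⟩) ?_
    simp [Word.len, Word.letters]

theorem lie_mem_lenSpan {f : MP k X} {n : ℕ} (hf : f ∈ lenSpan k X n) (a : X) :
    ⁅f, (ι a : MP k X)⁆ ∈ lenSpan k X (n + 1) := by
  change lieₗ.flip (ι a) f ∈ _
  refine (Submodule.span_le (p := (lenSpan k X (n + 1)).comap (lieₗ.flip (ι a)))).mpr ?_ hf
  rintro _ ⟨W, hW, rfl⟩
  exact lenSpan_mono (by omega) (eval_lie_mem W a)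

/-- The span contains the letters and is stable under operations with letters. It is therefore an
ideal, and induction on expressions applies. -/
theorem span_eval_eq_top :
    Submodule.span k (Set.range fun W : MPB k X => W.1.eval k) = ⊤ := by
  set U := Submodule.span k (Set.range fun W : MPB k X => W.1.eval k) with hU
  have hle (n : ℕ) : lenSpan k X n ≤ U := Submodule.span_mono fun _ ⟨W, _, e⟩ => ⟨W, e.symm⟩
  have hm : ∀ f ∈ U, ∀ a, f * ι a ∈ U := fun f hf a => by
    refine (Submodule.span_le (p := U.comap (mulₗ.flip (ι a)))).mpr ?_ hf
    rintro _ ⟨W, rfl⟩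
    exact hle _ (eval_mul_mem W a)
  have hl : ∀ f ∈ U, ∀ a, ⁅f, (ι a : MP k X)⁆ ∈ U := fun f hf a => by
    refine (Submodule.span_le (p := U.comap (lieₗ.flip (ι a)))).mpr ?_ hf
    rintro _ ⟨W, rfl⟩
    exact hle _ (eval_lie_mem W a)
  rw [eq_top_iff]
  rintro f -
  induction f using ind with | h x =>
  induction x with
  | var a => exact Submodule.subset_span ⟨⟨.lie a [], .letter a⟩, rfl⟩
  | zero => exact U.zero_mem
  | add x y hx hy => exact U.add_mem hx hy
  | smul c x hx => exact U.smul_mem c hx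
  | mul x y hx hy => exact (mul_lie_mem_of_letters hm hl (mk y) _ hx).1
  | lie x y hx hy => exact (mul_lie_mem_of_letters hm hl (mk y) _ hx).2

end MP

/-! ### Metabelian extensions of a vector space -/

/-- The data that turn `V × M` into a metabelian Poisson algebra whose square lies in `M`. -/
structure ExtensionDatum (k : Type*) (V : Type*) (M : Type*) [Field k] [AddCommGroup V]
    [Module k V] [AddCommGroup M] [Module k M] where
  μ : V →ₗ[k] M →ₗ[k] M
  d : V →ₗ[k] M →ₗ[k] M
  q : V →ₗ[k] V →ₗ[k] M
  ω : V →ₗ[k] V →ₗ[k] M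
  q_comm : ∀ u v, q u v = q v u
  ω_self : ∀ u, ω u u = 0
  μ_μ : ∀ u v m, μ u (μ v m) = 0
  μ_q : ∀ u v w, μ w (q u v) = μ u (q v w)
  d_d : ∀ u v m, d u (d v m) = d v (d u m)
  d_ω : ∀ u v w, d w (ω u v) + d u (ω v w) + d v (ω w u) = 0
  μ_d : ∀ v w m, μ w (d v m) + μ v (d w m) = 0
  d_μ : ∀ u w m, d u (μ w m) = μ w (d u m)
  d_q : ∀ u v w, d u (q v w) + μ w (ω u v) + μ v (ω u w) = 0

namespace ExtensionDatum

section

variable {k : Type*} {V : Type*} {M : Type*} [Field k] [AddCommGroup V]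
    [Module k V] [AddCommGroup M] [Module k M]

/-- The algebra defined by the datum. -/
def Alg (_ : ExtensionDatum k V M) : Type _ := V × M

variable (D : ExtensionDatum k V M)

instance : AddCommGroup D.Alg := inferInstanceAs (AddCommGroup (V × M))

instance : Module k D.Alg := inferInstanceAs (Module k (V × M))

variable {D} in
@[ext] theorem Alg.ext {x y : D.Alg} (h1 : x.1 = y.1) (h2 : x.2 = y.2) : x = y := Prod.ext h1 h2

/-- The element of the algebra with given components. -/
def toAlg (u : V) (m : M) : D.Alg := (u, m)

@[simp] theorem fst_toAlg (u : V) (m : M) : (D.toAlg u m).1 = u := rfl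

@[simp] theorem snd_toAlg (u : V) (m : M) : (D.toAlg u m).2 = m := rfl

/-- The first component. -/
def fstₗ : D.Alg →ₗ[k] V := LinearMap.fst k V M

/-- The second component. -/
def sndₗ : D.Alg →ₗ[k] M := LinearMap.snd k V M

@[simp] theorem fstₗ_apply (x : D.Alg) : D.fstₗ x = x.1 := rfl

@[simp] theorem sndₗ_apply (x : D.Alg) : D.sndₗ x = x.2 := rfl

instance : Mul D.Alg := ⟨fun x y => (0, D.μ y.1 x.2 + D.μ x.1 y.2 + D.q x.1 y.1)⟩

instance : Bracket D.Alg D.Alg := ⟨fun x y => (0, D.d y.1 x.2 - D.d x.1 y.2 + D.ω x.1 y.1)⟩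

variable {D}

@[simp] theorem Alg.fst_add (x y : D.Alg) : (x + y).1 = x.1 + y.1 := rfl
@[simp] theorem Alg.snd_add (x y : D.Alg) : (x + y).2 = x.2 + y.2 := rfl
@[simp] theorem Alg.fst_zero : (0 : D.Alg).1 = 0 := rfl
@[simp] theorem Alg.snd_zero : (0 : D.Alg).2 = 0 := rfl
@[simp] theorem Alg.fst_smul (c : k) (x : D.Alg) : (c • x).1 = c • x.1 := rfl
@[simp] theorem Alg.snd_smul (c : k) (x : D.Alg) : (c • x).2 = c • x.2 := rfl
@[simp] theorem Alg.fst_mul (x y : D.Alg) : (x * y).1 = 0 := rfl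
@[simp] theorem Alg.snd_mul (x y : D.Alg) :
    (x * y).2 = D.μ y.1 x.2 + D.μ x.1 y.2 + D.q x.1 y.1 := rfl
@[simp] theorem Alg.fst_lie (x y : D.Alg) : ⁅x, y⁆.1 = 0 := rfl
@[simp] theorem Alg.snd_lie (x y : D.Alg) :
    ⁅x, y⁆.2 = D.d y.1 x.2 - D.d x.1 y.2 + D.ω x.1 y.1 := rfl

instance : NonUnitalCommRing D.Alg where
  __ := (inferInstance : AddCommGroup D.Alg)
  mul_comm x y := by
    ext
    · simp
    · simp only [Alg.snd_mul, D.q_comm x.1 y.1]; abel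
  mul_assoc x y z := by
    ext
    · simp
    · simp only [Alg.snd_mul, Alg.fst_mul, map_add, map_zero, LinearMap.zero_apply, D.μ_μ,
        D.μ_q x.1 y.1 z.1]
      abel
  left_distrib x y z := by
    ext
    · simp
    · simp only [Alg.snd_mul, Alg.fst_add, Alg.snd_add, map_add, LinearMap.add_apply]; abel
  right_distrib x y z := by
    ext
    · simp
    · simp only [Alg.snd_mul, Alg.fst_add, Alg.snd_add, map_add, LinearMap.add_apply]; abel
  zero_mul x := by ext <;> simp
  mul_zero x := by ext <;> simp

instance : PoissonAlgebra k D.Alg where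
  smul_mul c x y := by ext <;> simp
  add_lie x y z := by
    ext
    · simp
    · simp only [Alg.snd_lie, Alg.fst_add, Alg.snd_add, map_add, LinearMap.add_apply]; abel
  lie_add x y z := by
    ext
    · simp
    · simp only [Alg.snd_lie, Alg.fst_add, Alg.snd_add, map_add, LinearMap.add_apply]; abel
  smul_lie c x y := by ext <;> simp [smul_sub]
  lie_smul c x y := by ext <;> simp [smul_sub]
  lie_self x := by ext <;> simp [D.ω_self]
  jacobi x y z := by
    ext
    · simp
    · have h := D.d_ω x.1 y.1 z.1
      simp only [Alg.snd_lie, Alg.fst_lie, Alg.snd_add, map_add, map_sub, map_zero,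
        LinearMap.zero_apply, Alg.snd_zero, D.d_d y.1 x.1, D.d_d z.1 x.1, D.d_d z.1 y.1]
      linear_combination (norm := abel) h
  leibniz x y z := by
    ext
    · simp
    · have h := D.d_q x.1 y.1 z.1
      have h3 := D.μ_d y.1 z.1 x.2
      simp only [Alg.snd_lie, Alg.fst_lie, Alg.snd_add, Alg.fst_mul, Alg.snd_mul, map_add, map_sub,
        map_zero, LinearMap.zero_apply, D.d_μ]
      linear_combination (norm := abel) -h - h3

theorem isMetabelian (D : ExtensionDatum k V M) : IsMetabelian k D.Alg := by
  have key : ∀ x ∈ square k D.Alg, x.1 = 0 := by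
    intro x hx
    have : square k D.Alg ≤ LinearMap.ker D.fstₗ := by
      refine sup_le (Submodule.span_le.mpr ?_) (Submodule.span_le.mpr ?_) <;>
      · rintro _ ⟨x, y, rfl⟩
        rfl
    exact this hx
  intro x hx y hy
  have h1 := key x hx
  have h2 := key y hy
  constructor <;> ext <;> simp [h1, h2]

end

variable {k : Type u} {X : Type v} {V : Type*} {M : Type*} [Field k] [AddCommGroup V]
    [Module k V] [AddCommGroup M] [Module k M] (D : ExtensionDatum k V M) (φ : X → V)

/-- Iterated brackets with letters in the module of the datum. -/
def iter (m : M) (l : List X) : M := l.foldl (fun m c => D.d (φ c) m) m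

theorem iter_cons (m : M) (a : X) (l : List X) :
    D.iter φ m (a :: l) = D.iter φ (D.d (φ a) m) l := rfl

/-- The values of monomials under the homomorphism to `D.Alg` defined by `φ`. -/
theorem exists_linearMap : ∃ (G₀ : MP k X →ₗ[k] V) (G : MP k X →ₗ[k] M),
    (∀ a, G₀ (MP.ι a) = φ a) ∧ (∀ f ∈ square k (MP k X), G₀ f = 0) ∧ (∀ a, G (MP.ι a) = 0) ∧
    (∀ a b l, G (MP.bracket ⁅(MP.ι a : MP k X), (MP.ι b : MP k X)⁆ l) =
      D.iter φ (D.ω (φ a) (φ b)) l) ∧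
    (∀ a b, G (MP.ι a * MP.ι b) = D.q (φ a) (φ b)) ∧
    (∀ a b c, G (MP.ι a * MP.ι b * MP.ι c) = D.μ (φ c) (D.q (φ a) (φ b))) ∧
    ∀ a b l c, G (MP.bracket ⁅(MP.ι a : MP k X), (MP.ι b : MP k X)⁆ l * MP.ι c) =
      D.μ (φ c) (D.iter φ (D.ω (φ a) (φ b)) l) := by
  obtain ⟨F, ⟨h1, h2, h3⟩, -⟩ := MP.existsUnique_lift (k := k) D.isMetabelian
    (fun a : X => D.toAlg (φ a) 0)
  have hbr : ∀ l (f : MP k X) m, F f = D.toAlg 0 m →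
      F (MP.bracket f l) = D.toAlg 0 (D.iter φ m l) := by
    intro l
    induction l with
    | nil => exact fun f m h => h
    | cons a l ih =>
      intro f m h
      refine ih _ _ ?_
      rw [h3, h, h1]
      ext <;> simp
  have hlie : ∀ a b, F ⁅(MP.ι a : MP k X), (MP.ι b : MP k X)⁆ = D.toAlg 0 (D.ω (φ a) (φ b)) :=
    fun a b => by
      rw [h3, h1, h1]
      ext <;> simp
  refine ⟨D.fstₗ ∘ₗ F, D.sndₗ ∘ₗ F,
    fun a => ?_, fun f hf => ?_, fun a => ?_, fun a b l => ?_, fun a b => ?_, fun a b c => ?_,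
    fun a b l c => ?_⟩
  · simp [h1]
  · refine LinearMap.mem_ker.mp ((sup_le (Submodule.span_le.mpr ?_) (Submodule.span_le.mpr ?_) :
      square k (MP k X) ≤ LinearMap.ker _) hf)
    · rintro _ ⟨x, y, rfl⟩
      simp [h2]
    · rintro _ ⟨x, y, rfl⟩
      simp [h3]
  · simp [h1]
  · simp [hbr _ _ _ (hlie a b)]
  · simp [h2, h1]
  · simp [h2, h1]
  · simp [h2, h1, hbr _ _ _ (hlie a b)]

end ExtensionDatum

/-! ### Four concrete extensions -/

namespace ExtensionDatum

variable {k V R : Type*} [Field k] [AddCommGroup V] [Module k V] [CommRing R] [Algebra k R]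

/-- The extension with zero bracket and products `u v`, `u v w` in `R`. -/
def com (x : V →ₗ[k] R) : ExtensionDatum k V (R × R) where
  μ := LinearMap.mk₂ k (fun u m => (0, x u * m.1))
    (fun _ _ _ => by ext <;> simp [add_mul]) (fun _ _ _ => by ext <;> simp)
    (fun _ _ _ => by ext <;> simp [mul_add]) (fun _ _ _ => by ext <;> simp)
  d := 0
  q := LinearMap.mk₂ k (fun u v => (x u * x v, 0))
    (fun _ _ _ => by ext <;> simp [add_mul]) (fun _ _ _ => by ext <;> simp)
    (fun _ _ _ => by ext <;> simp [mul_add]) (fun _ _ _ => by ext <;> simp)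
  ω := 0
  q_comm u v := by ext <;> simp [mul_comm]
  ω_self u := by simp
  μ_μ u v m := by ext <;> simp
  μ_q u v w := by ext <;> simp; ring
  d_d u v m := by simp
  d_ω u v w := by simp
  μ_d u v m := by simp
  d_μ u v m := by ext <;> simp
  d_q u v w := by simp

/-- The extension in which letters act on `R × R` by multiplication, and in which the product with a
letter is the bracket with this letter followed by `(m, n) ↦ (0, c m)`. -/
def magnus (x e : V →ₗ[k] R) (c : R) (hc : 2 * c = 0) : ExtensionDatum k V (R × R) where
  μ := LinearMap.mk₂ k (fun u m => (0, c * (x u * m.1)))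
    (fun _ _ _ => by ext <;> simp ; ring) (fun _ _ _ => by ext <;> simp)
    (fun _ _ _ => by ext <;> simp ; ring) (fun _ _ _ => by ext <;> simp)
  d := LinearMap.mk₂ k (fun u m => (x u * m.1, x u * m.2))
    (fun _ _ _ => by ext <;> simp <;> ring) (fun _ _ _ => by ext <;> simp)
    (fun _ _ _ => by ext <;> simp <;> ring) (fun _ _ _ => by ext <;> simp)
  -- The products of letters cannot be zero: this choice turns the Leibniz condition `d_q` into a
  -- multiple of `2 * c`.
  q := LinearMap.mk₂ k (fun u v => (0, c * (e u * x v + e v * x u)))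
    (fun _ _ _ => by ext <;> simp ; ring) (fun _ _ _ => by ext <;> simp [← smul_add])
    (fun _ _ _ => by ext <;> simp ; ring) (fun _ _ _ => by ext <;> simp [← smul_add])
  ω := LinearMap.mk₂ k (fun u v => (e u * x v - e v * x u, 0))
    (fun _ _ _ => by ext <;> simp ; ring) (fun _ _ _ => by ext <;> simp [smul_sub])
    (fun _ _ _ => by ext <;> simp ; ring) (fun _ _ _ => by ext <;> simp [smul_sub])
  q_comm u v := by ext <;> simp; ring
  ω_self u := by simp
  μ_μ u v m := by ext <;> simp
  μ_q u v w := by ext <;> simp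
  d_d u v m := by ext <;> simp <;> ring
  d_ω u v w := by ext <;> simp; ring
  μ_d u v m := by
    ext <;> simp
    linear_combination x u * x v * m.1 * hc
  d_μ u v m := by ext <;> simp; ring
  d_q u v w := by
    ext <;> simp
    linear_combination x v * x w * e u * hc

/-- The extension for which `⁅a, b⁆ * c` is the product of `α ∧ β` by `γ`. -/
def wedge (α β γ : V →ₗ[k] k) : ExtensionDatum k V (k × (V →ₗ[k] k) × k) where
  μ := LinearMap.mk₂ k (fun u m => (0, 0, γ u * m.1))
    (fun _ _ _ => by ext <;> simp ; ring) (fun _ _ _ => by ext <;> simp ; ring)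
    (fun _ _ _ => by ext <;> simp ; ring) (fun _ _ _ => by ext <;> simp ; ring)
  d := LinearMap.mk₂ k (fun u m => (0, 0, m.2.1 u))
    (fun _ _ _ => by ext <;> simp) (fun _ _ _ => by ext <;> simp)
    (fun _ _ _ => by ext <;> simp) (fun _ _ _ => by ext <;> simp)
  -- The value is a functional that `d` evaluates at u, arranged to cancel the two products in
  -- `d_q`.
  q := LinearMap.mk₂ k (fun v w => (0, γ w • (α v • β - β v • α) + γ v • (α w • β - β w • α), 0))
    (fun _ _ _ => by ext <;> simp ; ring) (fun _ _ _ => by ext <;> simp ; ring)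
    (fun _ _ _ => by ext <;> simp ; ring) (fun _ _ _ => by ext <;> simp ; ring)
  ω := LinearMap.mk₂ k (fun u v => (α u * β v - α v * β u, 0, 0))
    (fun _ _ _ => by ext <;> simp ; ring) (fun _ _ _ => by ext <;> simp ; ring)
    (fun _ _ _ => by ext <;> simp ; ring) (fun _ _ _ => by ext <;> simp ; ring)
  q_comm u v := by ext <;> simp; ring
  ω_self u := by simp
  μ_μ u v m := by ext <;> simp
  μ_q u v w := by ext <;> simp
  d_d u v m := by ext <;> simp
  d_ω u v w := by ext <;> simp
  μ_d u v m := by ext <;> simp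
  d_μ u v m := by ext <;> simp
  d_q u v w := by ext <;> simp; ring

/-- The extension for which `⁅⁅a, b⁆, c⁆ * d` is the product of two minors of size two. -/
def minors (x y : V →ₗ[k] R) :
    ExtensionDatum k V (R × (R × R × R) × (R × R) × (R × R) × R) where
  μ := LinearMap.mk₂ k (fun u m => (0, 0, 0, (m.1 * x u, m.1 * y u),
      m.2.2.1.1 * y u - m.2.2.1.2 * x u))
    (fun _ _ _ => by ext <;> simp <;> ring)
    (fun _ _ _ => by ext <;> simp [smul_sub])
    (fun _ _ _ => by ext <;> simp <;> ring)
    (fun _ _ _ => by ext <;> simp [smul_sub])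
  -- Reading the second and fourth slots as quadratic and linear forms in two variables A, B, the
  -- bracket with u is the derivation x_u ∂_B - y_u ∂_A on them. As q(v, w) is minus the product of
  -- the linear forms of v and w, the condition `d_q` is the product rule.
  d := LinearMap.mk₂ k (fun u m => (0, 0, (m.1 * x u, m.1 * y u),
      (x u * m.2.1.2.1 - 2 * y u * m.2.1.1, 2 * x u * m.2.1.2.2 - y u * m.2.1.2.1),
      x u * m.2.2.2.1.2 - y u * m.2.2.2.1.1))
    (fun _ _ _ => by ext <;> simp <;> ring)
    (fun _ _ _ => by ext <;> simp [smul_sub])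
    (fun _ _ _ => by ext <;> simp <;> ring)
    (fun _ _ _ => by ext <;> simp [smul_sub])
  q := LinearMap.mk₂ k (fun v w =>
      (0, (-(x v * x w), -(x v * y w + x w * y v), -(y v * y w)), 0, 0, 0))
    (fun _ _ _ => by ext <;> simp <;> ring)
    (fun _ _ _ => by ext <;> simp [smul_add])
    (fun _ _ _ => by ext <;> simp <;> ring)
    (fun _ _ _ => by ext <;> simp [smul_add])
  ω := LinearMap.mk₂ k (fun u v => (x u * y v - x v * y u, 0, 0, 0, 0))
    (fun _ _ _ => by ext <;> simp; ring)
    (fun _ _ _ => by ext <;> simp [smul_sub])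
    (fun _ _ _ => by ext <;> simp; ring)
    (fun _ _ _ => by ext <;> simp [smul_sub])
  q_comm u v := by ext <;> simp <;> ring
  ω_self u := by ext <;> simp
  μ_μ u v m := by ext <;> simp
  μ_q u v w := by ext <;> simp
  d_d u v m := by ext <;> simp ; ring
  d_ω u v w := by ext <;> simp <;> ring
  μ_d u v m := by ext <;> simp; ring
  d_μ u v m := by ext <;> simp; ring
  d_q u v w := by ext <;> simp <;> ring

end ExtensionDatum

/-- The monomial with coefficient one given by a multiset of variables. -/
noncomputable def mon (k : Type*) {σ : Type*} [Field k] (s : Multiset σ) : MvPolynomial σ k :=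
  open scoped Classical in MvPolynomial.monomial (Multiset.toFinsupp s) 1

/-- The coefficient of the monomial given by a multiset of variables. -/
noncomputable def monCoeff (k : Type*) {σ : Type*} [Field k] (s : Multiset σ) :
    MvPolynomial σ k →ₗ[k] k :=
  open scoped Classical in MvPolynomial.lcoeff k (Multiset.toFinsupp s)

/-! ### Polynomial monomials indexed by multisets -/

section Mon

variable {k σ : Type*} [Field k]

theorem monCoeff_mon_self (s : Multiset σ) : monCoeff k s (mon k s) = 1 := by
  classical
  simp [monCoeff, mon, MvPolynomial.coeff_monomial]

theorem monCoeff_mon_of_ne {s t : Multiset σ} (h : t ≠ s) : monCoeff k s (mon k t) = 0 := by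
  classical
  simp [monCoeff, mon, MvPolynomial.coeff_monomial, h]

theorem monCoeff_mon_ne_zero {s t : Multiset σ} (h : monCoeff k s (mon k t) ≠ 0) : t = s := by
  by_contra hne
  exact h (monCoeff_mon_of_ne hne)

theorem mon_cons (a : σ) (s : Multiset σ) : mon k (a ::ₘ s) = MvPolynomial.X a * mon k s := by
  classical
  rw [mon, mon, MvPolynomial.X, MvPolynomial.monomial_mul, one_mul, ← Multiset.singleton_add,
    Multiset.toFinsupp_add, Multiset.toFinsupp_singleton]

theorem mon_zero : mon k (0 : Multiset σ) = 1 := by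
  simp [mon]

end Mon

section Minor

variable {k : Type u} {X : Type v} [Field k]

/-- The multiset with one element `a` of the second kind and the elements `r` of the first kind. -/
def marked (a : X) (r : Multiset X) : Multiset (X ⊕ X) := Sum.inr a ::ₘ r.map Sum.inl

theorem marked_inj {a b : X} {r s : Multiset X} (h : marked a r = marked b s) :
    a = b ∧ r = s := by
  have h1 := congrArg (Multiset.filterMap Sum.getRight?) h
  have h2 := congrArg (Multiset.filterMap Sum.getLeft?) h
  simp only [marked, Multiset.filterMap_cons, Multiset.filterMap_map] at h1 h2
  have e1 : (Sum.getRight? ∘ (Sum.inl : X → X ⊕ X)) = fun _ => none := rfl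
  have e2 : (Sum.getLeft? ∘ (Sum.inl : X → X ⊕ X)) = some := rfl
  have e3 : ∀ r : Multiset X, Multiset.filterMap (fun _ : X => (none : Option X)) r = 0 := by
    intro r
    induction r using Multiset.induction with
    | empty => rfl
    | cons a r ih => rw [Multiset.filterMap_cons_none _ _ rfl, ih]
  rw [e1, e3, e3] at h1
  rw [e2, Multiset.filterMap_some, Multiset.filterMap_some] at h2
  simp at h1 h2
  exact ⟨h1, h2⟩

/-- The image of `[a, b, l…]` in the Magnus representation. -/
noncomputable def minor (k : Type u) [Field k] (a b : X) (l : List X) : MvPolynomial (X ⊕ X) k :=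
  mon k (marked a (b :: l : List X)) - mon k (marked b (a :: l : List X))

theorem monCoeff_minor_self {b c : X} (h : b ≠ c) (l : List X) :
    monCoeff k (marked b (c :: l : List X)) (minor k b c l) = 1 := by
  rw [minor, map_sub, monCoeff_mon_self, monCoeff_mon_of_ne, sub_zero]
  exact fun e => h (marked_inj e).1.symm

theorem card_eq_of_monCoeff_minor {a a' b : X} {l : List X} {r : Multiset X}
    (h : monCoeff k (marked b r) (minor k a a' l) ≠ 0) : r.card = l.length + 1 := by
  by_contra hne
  refine h ?_
  rw [minor, map_sub, monCoeff_mon_of_ne, monCoeff_mon_of_ne, sub_zero]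
  all_goals
    intro e
    rw [← (marked_inj e).2] at hne
    exact hne rfl

/-- The second term of the determinant marks a letter that is minimal among all letters involved,
whereas b exceeds the unmarked letter c. So only the first term can contribute, and it determines
its letters. -/
theorem eq_of_monCoeff_minor [LinearOrder X] {a a' b c : X} {l r : List X} (ha : a' < a)
    (hl : ∀ x ∈ l, a' ≤ x) (hcb : c < b)
    (h : monCoeff k (marked b (c :: r : List X)) (minor k a a' l) ≠ 0) :
    a = b ∧ (a' :: l).Perm (c :: r) := by
  by_cases h1 : marked a (a' :: l : List X) = marked b (c :: r : List X)
  · obtain ⟨e1, e2⟩ := marked_inj h1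
    exact ⟨e1, Multiset.coe_eq_coe.mp e2⟩
  · rw [minor, map_sub, monCoeff_mon_of_ne h1, zero_sub, neg_ne_zero] at h
    obtain ⟨rfl, e2⟩ := marked_inj (monCoeff_mon_ne_zero h)
    have hc : c ∈ a :: l := (Multiset.coe_eq_coe.mp e2).mem_iff.mpr List.mem_cons_self
    rcases List.mem_cons.mp hc with rfl | hc
    · exact absurd (ha.trans hcb) (lt_irrefl _)
    · exact absurd hcb (hl c hc).not_gt

end Minor

/-! ### Representations of the free algebra -/

namespace MP

variable {k : Type u} {X : Type v} [Field k]

/-- The linear map that sends a letter to a variable. -/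
noncomputable def letterMap (k : Type u) [Field k] {σ : Type*} (f : X → σ) :
    (X →₀ k) →ₗ[k] MvPolynomial σ k :=
  Finsupp.linearCombination k fun a => MvPolynomial.X (f a)

theorem letterMap_single {σ : Type*} (f : X → σ) (a : X) :
    letterMap k f (Finsupp.single a 1) = MvPolynomial.X (f a) := by
  simp [letterMap]

/-- The Magnus representation. -/
theorem exists_magnus {c : k} (hc : 2 * c = 0) :
    ∃ G H : MP k X →ₗ[k] MvPolynomial (X ⊕ X) k,
    (∀ a, G (ι a) = 0 ∧ H (ι a) = 0) ∧
    (∀ a b l, G (bracket ⁅(ι a : MP k X), (ι b : MP k X)⁆ l) = minor k a b l ∧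
      H (bracket ⁅(ι a : MP k X), (ι b : MP k X)⁆ l) = 0) ∧
    (∀ a b, G (ι a * ι b) = 0 ∧ H (ι a * ι b) = c • (mon k (marked a {b}) +
      mon k (marked b {a}))) ∧
    (∀ a b d, G (ι a * ι b * ι d) = 0 ∧ H (ι a * ι b * ι d) = 0) ∧
    ∀ a b l d, G (bracket ⁅(ι a : MP k X), (ι b : MP k X)⁆ l * ι d) = 0 ∧
      H (bracket ⁅(ι a : MP k X), (ι b : MP k X)⁆ l * ι d) = c • minor k a b (l ++ [d]) := by
  set D := ExtensionDatum.magnus (letterMap k (Sum.inl : X → X ⊕ X)) (letterMap k Sum.inr)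
    (MvPolynomial.C c) (by rw [← map_ofNat MvPolynomial.C 2, ← map_mul, hc, map_zero]) with hD
  obtain ⟨G₀, G, -, -, h1, h2, h3, h4, h5⟩ :=
    D.exists_linearMap (fun a : X => Finsupp.single a (1 : k))
  have hit : ∀ (l : List X) m, D.iter (fun a : X => Finsupp.single a (1 : k)) m l =
      (m.1 * mon k ((l : Multiset X).map Sum.inl), m.2 * mon k ((l : Multiset X).map Sum.inl)) := by
    intro l
    induction l with
    | nil => intro m; simp [ExtensionDatum.iter, mon_zero]
    | cons a l ih =>
      intro m
      rw [ExtensionDatum.iter_cons, ih, ← Multiset.cons_coe, Multiset.map_cons, mon_cons]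
      simp only [hD, ExtensionDatum.magnus, LinearMap.mk₂_apply, letterMap_single]
      ext1 <;> ring
  have hlie : ∀ (a b : X) (l : List X), D.iter (fun a : X => Finsupp.single a (1 : k))
      (D.ω (Finsupp.single a 1) (Finsupp.single b 1)) l = (minor k a b l, 0) := by
    intro a b l
    rw [hit]
    simp only [hD, ExtensionDatum.magnus, LinearMap.mk₂_apply, letterMap_single, minor, marked,
      ← Multiset.cons_coe, Multiset.map_cons, mon_cons]
    ext1 <;> ring
  refine ⟨LinearMap.fst k _ _ ∘ₗ G, LinearMap.snd k _ _ ∘ₗ G, fun a => ?_, fun a b l => ?_,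
    fun a b => ?_, fun a b d => ?_, fun a b l d => ?_⟩
  · simp [h1]
  · simp [h2, hlie]
  · simp only [LinearMap.comp_apply, h3, LinearMap.fst_apply, LinearMap.snd_apply]
    simp only [hD, ExtensionDatum.magnus, LinearMap.mk₂_apply, letterMap_single, marked,
      ← Multiset.cons_zero, Multiset.map_cons, Multiset.map_zero, mon_cons, mon_zero, MvPolynomial.smul_eq_C_mul,
      mul_one, and_self]
  · simp only [LinearMap.comp_apply, h4, LinearMap.fst_apply, LinearMap.snd_apply]
    simp only [hD, ExtensionDatum.magnus, LinearMap.mk₂_apply, mul_zero, and_self]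
  · simp only [LinearMap.comp_apply, h5, hlie, LinearMap.fst_apply, LinearMap.snd_apply]
    simp only [hD, ExtensionDatum.magnus, LinearMap.mk₂_apply, letterMap_single, minor, marked,
      ← Multiset.cons_coe, Multiset.map_cons, mon_cons, MvPolynomial.smul_eq_C_mul, true_and]
    rw [Multiset.coe_eq_coe.mpr (List.perm_append_singleton d l)]
    simp only [← Multiset.cons_coe, Multiset.map_cons, mon_cons]
    ring

/-- The representation by monomials. -/
theorem exists_com (k : Type u) (X : Type v) [Field k] :
    ∃ (L : MP k X →ₗ[k] (X →₀ k)) (G H : MP k X →ₗ[k] MvPolynomial X k),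
    (∀ a, L (ι a) = Finsupp.single a 1 ∧ G (ι a) = 0 ∧ H (ι a) = 0) ∧
    (∀ f ∈ square k (MP k X), L f = 0) ∧
    (∀ a b l, G (bracket ⁅(ι a : MP k X), (ι b : MP k X)⁆ l) = 0 ∧
      H (bracket ⁅(ι a : MP k X), (ι b : MP k X)⁆ l) = 0) ∧
    (∀ a b, G (ι a * ι b) = mon k {a, b} ∧ H (ι a * ι b) = 0) ∧
    (∀ a b d, G (ι a * ι b * ι d) = 0 ∧ H (ι a * ι b * ι d) = mon k {a, b, d}) ∧
    ∀ a b l d, G (bracket ⁅(ι a : MP k X), (ι b : MP k X)⁆ l * ι d) = 0 ∧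
      H (bracket ⁅(ι a : MP k X), (ι b : MP k X)⁆ l * ι d) = 0 := by
  set D := ExtensionDatum.com (letterMap k (id : X → X)) with hD
  obtain ⟨L, G, h0, h0', h1, h2, h3, h4, h5⟩ :=
    D.exists_linearMap (fun a : X => Finsupp.single a (1 : k))
  have hit : ∀ (l : List X), D.iter (fun a : X => Finsupp.single a (1 : k)) 0 l = 0 := by
    intro l
    induction l with
    | nil => rfl
    | cons a l ih => rw [ExtensionDatum.iter_cons, map_zero, ih]
  have hω : ∀ u v, D.ω u v = 0 := fun u v => rfl
  refine ⟨L, LinearMap.fst k _ _ ∘ₗ G, LinearMap.snd k _ _ ∘ₗ G, fun a => ?_, h0',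
    fun a b l => ?_, fun a b => ?_, fun a b d => ?_, fun a b l d => ?_⟩
  · simp [h1, h0]
  · simp [h2, hω, hit]
  · simp only [LinearMap.comp_apply, h3, LinearMap.fst_apply, LinearMap.snd_apply]
    simp [hD, ExtensionDatum.com, LinearMap.mk₂_apply, letterMap_single, mon_cons,
      ← Multiset.cons_zero, mon_zero]
  · simp only [LinearMap.comp_apply, h4, LinearMap.fst_apply, LinearMap.snd_apply]
    simp [hD, ExtensionDatum.com, LinearMap.mk₂_apply, letterMap_single, mon_cons,
      ← Multiset.cons_zero, mon_zero]
    ring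
  · simp [h5, hω, hit]

/-- The functional that selects a monomial `⁅b, c⁆ * d`. -/
theorem exists_wedge (b c d : X) : ∃ G : MP k X →ₗ[k] k, (∀ a, G (ι a) = 0) ∧
    (∀ a a' l, G (bracket ⁅(ι a : MP k X), (ι a' : MP k X)⁆ l) = 0) ∧
    (∀ a a', G (ι a * ι a') = 0) ∧ (∀ a a' a'', G (ι a * ι a' * ι a'') = 0) ∧
    (∀ a a' l e, l ≠ [] → G (bracket ⁅(ι a : MP k X), (ι a' : MP k X)⁆ l * ι e) = 0) ∧
    ∀ a a' e, G (⁅(ι a : MP k X), (ι a' : MP k X)⁆ * ι e) =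
      Finsupp.single e (1 : k) d * (Finsupp.single a (1 : k) b * Finsupp.single a' (1 : k) c -
        Finsupp.single a' (1 : k) b * Finsupp.single a (1 : k) c) := by
  set D := ExtensionDatum.wedge (Finsupp.lapply b : (X →₀ k) →ₗ[k] k) (Finsupp.lapply c)
    (Finsupp.lapply d) with hD
  obtain ⟨L, G, -, -, h1, h2, h3, h4, h5⟩ :=
    D.exists_linearMap (fun a : X => Finsupp.single a (1 : k))
  have hit : ∀ (l : List X) m, m.2.1 = 0 → l ≠ [] →
      D.iter (fun a : X => Finsupp.single a (1 : k)) m l = 0 := by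
    intro l m hm
    induction l generalizing m with
    | nil => exact fun h => absurd rfl h
    | cons a l ih =>
      intro _
      have h0 : D.d (Finsupp.single a (1 : k)) m = 0 := by
        simp [hD, ExtensionDatum.wedge, LinearMap.mk₂_apply, hm]
      rw [ExtensionDatum.iter_cons, h0]
      rcases eq_or_ne l [] with rfl | hl
      · rfl
      · exact ih 0 rfl hl
  refine ⟨LinearMap.snd k _ _ ∘ₗ LinearMap.snd k _ _ ∘ₗ G, fun a => ?_, fun a a' l => ?_,
    fun a a' => ?_, fun a a' a'' => ?_, fun a a' l e hl => ?_, fun a a' e => ?_⟩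
  · simp [h1]
  · rcases eq_or_ne l [] with rfl | hl
    · simp [h2, ExtensionDatum.iter, hD, ExtensionDatum.wedge]
    · rw [LinearMap.comp_apply, LinearMap.comp_apply, h2, hit l _ rfl hl, map_zero, map_zero]
  · simp [h3, hD, ExtensionDatum.wedge]
  · simp [h4, hD, ExtensionDatum.wedge]
  · rw [LinearMap.comp_apply, LinearMap.comp_apply, h5, hit l _ rfl hl, map_zero, map_zero,
      map_zero]
  · have := h5 a a' [] e
    rw [bracket_nil] at this
    simp [this, ExtensionDatum.iter, hD, ExtensionDatum.wedge]

/-- The representation of monomials `⁅⁅a, b⁆, c⁆ * d` by products of minors. -/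
theorem exists_minors (k : Type u) (X : Type v) [Field k] :
    ∃ G : MP k X →ₗ[k] MvPolynomial (X ⊕ X) k, (∀ a, G (ι a) = 0) ∧
    (∀ a a' l, G (bracket ⁅(ι a : MP k X), (ι a' : MP k X)⁆ l) = 0) ∧
    (∀ a a', G (ι a * ι a') = 0) ∧ (∀ a a' a'', G (ι a * ι a' * ι a'') = 0) ∧
    (∀ a a' e, G (⁅(ι a : MP k X), (ι a' : MP k X)⁆ * ι e) = 0) ∧
    ∀ a b c d : X, G (⁅⁅(ι a : MP k X), (ι b : MP k X)⁆, (ι c : MP k X)⁆ * ι d) =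
      mon k {Sum.inl a, Sum.inl c, Sum.inr b, Sum.inr d} -
      mon k {Sum.inl a, Sum.inl d, Sum.inr b, Sum.inr c} -
      mon k {Sum.inl b, Sum.inl c, Sum.inr a, Sum.inr d} +
      mon k {Sum.inl b, Sum.inl d, Sum.inr a, Sum.inr c} := by
  set D := ExtensionDatum.minors (letterMap k (Sum.inl : X → X ⊕ X)) (letterMap k Sum.inr) with hD
  obtain ⟨L, G, -, -, h1, h2, h3, h4, h5⟩ :=
    D.exists_linearMap (fun a : X => Finsupp.single a (1 : k))
  have hit : ∀ (l : List X) m, m.2.1 = 0 → m.2.2.2.1 = 0 → m.2.2.2.2 = 0 →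
      (D.iter (fun a : X => Finsupp.single a (1 : k)) m l).2.2.2.2 = 0 := by
    intro l
    induction l with
    | nil => exact fun m _ _ h => h
    | cons a l ih =>
      intro m e1 e2 e3
      rw [ExtensionDatum.iter_cons]
      refine ih _ ?_ ?_ ?_ <;> simp [hD, ExtensionDatum.minors, e1, e2]
  refine ⟨LinearMap.snd k _ _ ∘ₗ LinearMap.snd k _ _ ∘ₗ LinearMap.snd k _ _ ∘ₗ
    LinearMap.snd k _ _ ∘ₗ G, fun a => ?_, fun a a' l => ?_,
    fun a a' => ?_, fun a a' a'' => ?_, fun a a' e => ?_, fun a b c d => ?_⟩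
  · simp [h1]
  · simp only [LinearMap.comp_apply, h2]
    exact hit l _ rfl rfl rfl
  · simp [h3, hD, ExtensionDatum.minors]
  · simp [h4, hD, ExtensionDatum.minors]
  · have := h5 a a' [] e
    rw [bracket_nil] at this
    simp [this, ExtensionDatum.iter, hD, ExtensionDatum.minors]
  · have := h5 a b [c] d
    rw [bracket_cons, bracket_nil] at this
    simp [this, ExtensionDatum.iter, hD, ExtensionDatum.minors, letterMap_single, mon_cons,
      ← Multiset.cons_zero, mon_zero]
    ring

end MP

theorem pair_eq_pair {α : Type*} {a b c d : α} (h : ({a, b} : Multiset α) = {c, d}) :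
    (a = c ∧ b = d) ∨ (a = d ∧ b = c) := by
  have h1 : a = c ∨ a = d := by
    have : a ∈ ({c, d} : Multiset α) := h ▸ by simp
    simpa using this
  rcases h1 with rfl | rfl
  · left
    simpa using h
  · rw [Multiset.pair_comm c a] at h
    right
    simpa using h

theorem inl_inr_eq {X : Type*} {a b c d a' b' c' d' : X}
    (h : ({Sum.inl a, Sum.inl b, Sum.inr c, Sum.inr d} : Multiset (X ⊕ X)) =
      {Sum.inl a', Sum.inl b', Sum.inr c', Sum.inr d'}) :
    ((a = a' ∧ b = b') ∨ (a = b' ∧ b = a')) ∧ ((c = c' ∧ d = d') ∨ (c = d' ∧ d = c')) := by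
  have h1 := congrArg (Multiset.filterMap Sum.getRight?) h
  have h2 := congrArg (Multiset.filterMap Sum.getLeft?) h
  simp only [Multiset.insert_eq_cons, Multiset.filterMap_cons, Sum.getRight?, Sum.getLeft?,
    Option.map_none, Option.map_some, Option.getD_none, Option.getD_some, zero_add,
    Multiset.singleton_add] at h1 h2
  exact ⟨pair_eq_pair h2, pair_eq_pair h1⟩

namespace MPB

variable {k : Type u} {X : Type v} [Field k] [LinearOrder X]

theorem lt_iff (W W' : MPB k X) : W < W' ↔ W.1.len < W'.1.len ∨ W.1.len = W'.1.len ∧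
    (W.1.pb < W'.1.pb ∨ W.1.pb = W'.1.pb ∧ W.1.letters < W'.1.letters) := by
  change W.1.wt < W'.1.wt ↔ _
  simp only [Word.wt, Prod.Lex.toLex_lt_toLex]

end MPB

/-! ### Dual functionals and linear independence -/

namespace MP

variable {k : Type u} {X : Type v} [Field k] [LinearOrder X]

theorem exists_dual_lie (b c : X) (l : List X) (hcb : c < b) (hl : (c :: l).Pairwise (· ≤ ·)) :
    ∃ φ : MP k X →ₗ[k] k, φ (Word.eval k (.lie b (c :: l))) ≠ 0 ∧
      ∀ W', Word.IsBasic k W' → φ (W'.eval k) ≠ 0 → Word.lie b (c :: l) = W' := by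
  -- The parameter 0 is admissible in every characteristic; the first Magnus component sees pure
  -- brackets only.
  obtain ⟨G, _, h1, h2, h3, h4, h5⟩ := exists_magnus (k := k) (X := X) (c := 0) (mul_zero 2)
  refine ⟨monCoeff k (marked b (c :: l : List X)) ∘ₗ G, ?_, fun W' hW' h => ?_⟩
  · change monCoeff k _ (G (bracket ⁅(ι b : MP k X), (ι c : MP k X)⁆ l)) ≠ 0
    rw [(h2 b c l).1, monCoeff_minor_self hcb.ne']
    exact one_ne_zero
  · rw [LinearMap.comp_apply] at h
    have h0 {f : MP k X} (hf : G f = 0) : monCoeff k (marked b (c :: l : List X)) (G f) = 0 := by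
      rw [hf, map_zero]
    cases hW' with
    | letter a => exact absurd (h0 (h1 a).1) h
    | lie a a' r ha hr =>
      change monCoeff k _ (G (bracket ⁅(ι a : MP k X), (ι a' : MP k X)⁆ r)) ≠ 0 at h
      rw [(h2 a a' r).1] at h
      obtain ⟨rfl, hp⟩ := eq_of_monCoeff_minor ha (List.pairwise_cons.mp hr).1 hcb h
      rw [hp.eq_of_pairwise' hr hl]
    | com₂ a a' => exact absurd (h0 (h3 a a').1) h
    | com₃ a a' a'' => exact absurd (h0 (h4 a a' a'').1) h
    | mix₃ a a' d => exact absurd (h0 (h5 a a' [] d).1) h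
    | mix₄ a a' a'' d => exact absurd (h0 (h5 a a' [a''] d).1) h
    | mix a a' a'' as d => exact absurd (h0 (h5 a a' (a'' :: as) d).1) h

theorem exists_dual_mix (b c e : X) (l : List X) (d : X) (h2 : ringChar k = 2) (hcb : c < b)
    (hl : (c :: e :: (l ++ [d])).Pairwise (· ≤ ·)) :
    ∃ φ : MP k X →ₗ[k] k, φ (Word.eval k (.mix b (c :: e :: l) d)) ≠ 0 ∧
      ∀ W', Word.IsBasic k W' → φ (W'.eval k) ≠ 0 → Word.mix b (c :: e :: l) d = W' := by
  -- In characteristic 2 the parameter 1 is admissible. The second component kills pure brackets,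
  -- and products with too few letters are excluded by degree.
  obtain ⟨_, G, h1, h2', h3, h4, h5⟩ := exists_magnus (k := k) (X := X) (c := 1)
    (by rw [mul_one]; exact (ringChar_eq_two_iff k).mp h2)
  refine ⟨monCoeff k (marked b (c :: (e :: l ++ [d]) : List X)) ∘ₗ G, ?_, fun W' hW' h => ?_⟩
  · change monCoeff k _ (G (bracket ⁅(ι b : MP k X), (ι c : MP k X)⁆ (e :: l) * ι d)) ≠ 0
    rw [(h5 b c (e :: l) d).2, one_smul, monCoeff_minor_self hcb.ne']
    exact one_ne_zero
  · rw [LinearMap.comp_apply] at h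
    have h0 {f : MP k X} (hf : G f = 0) :
        monCoeff k (marked b (c :: (e :: l ++ [d]) : List X)) (G f) = 0 := by
      rw [hf, map_zero]
    cases hW' with
    | letter a => exact absurd (h0 (h1 a).2) h
    | lie a a' r ha hr => exact absurd (h0 (h2' a a' r).2) h
    | com₂ a a' =>
      change monCoeff k _ (G (ι a * ι a')) ≠ 0 at h
      refine absurd ?_ h
      rw [(h3 a a').2, one_smul, map_add, monCoeff_mon_of_ne, monCoeff_mon_of_ne, add_zero]
      all_goals
        intro h
        have := congrArg Multiset.card (marked_inj h).2
        simp at this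
    | com₃ a a' a'' => exact absurd (h0 (h4 a a' a'').2) h
    | mix₃ a a' d =>
      change monCoeff k _ (G (bracket ⁅(ι a : MP k X), (ι a' : MP k X)⁆ [] * ι d)) ≠ 0 at h
      rw [(h5 a a' [] d).2, one_smul] at h
      have := card_eq_of_monCoeff_minor h
      simp at this
    | mix₄ a a' a'' d hk => exact absurd h2 hk
    | mix a a' a'' as d' hk ha hr =>
      change monCoeff k _ (G (bracket ⁅(ι a : MP k X), (ι a' : MP k X)⁆ (a'' :: as) * ι d')) ≠ 0 at h
      rw [(h5 a a' (a'' :: as) d').2, one_smul] at h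
      obtain ⟨rfl, hp⟩ := eq_of_monCoeff_minor ha (List.pairwise_cons.mp hr).1 hcb h
      have := hp.eq_of_pairwise' hr hl
      simp only [List.cons.injEq] at this
      obtain ⟨rfl, rfl, h6⟩ := this
      obtain ⟨rfl, h7⟩ := List.append_inj' h6 rfl
      simp at h7
      rw [h7]

theorem exists_dual_mix₃ (b c d : X) (hcb : c < b) :
    ∃ φ : MP k X →ₗ[k] k, φ (Word.eval k (.mix b [c] d)) ≠ 0 ∧
      ∀ W', Word.IsBasic k W' → φ (W'.eval k) ≠ 0 → Word.mix b [c] d = W' := by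
  obtain ⟨G, h1, h2, h3, h4, h5, h6⟩ := exists_wedge (k := k) b c d
  refine ⟨G, ?_, fun W' hW' h => ?_⟩
  · change G (⁅(ι b : MP k X), (ι c : MP k X)⁆ * ι d) ≠ 0
    rw [h6]
    simp [hcb.ne]
  · cases hW' with
    | letter a => exact absurd (h1 a) h
    | lie a a' r ha hr => exact absurd (h2 a a' r) h
    | com₂ a a' => exact absurd (h3 a a') h
    | com₃ a a' a'' => exact absurd (h4 a a' a'') h
    | mix₃ a a' d' ha =>
      change G (⁅(ι a : MP k X), (ι a' : MP k X)⁆ * ι d') ≠ 0 at h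
      rw [h6] at h
      simp only [Finsupp.single_apply] at h
      split_ifs at h with e1 e2 e3 e4 <;> simp_all
      exact absurd hcb ha.not_gt
    | mix₄ a a' a'' d' => exact absurd (h5 a a' [a''] d' (by simp)) h
    | mix a a' a'' as d' => exact absurd (h5 a a' (a'' :: as) d' (by simp)) h

/-- The functional reads the coefficient of x_{b₁} x_{b₄} y_{b₂} y_{b₃} in the product of two minors
attached to a monomial. The alternative with a larger first letter is harmless, since only
triangularity is needed. -/
theorem exists_dual_mix₄ (b₁ b₂ b₃ b₄ : X) (hk : ringChar k ≠ 2) (h21 : b₂ < b₁) (h14 : b₁ ≤ b₄)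
    (h23 : b₂ ≤ b₃) (h34 : b₃ < b₄) :
    ∃ φ : MP k X →ₗ[k] k, φ (Word.eval k (.mix b₁ [b₂, b₃] b₄)) ≠ 0 ∧
      ∀ W', Word.IsBasic k W' → φ (W'.eval k) ≠ 0 →
        Word.mix b₁ [b₂, b₃] b₄ = W' ∨ ∃ a₁ a₂ a₃ a₄, W' = Word.mix a₁ [a₂, a₃] a₄ ∧ b₁ < a₁ := by
  obtain ⟨G, h1, h2, h3, h4, h5, h6⟩ := exists_minors k X
  refine ⟨monCoeff k {Sum.inl b₁, Sum.inl b₄, Sum.inr b₂, Sum.inr b₃} ∘ₗ G, ?_, fun W' hW' h => ?_⟩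
  · change monCoeff k _
      (G (⁅⁅(ι b₁ : MP k X), (ι b₂ : MP k X)⁆, (ι b₃ : MP k X)⁆ * ι b₄)) ≠ 0
    rw [h6, map_add, map_sub, map_sub, monCoeff_mon_self, monCoeff_mon_of_ne, monCoeff_mon_of_ne,
      monCoeff_mon_of_ne]
    · simp
    all_goals
      intro h
      have := inl_inr_eq h
      grind
  · rw [LinearMap.comp_apply] at h
    have h0 {f : MP k X} (hf : G f = 0) :
        monCoeff k {Sum.inl b₁, Sum.inl b₄, Sum.inr b₂, Sum.inr b₃} (G f) = 0 := by
      rw [hf, map_zero]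
    cases hW' with
    | letter a => exact absurd (h0 (h1 a)) h
    | lie a a' r ha hr => exact absurd (h0 (h2 a a' r)) h
    | com₂ a a' => exact absurd (h0 (h3 a a')) h
    | com₃ a a' a'' => exact absurd (h0 (h4 a a' a'')) h
    | mix₃ a a' d' ha => exact absurd (h0 (h5 a a' d')) h
    | mix₄ a₁ a₂ a₃ a₄ _ h21' h14' h23' h34' =>
      change monCoeff k _
        (G (⁅⁅(ι a₁ : MP k X), (ι a₂ : MP k X)⁆, (ι a₃ : MP k X)⁆ * ι a₄)) ≠ 0 at h
      suffices (b₁ = a₁ ∧ b₂ = a₂ ∧ b₃ = a₃ ∧ b₄ = a₄) ∨ b₁ < a₁ by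
        rcases this with ⟨rfl, rfl, rfl, rfl⟩ | h
        exacts [Or.inl rfl, Or.inr ⟨_, _, _, _, rfl, h⟩]
      rw [h6, map_add, map_sub, map_sub] at h
      by_contra hne
      refine h ?_
      rw [monCoeff_mon_of_ne, monCoeff_mon_of_ne, monCoeff_mon_of_ne, monCoeff_mon_of_ne]
      · simp
      all_goals
        intro h
        have := inl_inr_eq h
        grind
    | mix a a' a'' as d' hk' => exact absurd hk' hk

theorem triple_sorted {a b c a' b' c' : X} (h1 : a ≤ b) (h2 : b ≤ c) (h1' : a' ≤ b') (h2' : b' ≤ c')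
    (h : ({a, b, c} : Multiset X) = {a', b', c'}) : a = a' ∧ b = b' ∧ c = c' := by
  have h3 : [a, b, c].Perm [a', b', c'] := Multiset.coe_eq_coe.mp h
  have := h3.eq_of_pairwise' (r := (· ≤ ·)) (by simp [h1, h2, h1.trans h2])
    (by simp [h1', h2', h1'.trans h2'])
  simpa using this

/-- The basis monomials admit a triangular family of linear functionals. -/
theorem exists_dual (W : MPB k X) : ∃ φ : MP k X →ₗ[k] k, φ (W.1.eval k) ≠ 0 ∧
    ∀ W' : MPB k X, φ (W'.1.eval k) ≠ 0 → W ≤ W' := by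
  suffices h : ∃ φ : MP k X →ₗ[k] k, φ (W.1.eval k) ≠ 0 ∧
      ∀ W' : MPB k X, φ (W'.1.eval k) ≠ 0 → W.1 = W'.1 ∨ W < W' by
    obtain ⟨φ, h1, h2⟩ := h
    refine ⟨φ, h1, fun W' h => ?_⟩
    rcases h2 W' h with h | h
    · exact (show W = W' from Subtype.ext h).le
    · exact h.le
  have key (φ : MP k X →ₗ[k] k) (h1 : φ (W.1.eval k) ≠ 0)
      (h2 : ∀ W', Word.IsBasic k W' → φ (W'.eval k) ≠ 0 → W.1 = W') :
      ∃ φ : MP k X →ₗ[k] k, φ (W.1.eval k) ≠ 0 ∧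
        ∀ W' : MPB k X, φ (W'.1.eval k) ≠ 0 → W.1 = W'.1 ∨ W < W' :=
    ⟨φ, h1, fun W' h => Or.inl (h2 W'.1 W'.2 h)⟩
  obtain ⟨W, hW⟩ := W
  cases hW with
  | letter b =>
    obtain ⟨L, _, _, h1, h2, -⟩ := exists_com k X
    refine key (Finsupp.lapply b ∘ₗ L) ?_ fun W' hW' h => ?_
    · change L (ι b) b ≠ 0
      simp [(h1 b).1]
    · change L (W'.eval k) b ≠ 0 at h
      have h0 {f : MP k X} (hf : f ∈ square k (MP k X)) : L f b = 0 := by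
        rw [h2 f hf, Finsupp.zero_apply]
      cases hW' with
      | letter a =>
        change L (ι a) b ≠ 0 at h
        rw [(h1 a).1, Finsupp.single_apply] at h
        simp only [ne_eq, ite_eq_right_iff, one_ne_zero, imp_false, not_not] at h
        rw [h]
      | lie a a' r => exact absurd (h0 (bracket_mem_square (lie_mem_square _ _) r)) h
      | com₂ a a' => exact absurd (h0 (mul_mem_square _ _)) h
      | com₃ a a' a'' => exact absurd (h0 (mul_mem_square _ _)) h
      | mix₃ a a' d => exact absurd (h0 (mul_mem_square _ _)) h
      | mix₄ a a' a'' d => exact absurd (h0 (mul_mem_square _ _)) h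
      | mix a a' a'' as d => exact absurd (h0 (mul_mem_square _ _)) h
  | lie b c l h1 h2 =>
    obtain ⟨φ, h3, h4⟩ := exists_dual_lie (k := k) b c l h1 h2
    exact key φ h3 h4
  | com₂ b c hbc =>
    obtain ⟨_, G, _, h1, -, h2, h3, h4, h5⟩ := exists_com k X
    refine key (monCoeff k {b, c} ∘ₗ G) ?_ fun W' hW' h => ?_
    · change monCoeff k _ (G (ι b * ι c)) ≠ 0
      rw [(h3 b c).1, monCoeff_mon_self]
      exact one_ne_zero
    · rw [LinearMap.comp_apply] at h
      have h0 {f : MP k X} (hf : G f = 0) : monCoeff k {b, c} (G f) = 0 := by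
        rw [hf, map_zero]
      cases hW' with
      | letter a => exact absurd (h0 (h1 a).2.1) h
      | lie a a' r => exact absurd (h0 (h2 a a' r).1) h
      | com₂ a a' ha =>
        change monCoeff k _ (G (ι a * ι a')) ≠ 0 at h
        rw [(h3 a a').1] at h
        rcases pair_eq_pair (monCoeff_mon_ne_zero h) with ⟨rfl, rfl⟩ | ⟨rfl, rfl⟩
        · rfl
        · obtain rfl := le_antisymm ha hbc
          rfl
      | com₃ a a' a'' => exact absurd (h0 (h4 a a' a'').1) h
      | mix₃ a a' d => exact absurd (h0 (h5 a a' [] d).1) h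
      | mix₄ a a' a'' d => exact absurd (h0 (h5 a a' [a''] d).1) h
      | mix a a' a'' as d => exact absurd (h0 (h5 a a' (a'' :: as) d).1) h
  | com₃ b c d hbc hcd =>
    obtain ⟨_, _, G, h1, -, h2, h3, h4, h5⟩ := exists_com k X
    refine key (monCoeff k {b, c, d} ∘ₗ G) ?_ fun W' hW' h => ?_
    · change monCoeff k _ (G (ι b * ι c * ι d)) ≠ 0
      rw [(h4 b c d).2, monCoeff_mon_self]
      exact one_ne_zero
    · rw [LinearMap.comp_apply] at h
      have h0 {f : MP k X} (hf : G f = 0) : monCoeff k {b, c, d} (G f) = 0 := by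
        rw [hf, map_zero]
      cases hW' with
      | letter a => exact absurd (h0 (h1 a).2.2) h
      | lie a a' r => exact absurd (h0 (h2 a a' r).2) h
      | com₂ a a' ha => exact absurd (h0 (h3 a a').2) h
      | com₃ a a' a'' h6 h7 =>
        change monCoeff k _ (G (ι a * ι a' * ι a'')) ≠ 0 at h
        rw [(h4 a a' a'').2] at h
        obtain ⟨rfl, rfl, rfl⟩ := triple_sorted h6 h7 hbc hcd (monCoeff_mon_ne_zero h)
        rfl
      | mix₃ a a' d => exact absurd (h0 (h5 a a' [] d).2) h
      | mix₄ a a' a'' d => exact absurd (h0 (h5 a a' [a''] d).2) h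
      | mix a a' a'' as d => exact absurd (h0 (h5 a a' (a'' :: as) d).2) h
  | mix₃ b c d h1 =>
    obtain ⟨φ, h3, h4⟩ := exists_dual_mix₃ (k := k) b c d h1
    exact key φ h3 h4
  | mix₄ b₁ b₂ b₃ b₄ hk h1 h2 h3 h4 =>
    obtain ⟨φ, h5, h6⟩ := exists_dual_mix₄ (k := k) b₁ b₂ b₃ b₄ hk h1 h2 h3 h4
    refine ⟨φ, h5, fun W' h => (h6 W'.1 W'.2 h).imp_right ?_⟩
    rintro ⟨a₁, a₂, a₃, a₄, h7, h8⟩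
    refine (MPB.lt_iff _ W').mpr ?_
    rw [h7]
    exact Or.inr ⟨rfl, Or.inr ⟨rfl, List.Lex.rel h8⟩⟩
  | mix b c e l d h1 h2 h3 =>
    obtain ⟨φ, h4, h5⟩ := exists_dual_mix b c e l d h1 h2 h3
    exact key φ h4 h5

/-- A relation is tested with the functional of its largest monomial, which kills all the smaller
ones. -/
theorem linearIndependent_eval : LinearIndependent k fun W : MPB k X => W.1.eval k := by
  rw [linearIndependent_iff]
  intro f hf
  by_contra hne
  have hs : f.support.Nonempty := Finsupp.support_nonempty_iff.mpr hne
  set W := f.support.max' hs with hW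
  have hmem : W ∈ f.support := Finset.max'_mem _ _
  obtain ⟨φ, h1, h2⟩ := exists_dual W
  have h3 := congrArg φ hf
  rw [map_zero, Finsupp.linearCombination_apply, Finsupp.sum, map_sum,
    Finset.sum_eq_single_of_mem W hmem] at h3
  · rw [map_smul, smul_eq_mul] at h3
    exact mul_ne_zero (Finsupp.mem_support_iff.mp hmem) h1 h3
  · intro V hV hVW
    rw [map_smul, smul_eq_zero]
    right
    by_contra h
    exact hVW (le_antisymm (Finset.le_max' _ _ hV) (h2 V h))

end MP

/-! ### Well-foundedness and compatibility of the monomial order -/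

namespace MPB

variable {k : Type u} {X : Type v} [Field k] [LinearOrder X]

instance [WellFoundedLT X] : WellFoundedLT (MPB k X) := by
  -- The lexicographic order on lists is not well founded in general; since lengths are compared
  -- first, the shortlex order can replace it.
  have h1 : WellFounded (List.Shortlex ((· < ·) : X → X → Prop)) :=
    List.Shortlex.wf wellFounded_lt
  have h2 := WellFounded.prod_lex (wellFounded_lt (α := ℕ))
    (WellFounded.prod_lex (wellFounded_lt (α := ℕ)) h1)
  refine ⟨Subrelation.wf (r := InvImage _ fun W : MPB k X => (W.1.len, W.1.pb, W.1.letters)) ?_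
    (InvImage.wf _ h2)⟩
  intro W W' h
  rcases (lt_iff W W').mp h with h | ⟨h, h' | ⟨h', h''⟩⟩
  · exact Prod.Lex.left _ _ h
  · change Prod.Lex _ _ (W.1.len, _) (W'.1.len, _)
    rw [h]
    exact Prod.Lex.right _ (Prod.Lex.left _ _ h')
  · change Prod.Lex _ _ (W.1.len, W.1.pb, _) (W'.1.len, W'.1.pb, _)
    rw [h, h']
    exact Prod.Lex.right _ (Prod.Lex.right _ (List.Shortlex.of_lex h h''))

/-- `IsLong W ε b r`: the monomial `W` has at least five letters, the first one being `b` and the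
other ones being the elements of `r`; it is a bracket if `ε` is false and it involves a product if
`ε` is true. -/
structure IsLong (W : MPB k X) (ε : Bool) (b : X) (r : Multiset X) : Prop where
  letters : W.1.letters = b :: r.sort
  pb : W.1.pb + ε.toNat = r.card
  card : 4 ≤ r.card

namespace IsLong

variable {W W' V V' : MPB k X} {ε ε' : Bool} {b b' : X} {r r' : Multiset X}

theorem len (h : IsLong W ε b r) : W.1.len = r.card + 1 := by
  simp [Word.len, h.letters]

theorem eq (h : IsLong W ε b r) (h' : IsLong W' ε b r) : W = W' := by
  apply wt_injective
  have : W.1.pb = W'.1.pb := by have := h.pb; have := h'.pb; omega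
  simp only [Word.wt, Word.len, this, h.letters, h'.letters]

theorem unique (h : IsLong W ε b r) (h' : IsLong W ε' b' r') : ε = ε' ∧ b = b' ∧ r = r' := by
  have h1 := h.letters
  rw [h'.letters, List.cons.injEq] at h1
  obtain ⟨rfl, h1⟩ := h1
  have h2 : r = r' := by rw [← r.sort_eq (· ≤ ·), ← h1, Multiset.sort_eq]
  subst h2
  refine ⟨?_, rfl, rfl⟩
  have h3 := h.pb
  have h4 := h'.pb
  have : ε.toNat = ε'.toNat := by omega
  cases ε <;> cases ε' <;> simp_all

end IsLong

/-- The comparison is decided at the first difference or at the place of insertion. Sortedness plays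
no role, but equal lengths do: a proper prefix may overtake after the insertion. -/
theorem orderedInsert_lt (a : X) : ∀ {l l' : List X}, l.length = l'.length → l < l' →
    l.orderedInsert (· ≤ ·) a < l'.orderedInsert (· ≤ ·) a
  | [], [], _, h => absurd h (lt_irrefl _)
  | [], _ :: _, hlen, _ => by simp at hlen
  | _ :: _, [], hlen, _ => by simp at hlen
  | x :: l, y :: l', hlen, h => by
    rw [List.cons_lt_cons_iff] at h
    simp only [List.orderedInsert_cons]
    rcases h with h | ⟨rfl, h⟩
    · split_ifs with h1 h2 h2
      · rw [List.cons_lt_cons_iff, List.cons_lt_cons_iff]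
        exact Or.inr ⟨rfl, Or.inl h⟩
      · exact absurd (h1.trans h.le) h2
      · rw [List.cons_lt_cons_iff]
        exact Or.inl (lt_of_not_ge h1)
      · rw [List.cons_lt_cons_iff]
        exact Or.inl h
    · split_ifs with h1
      · rw [List.cons_lt_cons_iff, List.cons_lt_cons_iff]
        exact Or.inr ⟨rfl, Or.inr ⟨rfl, h⟩⟩
      · rw [List.cons_lt_cons_iff]
        exact Or.inr ⟨rfl, orderedInsert_lt a (by simpa using hlen) h⟩

theorem sort_cons_eq_orderedInsert (a : X) (r : Multiset X) :
    (a ::ₘ r).sort = r.sort.orderedInsert (· ≤ ·) a := by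
  refine List.Perm.eq_of_pairwise' (r := (· ≤ ·)) (Multiset.pairwise_sort _ _)
    ((Multiset.pairwise_sort _ _).orderedInsert _ _) ?_
  rw [← Multiset.coe_eq_coe, Multiset.sort_eq,
    Multiset.coe_eq_coe.mpr (List.perm_orderedInsert _ _ _), ← Multiset.cons_coe, Multiset.sort_eq]

/-- Adding a letter raises both lengths and both bracket numbers by one, so a tie has to be broken
by the tails alone. This is the compatibility of the order with brackets by letters. -/
theorem IsLong.lt_of_lt {W W' V V' : MPB k X} {ε ε' : Bool} {b b' : X} {r r' : Multiset X} {a : X}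
    (hW : IsLong W ε b r) (hW' : IsLong W' ε b (a ::ₘ r)) (hV : IsLong V ε' b' r')
    (hV' : IsLong V' ε' b' (a ::ₘ r')) (h : V < W) : V' < W' := by
  rw [lt_iff, hV.len, hW.len, hV.letters, hW.letters] at h
  rw [lt_iff, hV'.len, hW'.len, hV'.letters, hW'.letters, Multiset.card_cons, Multiset.card_cons]
  have h1 := hW.pb
  have h2 := hV.pb
  have h3 := hW'.pb
  have h4 := hV'.pb
  rw [Multiset.card_cons] at h3 h4
  rcases h with h | ⟨h, h' | ⟨h', h''⟩⟩
  · left; omega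
  · right; refine ⟨by omega, Or.inl (by omega)⟩
  · right; refine ⟨by omega, Or.inr ⟨by omega, ?_⟩⟩
    rw [List.cons_lt_cons_iff] at h'' ⊢
    refine h''.imp_right (And.imp_right fun h5 => ?_)
    rw [sort_cons_eq_orderedInsert, sort_cons_eq_orderedInsert]
    exact orderedInsert_lt a (by simpa using h) h5

end MPB

/-! ### Coordinates and leading monomials -/

namespace MP

variable {k : Type u} {X : Type v} [Field k] [LinearOrder X]

/-- The coordinates in the basis, as a linear equivalence. -/
noncomputable def coordsEquiv (k : Type u) (X : Type v) [Field k] [LinearOrder X] :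
    MP k X ≃ₗ[k] (MPB k X →₀ k) :=
  (Module.Basis.mk linearIndependent_eval span_eval_eq_top.ge).repr

theorem coordsEquiv_eval (W : MPB k X) : coordsEquiv k X (W.1.eval k) = Finsupp.single W 1 := by
  have := (Module.Basis.mk (linearIndependent_eval (k := k) (X := X)) span_eval_eq_top.ge).repr_self W
  rwa [Module.Basis.mk_apply] at this

/-- `Function.invFun` is a true inverse here, as the monomials are independent and spanning. -/
theorem coords_eq (f : MP k X) : coords f = coordsEquiv k X f := by
  have h : ∀ c : MPB k X →₀ k,
      Finsupp.linearCombination k (fun W : MPB k X => W.1.eval k) c = (coordsEquiv k X).symm c := by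
    intro c
    have : Finsupp.linearCombination k (fun W : MPB k X => W.1.eval k) =
        (coordsEquiv k X).symm.toLinearMap := by
      ext W
      simp [LinearEquiv.eq_symm_apply, coordsEquiv_eval]
    rw [this]; rfl
  have hinj : Function.Injective
      (Finsupp.linearCombination k (fun W : MPB k X => W.1.eval k)) := linearIndependent_eval
  obtain ⟨c, rfl⟩ := (coordsEquiv k X).symm.surjective f
  rw [LinearEquiv.apply_symm_apply, coords, ← h]
  exact Function.leftInverse_invFun hinj c

/-- The span of the basis monomials that belong to a set. -/
noncomputable def supp (k : Type u) {X : Type v} [Field k] [LinearOrder X] (B : Set (MPB k X)) :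
    Submodule k (MP k X) :=
  (Finsupp.supported k k B).comap (coordsEquiv k X).toLinearMap

theorem mem_supp {B : Set (MPB k X)} {f : MP k X} :
    f ∈ supp k B ↔ ∀ W, coords f W ≠ 0 → W ∈ B := by
  rw [coords_eq]
  change (coordsEquiv k X f) ∈ Finsupp.supported k k B ↔ _
  rw [Finsupp.mem_supported]
  constructor
  · intro h W hW
    exact h (Finsupp.mem_support_iff.mpr hW)
  · intro h W hW
    exact h W (Finsupp.mem_support_iff.mp hW)

theorem eval_mem_supp {B : Set (MPB k X)} {W : MPB k X} (hW : W ∈ B) : W.1.eval k ∈ supp k B := by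
  rw [mem_supp, coords_eq, coordsEquiv_eval]
  intro V hV
  rw [Finsupp.single_apply] at hV
  split_ifs at hV with h
  · exact h ▸ hW
  · exact absurd rfl hV

theorem supp_eq_span (B : Set (MPB k X)) :
    supp k B = Submodule.span k ((fun W : MPB k X => W.1.eval k) '' B) := by
  apply le_antisymm
  · rw [supp, Finsupp.supported_eq_span_single]
    intro f hf
    have := Submodule.mem_map_of_mem (f := (coordsEquiv k X).symm.toLinearMap)
      (Submodule.mem_comap.mp hf)
    rw [Submodule.map_span, ← Set.image_comp] at this
    convert this using 3
    · simp [LinearEquiv.eq_symm_apply, coordsEquiv_eval]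
    · simp
  · rw [Submodule.span_le]
    rintro _ ⟨W, hW, rfl⟩
    exact eval_mem_supp hW

theorem supp_mono {B C : Set (MPB k X)} (h : B ⊆ C) : supp k B ≤ supp k C := fun f hf => by
  rw [mem_supp] at hf ⊢
  exact fun W hW => h (hf W hW)

theorem lenSpan_eq_supp (n : ℕ) : lenSpan k X n = supp k {W | W.1.len ≤ n} := by
  rw [supp_eq_span, lenSpan]
  congr 1
  ext f
  exact ⟨fun ⟨W, h, e⟩ => ⟨W, h, e.symm⟩, fun ⟨W, h, e⟩ => ⟨W, h, e.symm⟩⟩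

theorem lm_lt_iff {f : MP k X} {W : MPB k X} : lm f < W ↔ f ∈ supp k (Set.Iio W) := by
  rw [mem_supp, lm, Finset.max_eq_sup_withBot, Finset.sup_lt_iff (WithBot.bot_lt_coe W)]
  simp only [Finsupp.mem_support_iff, WithBot.coe_lt_coe, Set.mem_Iio]

theorem coords_lm {f : MP k X} {W : MPB k X} (h : lm f = W) : coords f W ≠ 0 :=
  Finsupp.mem_support_iff.mp (Finset.mem_of_max h)

theorem lm_eq_bot {f : MP k X} : lm f = ⊥ ↔ f = 0 := by
  rw [lm, Finset.max_eq_bot, Finsupp.support_eq_empty, coords_eq, LinearEquiv.map_eq_zero_iff]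

theorem lm_zero : lm (0 : MP k X) = ⊥ := lm_eq_bot.mpr rfl

theorem lm_ne_bot {f : MP k X} (h : f ≠ 0) : ∃ W : MPB k X, lm f = W := by
  obtain ⟨W, hW⟩ := WithBot.ne_bot_iff_exists.mp (fun h' => h (lm_eq_bot.mp h'))
  exact ⟨W, hW.symm⟩

theorem sub_smul_mem {f : MP k X} {W : MPB k X} (h : lm f = W) :
    f - coords f W • W.1.eval k ∈ supp k (Set.Iio W) := by
  rw [mem_supp]
  intro V hV
  simp only [coords_eq, map_sub, map_smul, coordsEquiv_eval, Finsupp.sub_apply,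
    Finsupp.smul_apply, Finsupp.single_apply, smul_eq_mul] at hV
  have hne : V ≠ W := by
    rintro rfl
    simp at hV
  rw [if_neg hne.symm, mul_zero, sub_zero, ← coords_eq] at hV
  have : (V : WithBot (MPB k X)) ≤ lm f := Finset.le_max (Finsupp.mem_support_iff.mpr hV)
  rw [h, WithBot.coe_le_coe] at this
  exact lt_of_le_of_ne this hne

/-- `f` is monic with leading monomial `W`. -/
def Lead (f : MP k X) (W : MPB k X) : Prop := f - W.1.eval k ∈ supp k (Set.Iio W)

theorem lm_of_smul {f : MP k X} {W : MPB k X} {c : k} (hc : c ≠ 0)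
    (h : f - c • W.1.eval k ∈ supp k (Set.Iio W)) : lm f = W := by
  have h1 : coords f W = c := by
    by_contra hne
    have := mem_supp.mp h W
    simp only [coords_eq, map_sub, map_smul, coordsEquiv_eval, Finsupp.sub_apply,
      Finsupp.smul_apply, Finsupp.single_apply, smul_eq_mul, if_true, mul_one] at this
    rw [coords_eq] at hne
    exact (lt_irrefl W) (this (sub_ne_zero.mpr hne))
  apply le_antisymm
  · rw [lm, Finset.max_eq_sup_withBot]
    refine Finset.sup_le fun V hV => ?_
    rw [WithBot.coe_le_coe]
    by_contra hlt
    have h2 := mem_supp.mp h V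
    simp only [coords_eq, map_sub, map_smul, coordsEquiv_eval, Finsupp.sub_apply,
      Finsupp.smul_apply, Finsupp.single_apply, smul_eq_mul] at h2
    rw [if_neg (not_le.mp hlt).ne, mul_zero, sub_zero, ← coords_eq] at h2
    exact hlt (le_of_lt (h2 (Finsupp.mem_support_iff.mp hV)))
  · refine Finset.le_max (Finsupp.mem_support_iff.mpr ?_)
    rwa [h1]

theorem Lead.lm {f : MP k X} {W : MPB k X} (h : Lead f W) : lm f = W :=
  lm_of_smul one_ne_zero (by rwa [one_smul])

theorem Lead.unique {f : MP k X} {W V : MPB k X} (h : Lead f W) (h' : Lead f V) : W = V :=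
  WithBot.coe_injective (h.lm.symm.trans h'.lm)

theorem IsMonic.exists_lead {f : MP k X} (h : IsMonic f) : ∃ W, Lead f W := by
  obtain ⟨W, h1, h2⟩ := h
  have := sub_smul_mem h1
  rw [h2, one_smul] at this
  exact ⟨W, this⟩

theorem IsMonic.lead {f : MP k X} (h : IsMonic f) {W : MPB k X} (hW : MP.lm f = W) : Lead f W := by
  obtain ⟨V, hV⟩ := h.exists_lead
  rw [hV.lm] at hW
  exact WithBot.coe_injective hW ▸ hV

theorem sub_mem_of_lead {f g : MP k X} {W : MPB k X} (hf : Lead f W) (hg : Lead g W) :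
    f - g ∈ supp k (Set.Iio W) := by
  have := Submodule.sub_mem _ hf hg
  rwa [sub_sub_sub_cancel_right] at this

theorem len_le_of_mem_lenSpan {f : MP k X} {n : ℕ} (h : f ∈ lenSpan k X n) {W : MPB k X}
    (hW : lm f = W) : W.1.len ≤ n := by
  rw [lenSpan_eq_supp, mem_supp] at h
  exact h W (coords_lm hW)

theorem lenSpan_le_supp {n : ℕ} {W : MPB k X} (h : n < W.1.len) :
    lenSpan k X n ≤ supp k (Set.Iio W) := by
  rw [lenSpan_eq_supp]
  exact supp_mono fun V hV => (MPB.lt_iff V W).mpr (Or.inl (lt_of_le_of_lt hV h))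

theorem mem_lenSpan_of_lead {f : MP k X} {W : MPB k X} (h : Lead f W) :
    f ∈ lenSpan k X W.1.len := by
  rw [← sub_add_cancel f (W.1.eval k)]
  refine Submodule.add_mem _ ?_ (eval_mem_lenSpan W le_rfl)
  rw [lenSpan_eq_supp]
  refine supp_mono (fun V hV => ?_) h
  rcases (MPB.lt_iff V W).mp hV with h | h
  exacts [h.le, h.1.le]

/-! ### Leading monomials of brackets with letters -/

theorem exists_isLong {W : MPB k X} (h : 5 ≤ W.1.len) : ∃ ε b r, MPB.IsLong W ε b r := by
  obtain ⟨ε, b, c, l, -, h2, -, h4, h5, h6, -⟩ := exists_run_of_five_le h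
  refine ⟨ε, b, (c :: l : List X), ?_, by simpa using h6, by simpa using h4⟩
  rw [h5, Multiset.coe_sort, List.mergeSort_eq_self]
  simpa using h2

/-- If a is not below the second letter c, it joins the tail and the result is a monomial. Otherwise
Jacobi's identity produces the expected monomial minus one whose first letter is c < b. -/
theorem eval_lie_of_isLong {W : MPB k X} {ε : Bool} {b : X} {r : Multiset X}
    (hW : MPB.IsLong W ε b r) (a : X) : ∃ W' : MPB k X, MPB.IsLong W' ε b (a ::ₘ r) ∧
      Lead ⁅W.1.eval k, (ι a : MP k X)⁆ W' := by
  obtain ⟨ε', b', c, l, h1, h2, h3, h4, h5, h6, h7⟩ :=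
    exists_run_of_five_le (k := k) (W := W) (by have := hW.len; have := hW.card; omega)
  have hcl : MPB.IsLong W ε' b' (c ::ₘ (l : Multiset X)) := by
    refine ⟨?_, by simpa using h6, by simpa using h4⟩
    rw [h5, Multiset.cons_coe, Multiset.coe_sort, List.mergeSort_eq_self]
    simpa using h2
  obtain ⟨rfl, rfl, rfl⟩ := hW.unique hcl
  have hne : l ≠ [] := by rintro rfl; simp at h4
  rw [h7, lie_run (lie_mem_square _ _) a hne,
    run_perm h3 (lie_mem_square _ _) (List.perm_append_singleton a l)]
  have hcl := (List.pairwise_cons.mp h2).1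
  have h3' (m : List X) (hm : m.length = l.length + 1) : ε = true → (2 : k) = 0 ∧ 2 ≤ m.length :=
    fun h => ⟨h3 h, by omega⟩
  rcases le_or_gt c a with hca | hac
  · obtain ⟨V, e1, e2, e3⟩ := exists_word_of_min (k := k) (ε := ε) h1
      (l := a :: l) (by simpa using ⟨hca, hcl⟩) (h3' _ (by simp))
    have hV : MPB.IsLong V ε b (a ::ₘ c ::ₘ (l : Multiset X)) := by
      rw [Multiset.cons_swap]
      exact ⟨e1, by simpa using e2, by simp; omega⟩
    refine ⟨V, hV, ?_⟩
    rw [Lead, e3, sub_self]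
    exact Submodule.zero_mem _
  · have hal : ∀ x ∈ l, a ≤ x := fun x hx => hac.le.trans (hcl x hx)
    obtain ⟨V, e1, e2, e3⟩ := exists_word_of_min (k := k) (ε := ε) (hac.trans h1)
      (l := c :: l) (by simpa using ⟨hac.le, hal⟩) (h3' _ (by simp))
    obtain ⟨V', e1', e2', e3'⟩ := exists_word_of_min (k := k) (ε := ε) hac
      (l := b :: l) (by simpa using ⟨(hac.trans h1).le, hal⟩) (h3' _ (by simp))
    have hV : MPB.IsLong V ε b (a ::ₘ c ::ₘ (l : Multiset X)) :=
      ⟨e1, by simpa using e2, by simp; omega⟩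
    have hV' : MPB.IsLong V' ε c (a ::ₘ b ::ₘ (l : Multiset X)) :=
      ⟨e1', by simpa using e2', by simp; omega⟩
    refine ⟨V, hV, ?_⟩
    rw [Lead, run_jacobi h3 b c a (fun _ => hne), ← e3, ← e3', sub_sub_cancel_left]
    refine Submodule.neg_mem _ (eval_mem_supp ((MPB.lt_iff V' V).mpr (Or.inr ⟨?_, Or.inr ⟨?_, ?_⟩⟩)))
    · rw [hV.len, hV'.len]; simp
    · simp only [List.length_cons] at e2 e2'; omega
    · rw [hV.letters, hV'.letters]
      exact List.Lex.rel h1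

theorem lie_of_isLong {W : MPB k X} {ε : Bool} {b : X} {r : Multiset X}
    (hW : MPB.IsLong W ε b r) (a : X) : ∃ W' : MPB k X, MPB.IsLong W' ε b (a ::ₘ r) ∧
      (∀ f, Lead f W → Lead ⁅f, (ι a : MP k X)⁆ W') ∧
      ∀ f ∈ supp k (Set.Iio W), ⁅f, (ι a : MP k X)⁆ ∈ supp k (Set.Iio W') := by
  obtain ⟨W', h1, h2⟩ := eval_lie_of_isLong (k := k) hW a
  have h3 : ∀ f ∈ supp k (Set.Iio W), ⁅f, (ι a : MP k X)⁆ ∈ supp k (Set.Iio W') := by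
    intro f hf
    rw [supp_eq_span] at hf
    refine (Submodule.span_le (p := (supp k (Set.Iio W')).comap (lieₗ.flip (ι a)))).mpr ?_ hf
    rintro _ ⟨V, hV, rfl⟩
    change ⁅V.1.eval k, (ι a : MP k X)⁆ ∈ supp k (Set.Iio W')
    by_cases h5 : 5 ≤ V.1.len
    · obtain ⟨ε', b', r', hV'⟩ := exists_isLong h5
      obtain ⟨V', h4, h6⟩ := eval_lie_of_isLong (k := k) hV' a
      have hlt : V' < W' := hW.lt_of_lt h1 hV' h4 hV
      rw [← sub_add_cancel ⁅V.1.eval k, (ι a : MP k X)⁆ (V'.1.eval k)]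
      exact Submodule.add_mem _ (supp_mono (Set.Iio_subset_Iio hlt.le) h6) (eval_mem_supp hlt)
    -- A monomial with at most four letters yields length at most five, while W' has at least six
    -- letters.
    · refine lenSpan_le_supp ?_ (eval_lie_mem V a)
      have := h1.len
      have := hW.card
      rw [Multiset.card_cons] at *
      omega
  refine ⟨W', h1, fun f hf => ?_, h3⟩
  have h4 := Submodule.add_mem _ (h3 _ hf) h2
  rwa [sub_lie, sub_add_sub_cancel] at h4

theorem bracket_of_isLong {W : MPB k X} {ε : Bool} {b : X} {r : Multiset X}
    (hW : MPB.IsLong W ε b r) (as : List X) : ∃ W' : MPB k X, MPB.IsLong W' ε b (r + as) ∧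
      ∀ f, Lead f W → Lead (bracket f as) W' := by
  induction as generalizing W r with
  | nil => exact ⟨W, by simpa using hW, fun f h => h⟩
  | cons a as ih =>
    obtain ⟨V, h1, h2, -⟩ := lie_of_isLong (k := k) hW a
    obtain ⟨W', h3, h4⟩ := ih h1
    refine ⟨W', ?_, fun f hf => h4 _ (h2 f hf)⟩
    rwa [← Multiset.cons_coe, Multiset.add_cons, ← Multiset.cons_add]

end MP

namespace MP

variable {k : Type u} {X : Type v} [Field k] [LinearOrder X] {S : Set (MP k X)}

/-- The span of the normal polynomials whose leading monomial belongs to a set. -/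
def nspan (S : Set (MP k X)) (B : Set (MPB k X)) : Submodule k (MP k X) :=
  Submodule.span k {g | IsNormal S g ∧ ∃ W ∈ B, lm g = W}

theorem nspan_mono {B C : Set (MPB k X)} (h : B ⊆ C) : nspan S B ≤ nspan S C :=
  Submodule.span_mono fun _ ⟨hg, W, hW, e⟩ => ⟨hg, W, h hW, e⟩

theorem nspan_len_mono {m n : ℕ} (h : m ≤ n) :
    nspan S {W | W.1.len ≤ m} ≤ nspan S {W | W.1.len ≤ n} :=
  nspan_mono fun _ hW => le_trans hW h

theorem mem_nspan {B : Set (MPB k X)} {g : MP k X} {W : MPB k X} (hg : IsNormal S g)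
    (hl : Lead g W) (hW : W ∈ B) : g ∈ nspan S B :=
  Submodule.subset_span ⟨hg, W, hW, hl.lm⟩

/-! ### Normal polynomials -/

variable (hS : ∀ s ∈ S, IsMonic s)

include hS

theorem IsNormal.exists_lead {g : MP k X} (hg : IsNormal S g) : ∃ W, Lead g W := by
  cases hg with
  | base s hs => exact (hS g hs).exists_lead
  | bracket s as W hs hW h5 =>
    obtain ⟨ε, b, r, hl⟩ := exists_isLong h5
    obtain ⟨V, -, h⟩ := bracket_of_isLong (k := k) hl as
    exact ⟨V, h s ((hS s hs).lead hW)⟩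

theorem IsNormal.lead {g : MP k X} (hg : IsNormal S g) {W : MPB k X} (hW : lm g = W) :
    Lead g W := by
  obtain ⟨V, hV⟩ := hg.exists_lead hS
  rw [hV.lm] at hW
  exact WithBot.coe_injective hW ▸ hV

/-- A normal polynomial of length at least five is an iterated bracket of a long element. -/
theorem IsNormal.exists_eq_bracket {g : MP k X} (hg : IsNormal S g) {W : MPB k X} (hW : Lead g W)
    (h5 : 5 ≤ W.1.len) : ∃ s ∈ S, ∃ (as : List X) (ε : Bool) (b : X) (r : Multiset X)
      (V : MPB k X), MPB.IsLong V ε b r ∧ Lead s V ∧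
      MPB.IsLong W ε b (r + as) ∧ g = MP.bracket s as := by
  cases hg with
  | base s hs =>
    obtain ⟨ε, b, r, hl⟩ := exists_isLong h5
    exact ⟨g, hs, [], ε, b, r, W, hl, hW, by simpa using hl, rfl⟩
  | bracket s as V hs hV h5' =>
    obtain ⟨ε, b, r, hl⟩ := exists_isLong h5'
    have hsV := (hS s hs).lead hV
    obtain ⟨V', h1, h2⟩ := bracket_of_isLong (k := k) hl as
    obtain rfl := (h2 s hsV).unique hW
    exact ⟨s, hs, as, ε, b, r, V, hl, hsV, h1, rfl⟩

theorem IsNormal.lie {g : MP k X} (hg : IsNormal S g) {W : MPB k X} (hW : Lead g W)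
    (h5 : 5 ≤ W.1.len) (a : X) : IsNormal S ⁅g, (ι a : MP k X)⁆ := by
  obtain ⟨s, hs, as, ε, b, r, V, hV, hsV, -, rfl⟩ := hg.exists_eq_bracket hS hW h5
  rw [← bracket_concat]
  refine .bracket s _ V hs hsV.lm ?_
  have := hV.len
  have := hV.card
  omega

theorem IsNormal.mem_of_len_le {g : MP k X} (hg : IsNormal S g) {W : MPB k X} (hW : Lead g W)
    (h4 : W.1.len ≤ 4) : g ∈ S := by
  cases hg with
  | base s hs => exact hs
  | bracket s as V hs hV h5' =>
    obtain ⟨ε, b, r, hl⟩ := exists_isLong h5'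
    obtain ⟨V', h1, h2⟩ := bracket_of_isLong (k := k) hl as
    obtain rfl := (h2 s ((hS s hs).lead hV)).unique hW
    have h3 := h1.len
    have h6 := hl.card
    rw [Multiset.card_add] at h3
    omega

/-- The bound by a leading monomial is weakened to a bound by length, which behaves well under
brackets even where short monomials break the order. -/
theorem mem_nspan_of_lm_le {f h : MP k X} {n : ℕ}
    (hf : f ∈ Submodule.span k {g | IsNormal S g ∧ lm g ≤ lm h}) (hh : h ∈ lenSpan k X n) :
    f ∈ nspan S {W | W.1.len ≤ n} := by
  refine Submodule.span_mono ?_ hf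
  rintro g ⟨hg, hle⟩
  obtain ⟨W, hW⟩ := hg.exists_lead hS
  refine ⟨hg, W, ?_, hW.lm⟩
  rw [hW.lm] at hle
  rcases eq_or_ne h 0 with rfl | hne
  · rw [lm_zero] at hle
    exact absurd (le_bot_iff.mp hle) (WithBot.coe_ne_bot)
  · obtain ⟨V, hV⟩ := lm_ne_bot hne
    rw [hV, WithBot.coe_le_coe] at hle
    have := len_le_of_mem_lenSpan hh hV
    rcases hle.eq_or_lt with rfl | h
    · exact this
    · rcases (MPB.lt_iff W V).mp h with h | h
      · exact h.le.trans this
      · exact h.1.le.trans this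

theorem nspan_eq_univ : Submodule.span k {g | IsNormal S g} = nspan S Set.univ := by
  refine congrArg _ (Set.ext fun g => ⟨fun hg => ?_, fun hg => hg.1⟩)
  obtain ⟨W, hW⟩ := hg.exists_lead hS
  exact ⟨hg, W, trivial, hW.lm⟩

/-! ### Consequences of the triviality of multiplication compositions -/

section Mul

variable (hM : TrivialUnderMulCompositions S)

include hM

/-- Brackets of long normal polynomials are normal. Short ones belong to S, and their brackets are
multiplication compositions. -/
theorem lie_mem_nspan_len {f : MP k X} {n : ℕ} (hf : f ∈ nspan S {W | W.1.len ≤ n}) (a : X) :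
    ⁅f, (ι a : MP k X)⁆ ∈ nspan S {W | W.1.len ≤ n + 1} := by
  refine (Submodule.span_le (p := (nspan S {W | W.1.len ≤ n + 1}).comap
    (lieₗ.flip (ι a)))).mpr ?_ hf
  rintro g ⟨hg, W, hWn, hW⟩
  have hn : W.1.len ≤ n := hWn
  have hW' := hg.lead hS hW
  change ⁅g, (ι a : MP k X)⁆ ∈ nspan S {W | W.1.len ≤ n + 1}
  by_cases h5 : 5 ≤ W.1.len
  · obtain ⟨ε, b, r, hl⟩ := exists_isLong h5
    obtain ⟨V, h1, h2, -⟩ := lie_of_isLong (k := k) hl a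
    refine mem_nspan (hg.lie hS hW' h5 a) (h2 g hW') ?_
    have h3 := h1.len
    have h4 := hl.len
    rw [Multiset.card_cons] at h3
    change V.1.len ≤ n + 1
    omega
  · have hs := hg.mem_of_len_le hS hW' (by omega)
    exact mem_nspan_of_lm_le hS (hM _ (.lie g a W hs hW (by omega)))
      (lenSpan_mono (by omega) (lie_mem_lenSpan (mem_lenSpan_of_lead hW') a))

theorem bracket_mem_nspan_len {f : MP k X} {n : ℕ} (hf : f ∈ nspan S {W | W.1.len ≤ n})
    (as : List X) : bracket f as ∈ nspan S {W | W.1.len ≤ n + as.length} := by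
  induction as generalizing f n with
  | nil => exact hf
  | cons a as ih =>
    have := ih (lie_mem_nspan_len hS hM hf a)
    rwa [add_assoc, add_comm 1] at this

theorem lie_mem_nspan {f : MP k X} (hf : f ∈ Submodule.span k {g | IsNormal S g}) (a : X) :
    ⁅f, (ι a : MP k X)⁆ ∈ Submodule.span k {g | IsNormal S g} := by
  refine (Submodule.span_le (p := (Submodule.span k {g | IsNormal S g}).comap
    (lieₗ.flip (ι a)))).mpr ?_ hf
  intro g hg
  obtain ⟨W, hW⟩ := hg.exists_lead hS
  have := lie_mem_nspan_len hS hM (mem_nspan (B := {V | V.1.len ≤ W.1.len}) hg hW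
    (le_refl W.1.len)) a
  rw [nspan_eq_univ hS]
  exact nspan_mono (Set.subset_univ _) this

omit hS in
theorem mul_lie_letters_mem {s : MP k X} (hs : s ∈ S) (a b : X) :
    s * ⁅(ι a : MP k X), (ι b : MP k X)⁆ ∈ Submodule.span k {g | IsNormal S g} := by
  have key : ∀ a b : X, b < a →
      s * ⁅(ι a : MP k X), (ι b : MP k X)⁆ ∈ Submodule.span k {g | IsNormal S g} :=
    fun a b hba => Submodule.span_mono (fun _ h => h.1) (hM _ (.mul_lie s a b hs hba))
  rcases lt_trichotomy a b with h | rfl | h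
  · rw [lie_skew, mul_neg]
    exact Submodule.neg_mem _ (key b a h)
  · rw [lie_self, mul_zero]
    exact Submodule.zero_mem _
  · exact key a b h

/-- The Leibniz identity moves the product inside the last bracket: (g, c)a = (ga, c) - g(a, c). The
correction is a multiplication composition up to sign when g is in S, and zero once g lies in P². -/
theorem mul_mem_nspan {f : MP k X} (hf : f ∈ Submodule.span k {g | IsNormal S g}) (a : X) :
    f * ι a ∈ Submodule.span k {g | IsNormal S g} := by
  set U := Submodule.span k {g | IsNormal S g} with hU
  refine (Submodule.span_le (p := U.comap (mulₗ.flip (ι a)))).mpr ?_ hf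
  have hbase : ∀ s ∈ S, s * ι a ∈ U := fun s hs =>
    Submodule.span_mono (fun _ h => h.1) (hM _ (.mul s a hs))
  intro g hg
  change g * ι a ∈ U
  cases hg with
  | base s hs => exact hbase g hs
  | bracket s as W hs hW h5 =>
    induction as using List.reverseRecOn with
    | nil => exact hbase s hs
    | append_singleton as c ih =>
      rw [bracket_concat]
      have e : ⁅MP.bracket s as, (ι c : MP k X)⁆ * ι a =
          ⁅MP.bracket s as * ι a, (ι c : MP k X)⁆ -
            MP.bracket s as * ⁅(ι a : MP k X), (ι c : MP k X)⁆ := by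
        rw [mul_lie, add_sub_cancel_right]
      rw [e]
      refine U.sub_mem (lie_mem_nspan hS hM ih c) ?_
      cases as with
      | nil => exact mul_lie_letters_mem hM hs a c
      | cons d as =>
        rw [bracket_cons, mul_eq_zero_of_square (bracket_mem_square (lie_mem_square _ _) as) (lie_mem_square _ _)]
        exact U.zero_mem

theorem idealSpan_le : idealSpan S ≤ Submodule.span k {g | IsNormal S g} := by
  refine sInf_le ⟨fun s hs => Submodule.subset_span (.base s hs), fun f hf g => ?_⟩
  exact mul_lie_mem_of_letters (fun f hf a => mul_mem_nspan hS hM hf a)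
    (fun f hf a => lie_mem_nspan hS hM hf a) g f hf

omit hS hM in
-- All monomials of f other than letters lie in P² and bracket to zero with (a, b).
theorem lie_lie_letters_mem_lenSpan (f : MP k X) (a b : X) :
    ⁅f, ⁅(ι a : MP k X), (ι b : MP k X)⁆⁆ ∈ lenSpan k X 3 := by
  have hf : f ∈ Submodule.span k (Set.range fun W : MPB k X => W.1.eval k) := by
    rw [span_eval_eq_top]; trivial
  refine (Submodule.span_le (p := (lenSpan k X 3).comap
    (lieₗ.flip ⁅(ι a : MP k X), (ι b : MP k X)⁆))).mpr ?_ hf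
  rintro _ ⟨W, rfl⟩
  change ⁅W.1.eval k, ⁅(ι a : MP k X), (ι b : MP k X)⁆⁆ ∈ lenSpan k X 3
  have h0 {f : MP k X} (hf : f ∈ square k (MP k X)) :
      ⁅f, ⁅(ι a : MP k X), (ι b : MP k X)⁆⁆ ∈ lenSpan k X 3 := by
    rw [lie_eq_zero_of_square hf (lie_mem_square _ _)]
    exact Submodule.zero_mem _
  obtain ⟨W, hW⟩ := W
  cases hW with
  | letter c =>
    change ⁅(ι c : MP k X), ⁅(ι a : MP k X), (ι b : MP k X)⁆⁆ ∈ lenSpan k X 3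
    rw [lie_skew]
    exact Submodule.neg_mem _ (run_mem_lenSpan (ε := false) (l := [c]) a b (by simp) le_rfl)
  | lie a a' r => exact h0 (bracket_mem_square (lie_mem_square _ _) r)
  | com₂ a a' => exact h0 (mul_mem_square _ _)
  | com₃ a a' a'' => exact h0 (mul_mem_square _ _)
  | mix₃ a a' d => exact h0 (mul_mem_square _ _)
  | mix₄ a a' a'' d => exact h0 (mul_mem_square _ _)
  | mix a a' a'' as d => exact h0 (mul_mem_square _ _)

/-- Elements of S may contain letters, so the operators of letters need not commute on them. This
bounds the defect. -/
theorem lie_lie_letters_mem_nspan {s : MP k X} (hs : s ∈ S) (a b : X) :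
    ⁅s, ⁅(ι a : MP k X), (ι b : MP k X)⁆⁆ ∈ nspan S {W | W.1.len ≤ 3} := by
  have key : ∀ a b : X, b < a →
      ⁅s, ⁅(ι a : MP k X), (ι b : MP k X)⁆⁆ ∈ nspan S {W | W.1.len ≤ 3} :=
    fun a b hba => mem_nspan_of_lm_le hS (hM _ (.lie_lie s a b hs hba))
      (lie_lie_letters_mem_lenSpan s a b)
  rcases lt_trichotomy a b with h | rfl | h
  · rw [lie_skew (ι a : MP k X), lie_neg]
    exact Submodule.neg_mem _ (key b a h)
  · rw [lie_self, lie_zero]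
    exact Submodule.zero_mem _
  · exact key a b h

/-- Iterated brackets depend on the order of the letters only up to shorter normal polynomials. -/
theorem bracket_perm_sub_mem {f : MP k X}
    (hf : ∀ a b : X, ⁅f, ⁅(ι a : MP k X), (ι b : MP k X)⁆⁆ ∈ nspan S {W | W.1.len ≤ 3})
    {as bs : List X} (h : as.Perm bs) :
    bracket f as - bracket f bs ∈ nspan S {W | W.1.len ≤ as.length + 1} := by
  induction h generalizing f with
  | nil =>
    rw [sub_self]
    exact Submodule.zero_mem _
  | cons a h ih =>
    -- After one bracket the element lies in P², where the defect vanishes.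
    refine nspan_len_mono (by simp) (ih fun b c => ?_)
    · rw [lie_eq_zero_of_square (lie_mem_square _ _) (lie_mem_square _ _)]
      exact Submodule.zero_mem _
  | swap a b l =>
    -- The difference is the bracket of (f, (b, a)), of length at most three, with the remaining
    -- letters.
    rw [bracket_cons, bracket_cons, bracket_cons, bracket_cons, ← bracket_sub, ← lie_lie]
    have := bracket_mem_nspan_len hS hM (hf b a) l
    refine nspan_len_mono ?_ this
    simp only [List.length_cons]
    omega
  | trans h1 h2 ih1 ih2 =>
    have h3 := ih2 hf
    rw [← h1.length_eq] at h3
    have := Submodule.add_mem _ (ih1 hf) h3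
    rwa [sub_add_sub_cancel] at this

theorem lie_mem_nspan_Iio {W W' : MPB k X} {ε : Bool} {b : X} {r : Multiset X} {a : X}
    (hW : MPB.IsLong W ε b r) (hW' : MPB.IsLong W' ε b (a ::ₘ r)) {f : MP k X}
    (hf : f ∈ nspan S (Set.Iio W)) : ⁅f, (ι a : MP k X)⁆ ∈ nspan S (Set.Iio W') := by
  refine (Submodule.span_le (p := (nspan S (Set.Iio W')).comap (lieₗ.flip (ι a)))).mpr ?_ hf
  rintro g ⟨hg, V, hVW, hV⟩
  have hV' := hg.lead hS hV
  change ⁅g, (ι a : MP k X)⁆ ∈ nspan S (Set.Iio W')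
  by_cases h5 : 5 ≤ V.1.len
  · obtain ⟨ε', b', r', hl⟩ := exists_isLong h5
    obtain ⟨V', h1, h2, -⟩ := lie_of_isLong (k := k) hl a
    exact mem_nspan (hg.lie hS hV' h5 a) (h2 g hV') (hW.lt_of_lt hW' hl h1 hVW)
  · refine nspan_mono ?_ (lie_mem_nspan_len hS hM
      (mem_nspan (B := {U | U.1.len ≤ V.1.len}) hg hV' (le_refl V.1.len)) a)
    intro U hU
    refine (MPB.lt_iff U W').mpr (Or.inl ?_)
    have h1 := hW'.len
    have h2 := hW.card
    have h3 : U.1.len ≤ V.1.len + 1 := hU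
    rw [Multiset.card_cons] at h1
    omega

theorem bracket_mem_nspan_Iio {W W' : MPB k X} {ε : Bool} {b : X} {r : Multiset X} {as : List X}
    (hW : MPB.IsLong W ε b r) (hW' : MPB.IsLong W' ε b (r + as)) {f : MP k X}
    (hf : f ∈ nspan S (Set.Iio W)) : bracket f as ∈ nspan S (Set.Iio W') := by
  induction as generalizing W r f with
  | nil =>
    obtain rfl := hW.eq (by simpa using hW')
    exact hf
  | cons a as ih =>
    obtain ⟨V, h1, -, -⟩ := lie_of_isLong (k := k) hW a
    refine ih h1 ?_ (lie_mem_nspan_Iio hS hM hW h1 hf)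
    rwa [← Multiset.cons_coe, Multiset.add_cons, ← Multiset.cons_add] at hW'

omit hM in
theorem mem_nspan_of_lm_lt {f : MP k X} {W : MPB k X}
    (hf : f ∈ Submodule.span k {g | IsNormal S g ∧ lm g < W}) : f ∈ nspan S (Set.Iio W) := by
  refine Submodule.span_mono ?_ hf
  rintro g ⟨hg, hlt⟩
  obtain ⟨V, hV⟩ := hg.exists_lead hS
  rw [hV.lm, WithBot.coe_lt_coe] at hlt
  exact ⟨hg, V, hlt, hV.lm⟩

/-- The reordering error has length at most `as.length + 1`, and W has at least four letters more.
-/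
theorem bracket_sub_bracket_sort_mem {s : MP k X} (hs : s ∈ S) {V W : MPB k X} {ε : Bool} {b : X}
    {r : Multiset X} {as : List X} {p q : Multiset X} (hV : MPB.IsLong V ε b r)
    (hW : MPB.IsLong W ε b (r + as)) (e : p + q = as) :
    bracket s as - bracket s (p.sort ++ q.sort) ∈ nspan S (Set.Iio W) := by
  have hp : as.Perm (p.sort ++ q.sort) := by
    rw [← Multiset.coe_eq_coe, ← Multiset.coe_add, Multiset.sort_eq, Multiset.sort_eq, e]
  have h := bracket_perm_sub_mem hS hM (lie_lie_letters_mem_nspan hS hM hs) hp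
  refine nspan_mono (fun U hU => (MPB.lt_iff U W).mpr (Or.inl ?_)) h
  have h1 := hW.len
  have h2 := hV.card
  have h3 : U.1.len ≤ as.length + 1 := hU
  rw [Multiset.card_add, Multiset.coe_card] at h1
  omega

/-! ### Comparison of normal polynomials with equal leading monomials -/

variable (hG : TrivialUnderGenCompositions S)

include hG

omit hM in
theorem bracket_sub_bracket_mem {s₁ s₂ : MP k X} (h₁ : s₁ ∈ S) (h₂ : s₂ ∈ S) {V₁ V₂ W : MPB k X}
    {ε : Bool} {b : X} {r₁ r₂ p q : Multiset X} (hV₁ : MPB.IsLong V₁ ε b r₁)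
    (hV₂ : MPB.IsLong V₂ ε b r₂) (hl₁ : Lead s₁ V₁) (hl₂ : Lead s₂ V₂)
    (hW : MPB.IsLong W ε b (r₁ + p)) (hpq : r₁ + p = r₂ + q) (hd : ∀ c ∈ p, c ∉ q) :
    bracket s₁ p.sort - bracket s₂ q.sort ∈ nspan S (Set.Iio W) := by
  have hlm : lm (bracket s₁ p.sort) = W := by
    obtain ⟨W', h3, h4⟩ := bracket_of_isLong (k := k) hV₁ p.sort
    rw [Multiset.sort_eq] at h3
    rw [(h4 s₁ hl₁).lm, hW.eq h3]
  refine mem_nspan_of_lm_lt hS ?_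
  rw [← hlm]
  apply hG
  -- The number of brackets forces the constructor of a long monomial, so equal flags select the
  -- same kind of general composition.
  have shape (V : MPB k X) (r : Multiset X) (hV : MPB.IsLong V ε b r) :
      (ε = false ∧ V.1 = .lie b r.sort) ∨
        (ε = true ∧ ∃ as c, V.1 = .mix b as c ∧ as ++ [c] = r.sort) := by
    obtain ⟨h3, h4, h5⟩ := hV
    have h6 := r.length_sort (r := (· ≤ ·))
    cases hV : V.1 with
    | lie a as =>
      rw [hV] at h3 h4
      simp only [Word.letters, List.cons.injEq, Word.pb] at h3 h4
      rw [← h3.2] at h6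
      have : ε = false := by cases ε <;> simp at h4 ⊢; omega
      exact Or.inl ⟨this, by rw [h3.1, h3.2]⟩
    | com a as =>
      rw [hV] at h4
      simp only [Word.pb] at h4
      have := ε.toNat_le
      omega
    | mix a as c =>
      rw [hV] at h3 h4
      simp only [Word.letters, List.cons.injEq, Word.pb] at h3 h4
      rw [← h3.2, List.length_append, List.length_singleton] at h6
      have : ε = true := by cases ε <;> simp at h4 ⊢; omega
      exact Or.inr ⟨this, as, c, by rw [h3.1], h3.2⟩
  rcases shape V₁ r₁ hV₁ with ⟨e₁, h3⟩ | ⟨e₁, as, c, h3, h4⟩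
  · rcases shape V₂ r₂ hV₂ with ⟨-, h5⟩ | ⟨e₂, -⟩
    · refine .lie s₁ s₂ V₁ V₂ b _ _ p q h₁ h₂ hl₁.lm hl₂.lm h3 h5 ?_ ?_ ?_ hd
      · rw [Multiset.length_sort]; exact hV₁.card
      · rw [Multiset.length_sort]; exact hV₂.card
      · rwa [Multiset.sort_eq, Multiset.sort_eq]
    · rw [e₁] at e₂; exact absurd e₂ (by simp)
  · rcases shape V₂ r₂ hV₂ with ⟨e₂, -⟩ | ⟨-, bs, d, h5, h6⟩
    · rw [e₁] at e₂; exact absurd e₂ (by simp)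
    · refine .mix s₁ s₂ V₁ V₂ b as bs c d p q h₁ h₂ hl₁.lm hl₂.lm h3 h5 ?_ ?_ ?_ hd
      · rw [h4, Multiset.length_sort]; exact hV₁.card
      · rw [h6, Multiset.length_sort]; exact hV₂.card
      · rwa [h4, h6, Multiset.sort_eq, Multiset.sort_eq]

/-- Normal polynomials with the same leading monomial agree up to smaller ones. -/
theorem IsNormal.sub_mem {g₁ g₂ : MP k X} (h₁ : IsNormal S g₁) (h₂ : IsNormal S g₂) {W : MPB k X}
    (hl₁ : Lead g₁ W) (hl₂ : Lead g₂ W) : g₁ - g₂ ∈ nspan S (Set.Iio W) := by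
  by_cases h5 : 5 ≤ W.1.len
  · obtain ⟨s₁, hs₁, as₁, ε, b, r₁, V₁, hV₁, hL₁, hW, rfl⟩ := h₁.exists_eq_bracket hS hl₁ h5
    obtain ⟨s₂, hs₂, as₂, ε', b', r₂, V₂, hV₂, hL₂, hW', rfl⟩ := h₂.exists_eq_bracket hS hl₂ h5
    obtain ⟨rfl, rfl, hr⟩ := hW.unique hW'
    set m₁ : Multiset X := (as₁ : Multiset X) with hm₁
    set m₂ : Multiset X := (as₂ : Multiset X) with hm₂
    -- The two differences are the complementary factors of the composition; the intersection
    -- collects the letters to be split off.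
    have e₁ : m₁ - m₂ + m₁ ∩ m₂ = m₁ := Multiset.sub_add_inter m₁ m₂
    have e₂ : m₂ - m₁ + m₁ ∩ m₂ = m₂ := by
      rw [Multiset.inter_comm]; exact Multiset.sub_add_inter m₂ m₁
    have hpq : r₁ + (m₁ - m₂) = r₂ + (m₂ - m₁) := by
      rw [← e₁, ← e₂, ← add_assoc, ← add_assoc] at hr
      simpa [e₁, e₂] using hr
    have hd : ∀ c ∈ m₁ - m₂, c ∉ m₂ - m₁ := by
      intro c h1 h2
      rw [Multiset.mem_sub] at h1 h2
      exact absurd h1 h2.not_gt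
    obtain ⟨W', hW₁, -⟩ := bracket_of_isLong (k := k) hV₁ (m₁ - m₂).sort
    rw [Multiset.sort_eq] at hW₁
    have main := bracket_sub_bracket_mem hS hG hs₁ hs₂ hV₁ hV₂ hL₁ hL₂ hW₁ hpq hd
    -- Brackets with the common letters carry the trivial composition to an element below W.
    have main' := bracket_mem_nspan_Iio hS hM (as := (m₁ ∩ m₂).sort) (W' := W) hW₁
      (by rwa [Multiset.sort_eq, add_assoc, e₁]) main
    rw [bracket_sub, ← bracket_append, ← bracket_append] at main'
    have p₁ := bracket_sub_bracket_sort_mem hS hM hs₁ hV₁ hW e₁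
    have p₂ := bracket_sub_bracket_sort_mem hS hM hs₂ hV₂ hW' e₂
    have := Submodule.sub_mem _ (Submodule.add_mem _ p₁ main') p₂
    rwa [sub_add_sub_cancel, sub_sub_sub_cancel_right] at this
  · have hs₁ := h₁.mem_of_len_le hS hl₁ (by omega)
    have hs₂ := h₂.mem_of_len_le hS hl₂ (by omega)
    have := hG _ _ (.eq g₁ g₂ hs₁ hs₂ (hl₁.lm.trans hl₂.lm.symm))
    rw [hl₁.lm] at this
    exact mem_nspan_of_lm_lt hS this

end Mul

end MP

/-! ### The ideal generated by S and descent on leading monomials -/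

namespace MP

variable {k : Type u} {X : Type v} [Field k] {S : Set (MP k X)}

theorem idealSpan_isIdeal (S : Set (MP k X)) {f : MP k X} (hf : f ∈ idealSpan S) (g : MP k X) :
    f * g ∈ idealSpan S ∧ ⁅f, g⁆ ∈ idealSpan S := by
  simp only [idealSpan, Submodule.mem_sInf] at hf ⊢
  exact ⟨fun I hI => (hI.2 f (hf I hI) g).1, fun I hI => (hI.2 f (hf I hI) g).2⟩

theorem subset_idealSpan (S : Set (MP k X)) : S ⊆ idealSpan S := fun s hs => by
  rw [SetLike.mem_coe, idealSpan, Submodule.mem_sInf]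
  exact fun I hI => hI.1 hs

theorem bracket_mem_idealSpan {f : MP k X} (hf : f ∈ idealSpan S) (as : List X) :
    bracket f as ∈ idealSpan S := by
  induction as generalizing f with
  | nil => exact hf
  | cons a as ih => exact ih (idealSpan_isIdeal S hf _).2

variable [LinearOrder X]

theorem IsNormal.mem_idealSpan {g : MP k X} (hg : IsNormal S g) : g ∈ idealSpan S := by
  cases hg with
  | base s hs => exact subset_idealSpan S hs
  | bracket s as W hs => exact bracket_mem_idealSpan (subset_idealSpan S hs) as

theorem mem_Iio_of_smul_sub {f : MP k X} {W : MPB k X} {c : k} {g : MP k X} (hg : Lead g W)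
    (hf : f - c • W.1.eval k ∈ supp k (Set.Iio W)) : f - c • g ∈ supp k (Set.Iio W) := by
  have := Submodule.sub_mem _ hf (Submodule.smul_mem _ c hg)
  rwa [smul_sub, sub_sub_sub_cancel_right] at this

theorem sub_smul_lead_mem {f g : MP k X} {W : MPB k X} (hf : lm f = W) (hg : Lead g W) :
    f - coords f W • g ∈ supp k (Set.Iio W) := mem_Iio_of_smul_sub hg (sub_smul_mem hf)

theorem lead_of_mem_Iio {f g : MP k X} {W : MPB k X} {c : k} (hc : c ≠ 0) (hg : Lead g W)
    (hf : f - c • g ∈ supp k (Set.Iio W)) : lm f = W := by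
  refine lm_of_smul hc ?_
  have := Submodule.add_mem _ hf (Submodule.smul_mem _ c hg)
  rwa [smul_sub, sub_add_sub_cancel] at this

theorem nspan_Iio_le_supp (W : MPB k X) : nspan S (Set.Iio W) ≤ supp k (Set.Iio W) := by
  refine Submodule.span_le.mpr ?_
  rintro g ⟨-, V, hV, e⟩
  rw [SetLike.mem_coe, ← lm_lt_iff, e]
  exact WithBot.coe_lt_coe.mpr hV

theorem exists_normal_of_notMem_irr {W : MPB k X} (hW : W ∉ Irr S) :
    ∃ g, IsNormal S g ∧ lm g = W := by
  by_contra h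
  exact hW fun g hg e => h ⟨g, hg, e.symm⟩

variable (hS : ∀ s ∈ S, IsMonic s)

include hS

/-- An element of the span of the normal polynomials below `W` has the leading monomial of a normal
polynomial. -/
theorem exists_normal_of_mem_nspan [WellFoundedLT X] (hM : TrivialUnderMulCompositions S)
    (hG : TrivialUnderGenCompositions S) (W : MPB k X) {f : MP k X} (hf : f ∈ nspan S (Set.Iic W))
    (hne : f ≠ 0) : ∃ h, IsNormal S h ∧ lm f = lm h := by
  induction W using WellFoundedLT.induction generalizing f with
  | ind W ih =>
    have below : ∀ f ∈ nspan S (Set.Iio W), f ≠ 0 → ∃ h, IsNormal S h ∧ lm f = lm h := by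
      intro f hf hne
      -- A finite combination below W is bounded by some V < W; the alternative f = 0 covers the
      -- empty combination.
      suffices h : f = 0 ∨ ∃ V < W, f ∈ nspan S (Set.Iic V) by
        rcases h with h | ⟨V, hV, h⟩
        exacts [absurd h hne, ih V hV h hne]
      clear hne
      induction hf using Submodule.span_induction with
      | mem g hg =>
        obtain ⟨hn, V, hV, e⟩ := hg
        exact Or.inr ⟨V, hV, Submodule.subset_span ⟨hn, V, Set.mem_Iic.mpr le_rfl, e⟩⟩
      | zero => exact Or.inl rfl
      | add x y _ _ hx hy =>
        rcases hx with rfl | ⟨V, hV, hx⟩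
        · rwa [zero_add]
        rcases hy with rfl | ⟨U, hU, hy⟩
        · rw [add_zero]; exact Or.inr ⟨V, hV, hx⟩
        exact Or.inr ⟨max V U, max_lt hV hU, Submodule.add_mem _
          (nspan_mono (Set.Iic_subset_Iic.mpr (le_max_left V U)) hx)
          (nspan_mono (Set.Iic_subset_Iic.mpr (le_max_right V U)) hy)⟩
      | smul c x _ hx =>
        rcases hx with rfl | ⟨V, hV, hx⟩
        · exact Or.inl (smul_zero c)
        · exact Or.inr ⟨V, hV, Submodule.smul_mem _ c hx⟩
    by_cases hex : ∃ h, IsNormal S h ∧ lm h = W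
    · obtain ⟨h, hh, hW⟩ := hex
      have hl := hh.lead hS hW
      -- Modulo normal polynomials below W, every generator with leading monomial W equals h, so f
      -- is a multiple of h. A nonzero factor gives the leading monomial W, a zero one lets the
      -- descent continue.
      have : ∃ c : k, f - c • h ∈ nspan S (Set.Iio W) := by
        induction hf using Submodule.span_induction with
        | mem g hg =>
          obtain ⟨hn, V, hV, e⟩ := hg
          rcases (Set.mem_Iic.mp hV).eq_or_lt with rfl | hlt
          · exact ⟨1, by rw [one_smul]; exact hn.sub_mem hS hM hG hh (hn.lead hS e) hl⟩
          · exact ⟨0, by rw [zero_smul, sub_zero]; exact Submodule.subset_span ⟨hn, V, hlt, e⟩⟩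
        | zero => exact ⟨0, by rw [zero_smul, sub_zero]; exact Submodule.zero_mem _⟩
        | add x y _ _ hx hy =>
          have hx' : ∃ c : k, x - c • h ∈ nspan S (Set.Iio W) := by
            by_cases h0 : x = 0
            · exact ⟨0, by rw [h0, zero_smul, sub_zero]; exact Submodule.zero_mem _⟩
            · exact hx h0
          have hy' : ∃ c : k, y - c • h ∈ nspan S (Set.Iio W) := by
            by_cases h0 : y = 0
            · exact ⟨0, by rw [h0, zero_smul, sub_zero]; exact Submodule.zero_mem _⟩
            · exact hy h0
          obtain ⟨c, hc⟩ := hx'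
          obtain ⟨d, hd⟩ := hy'
          refine ⟨c + d, ?_⟩
          rw [add_smul, add_sub_add_comm]
          exact Submodule.add_mem _ hc hd
        | smul d x _ hx =>
          obtain ⟨c, hc⟩ := hx (fun h0 => hne (by rw [h0, smul_zero]))
          refine ⟨d * c, ?_⟩
          rw [mul_smul, ← smul_sub]
          exact Submodule.smul_mem _ d hc
      obtain ⟨c, hc⟩ := this
      rcases eq_or_ne c 0 with rfl | hc0
      · rw [zero_smul, sub_zero] at hc
        exact below f hc hne
      · exact ⟨h, hh, (lead_of_mem_Iio hc0 hl (nspan_Iio_le_supp W hc)).trans hl.lm.symm⟩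
    · refine below f (Submodule.span_mono ?_ hf) hne
      rintro g ⟨hn, V, hV, e⟩
      refine ⟨hn, V, Set.mem_Iio.mpr (lt_of_le_of_ne hV ?_), e⟩
      rintro rfl
      exact hex ⟨g, hn, e⟩

theorem isGroebnerShirshovBasis_of_trivial [WellFoundedLT X] (hM : TrivialUnderMulCompositions S)
    (hG : TrivialUnderGenCompositions S) : IsGroebnerShirshovBasis S (idealSpan S) := by
  refine ⟨rfl, fun f hf hne => ?_⟩
  have h1 := idealSpan_le hS hM hf
  suffices h : f = 0 ∨ ∃ V, f ∈ nspan S (Set.Iic V) by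
    rcases h with h | ⟨V, h⟩
    exacts [absurd h hne, exists_normal_of_mem_nspan hS hM hG V h hne]
  clear hf hne
  induction h1 using Submodule.span_induction with
  | mem g hg =>
    obtain ⟨V, hV⟩ := IsNormal.exists_lead hS hg
    exact Or.inr ⟨V, mem_nspan hg hV (Set.mem_Iic.mpr le_rfl)⟩
  | zero => exact Or.inl rfl
  | add x y _ _ hx hy =>
    rcases hx with rfl | ⟨V, hx⟩
    · rwa [zero_add]
    rcases hy with rfl | ⟨U, hy⟩
    · rw [add_zero]; exact Or.inr ⟨V, hx⟩
    exact Or.inr ⟨max V U, Submodule.add_mem _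
      (nspan_mono (Set.Iic_subset_Iic.mpr (le_max_left V U)) hx)
      (nspan_mono (Set.Iic_subset_Iic.mpr (le_max_right V U)) hy)⟩
  | smul c x _ hx =>
    rcases hx with rfl | ⟨V, hx⟩
    · exact Or.inl (smul_zero c)
    · exact Or.inr ⟨V, Submodule.smul_mem _ c hx⟩

/-! ### From a Gröbner–Shirshov basis to trivial compositions -/

section GroebnerShirshov

variable [WellFoundedLT X] (h : IsGroebnerShirshovBasis S (idealSpan S))

include h

/-- Division algorithm: subtracting a multiple of a normal polynomial with the same leading monomial
stays in the ideal and lowers the leading monomial. -/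
theorem mem_nspan_of_mem_idealSpan (W : MPB k X) {f : MP k X} (hf : f ∈ idealSpan S)
    (hW : lm f = W) : f ∈ nspan S (Set.Iic W) := by
  induction W using WellFoundedLT.induction generalizing f with
  | ind W ih =>
    have hne : f ≠ 0 := by
      rintro rfl
      rw [lm_zero] at hW
      exact WithBot.bot_ne_coe hW
    obtain ⟨g, hg, e⟩ := h.2 f hf hne
    rw [hW] at e
    have hl := hg.lead hS e.symm
    have h1 := sub_smul_lead_mem hW hl
    have h2 : f - coords f W • g ∈ nspan S (Set.Iic W) := by
      by_cases h0 : f - coords f W • g = 0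
      · rw [h0]; exact Submodule.zero_mem _
      obtain ⟨V, hV⟩ := lm_ne_bot h0
      have hlt := lm_lt_iff.mpr h1
      rw [hV, WithBot.coe_lt_coe] at hlt
      exact nspan_mono (Set.Iic_subset_Iic.mpr hlt.le)
        (ih V hlt (Submodule.sub_mem _ hf (Submodule.smul_mem _ _ hg.mem_idealSpan)) hV)
    have h3 : g ∈ nspan S (Set.Iic W) := mem_nspan hg hl (Set.mem_Iic.mpr le_rfl)
    have := Submodule.add_mem _ h2 (Submodule.smul_mem _ (coords f W) h3)
    rwa [sub_add_cancel] at this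

theorem mem_span_of_mem_idealSpan {f : MP k X} (hf : f ∈ idealSpan S) :
    f ∈ Submodule.span k {g | IsNormal S g ∧ lm g ≤ lm f} := by
  by_cases h0 : f = 0
  · rw [h0]; exact Submodule.zero_mem _
  obtain ⟨W, hW⟩ := lm_ne_bot h0
  refine Submodule.span_mono ?_ (mem_nspan_of_mem_idealSpan hS h W hf hW)
  rintro g ⟨hg, V, hV, e⟩
  refine ⟨hg, ?_⟩
  rw [e, hW]
  exact WithBot.coe_le_coe.mpr hV

theorem trivialUnderMulCompositions : TrivialUnderMulCompositions S := by
  intro f hf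
  apply mem_span_of_mem_idealSpan hS h
  cases hf with
  | mul s a hs => exact (idealSpan_isIdeal S (subset_idealSpan S hs) _).1
  | mul_lie s a b hs => exact (idealSpan_isIdeal S (subset_idealSpan S hs) _).1
  | lie_lie s a b hs => exact (idealSpan_isIdeal S (subset_idealSpan S hs) _).2
  | lie s a W hs => exact (idealSpan_isIdeal S (subset_idealSpan S hs) _).2

/-- The leading terms cancel, so the normal polynomials produced by division are strictly smaller.
-/
theorem sub_mem_span_of_lead {f g : MP k X} (hf : f ∈ idealSpan S) (hg : g ∈ idealSpan S)
    {W : MPB k X} (hlf : Lead f W) (hlg : Lead g W) :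
    f - g ∈ Submodule.span k {h | IsNormal S h ∧ lm h < lm f} := by
  refine Submodule.span_mono ?_ (mem_span_of_mem_idealSpan hS h (Submodule.sub_mem _ hf hg))
  rintro h' ⟨hn, hle⟩
  refine ⟨hn, hle.trans_lt ?_⟩
  rw [hlf.lm]
  exact lm_lt_iff.mpr (sub_mem_of_lead hlf hlg)

theorem bracket_sub_mem_span {s₁ s₂ : MP k X} (h₁ : s₁ ∈ S) (h₂ : s₂ ∈ S) {W₁ W₂ : MPB k X}
    {ε : Bool} {b : X} {r₁ r₂ p q : Multiset X} (hl₁ : lm s₁ = W₁) (hl₂ : lm s₂ = W₂)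
    (hW₁ : MPB.IsLong W₁ ε b r₁) (hW₂ : MPB.IsLong W₂ ε b r₂) (hpq : r₁ + p = r₂ + q) :
    bracket s₁ p.sort - bracket s₂ q.sort ∈
      Submodule.span k {g | IsNormal S g ∧ lm g < lm (bracket s₁ p.sort)} := by
  obtain ⟨V₁, hV₁, e₁⟩ := bracket_of_isLong (k := k) hW₁ p.sort
  obtain ⟨V₂, hV₂, e₂⟩ := bracket_of_isLong (k := k) hW₂ q.sort
  rw [Multiset.sort_eq] at hV₁ hV₂
  rw [← hpq] at hV₂
  obtain rfl := hV₁.eq hV₂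
  exact sub_mem_span_of_lead hS h (bracket_mem_idealSpan (subset_idealSpan S h₁) _)
    (bracket_mem_idealSpan (subset_idealSpan S h₂) _) (e₁ _ ((hS s₁ h₁).lead hl₁))
    (e₂ _ ((hS s₂ h₂).lead hl₂))

omit hS h [WellFoundedLT X] in
theorem isLong_of_lie {W : MPB k X} {a : X} {as : List X} (hW : W.1 = .lie a as)
    (h4 : 4 ≤ as.length) : MPB.IsLong W false a as := by
  obtain ⟨ε, b, r, h⟩ := exists_isLong (W := W) (by rw [hW]; simp [Word.len, Word.letters]; omega)
  have h1 := h.letters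
  have h2 := h.pb
  rw [hW] at h1 h2
  simp only [Word.letters, List.cons.injEq, Word.pb] at h1 h2
  obtain ⟨rfl, rfl⟩ := h1
  rw [Multiset.length_sort] at h2
  have : ε = false := by cases ε <;> simp at h2 ⊢
  rw [Multiset.sort_eq, ← this]
  exact h

omit hS h [WellFoundedLT X] in
-- The length condition excludes mixed monomials with three or four letters, leaving those of
-- characteristic 2.
theorem isLong_of_mix {W : MPB k X} {a c : X} {as : List X} (hW : W.1 = .mix a as c)
    (h4 : 4 ≤ (as ++ [c]).length) : MPB.IsLong W true a (as ++ [c] : List X) := by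
  obtain ⟨ε, b, r, h⟩ := exists_isLong (W := W) (by
    rw [hW]; simp [Word.len, Word.letters] at h4 ⊢; omega)
  have h1 := h.letters
  have h2 := h.pb
  rw [hW] at h1 h2
  simp only [Word.letters, List.cons.injEq, Word.pb] at h1 h2
  obtain ⟨rfl, h1⟩ := h1
  have h3 := r.length_sort (r := (· ≤ ·))
  rw [← h1, List.length_append, List.length_singleton] at h3
  have : ε = true := by cases ε <;> simp at h2 ⊢; omega
  rw [h1, Multiset.sort_eq, ← this]
  exact h

theorem trivialUnderGenCompositions : TrivialUnderGenCompositions S := by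
  intro f W hf
  cases hf with
  | eq s₁ s₂ h₁ h₂ he =>
    obtain ⟨V, hV⟩ := (hS s₁ h₁).exists_lead
    exact sub_mem_span_of_lead hS h (subset_idealSpan S h₁) (subset_idealSpan S h₂) hV
      ((hS s₂ h₂).lead (he.symm.trans hV.lm))
  | lie s₁ s₂ W₁ W₂ a as bs p q h₁ h₂ hl₁ hl₂ e₁ e₂ has hbs hpq =>
    exact bracket_sub_mem_span hS h h₁ h₂ hl₁ hl₂ (isLong_of_lie e₁ has) (isLong_of_lie e₂ hbs) hpq
  | mix s₁ s₂ W₁ W₂ a as bs c d p q h₁ h₂ hl₁ hl₂ e₁ e₂ has hbs hpq =>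
    exact bracket_sub_mem_span hS h h₁ h₂ hl₁ hl₂ (isLong_of_mix e₁ has) (isLong_of_mix e₂ hbs) hpq

end GroebnerShirshov

/-! ### Irreducible monomials -/

/-- A reducible monomial is replaced by the smaller terms of a normal polynomial, and the order is
well founded. -/
theorem supp_Iio_le [WellFoundedLT X] (W : MPB k X) :
    supp k (Set.Iio W) ≤ supp k (Irr S ∩ Set.Iio W) ⊔ idealSpan S := by
  induction W using WellFoundedLT.induction with
  | ind W ih =>
    rw [supp_eq_span, Submodule.span_le]
    rintro _ ⟨V, hV, rfl⟩
    change V.1.eval k ∈ _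
    by_cases hI : V ∈ Irr S
    · exact Submodule.mem_sup_left (eval_mem_supp ⟨hI, hV⟩)
    · obtain ⟨g, hg, e⟩ := exists_normal_of_notMem_irr hI
      have hl := hg.lead hS e
      rw [← sub_sub_cancel g (V.1.eval k)]
      refine Submodule.sub_mem _ (Submodule.mem_sup_right hg.mem_idealSpan) ?_
      have hle : supp k (Irr S ∩ Set.Iio V) ≤ supp k (Irr S ∩ Set.Iio W) :=
        supp_mono (Set.inter_subset_inter_right _ (Set.Iio_subset_Iio (le_of_lt hV)))
      exact sup_le_sup_right hle (idealSpan S) (ih V hV hl)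

theorem span_irr_eq_top [WellFoundedLT X] : Submodule.span k
    (Set.range fun W : Irr S => (idealSpan S).mkQ (W.1.1.eval k)) = ⊤ := by
  have h1 : supp k (Irr S) ⊔ idealSpan S = ⊤ := by
    rw [eq_top_iff]
    rintro f -
    have hf : f ∈ Submodule.span k (Set.range fun W : MPB k X => W.1.eval k) := by
      rw [span_eval_eq_top]; trivial
    refine Submodule.span_le.mpr ?_ hf
    rintro _ ⟨W, rfl⟩
    change W.1.eval k ∈ _
    by_cases hI : W ∈ Irr S
    · exact Submodule.mem_sup_left (eval_mem_supp hI)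
    · obtain ⟨g, hg, e⟩ := exists_normal_of_notMem_irr hI
      have hl := hg.lead hS e
      rw [← sub_sub_cancel g (W.1.eval k)]
      refine Submodule.sub_mem _ (Submodule.mem_sup_right hg.mem_idealSpan) ?_
      have hle : supp k (Irr S ∩ Set.Iio W) ≤ supp k (Irr S) := supp_mono Set.inter_subset_left
      exact sup_le_sup_right hle (idealSpan S) (supp_Iio_le hS W hl)
  have h2 := congrArg (Submodule.map (idealSpan S).mkQ) h1
  rw [Submodule.map_sup, Submodule.map_top, Submodule.range_mkQ, supp_eq_span, Submodule.map_span,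
    ← Set.image_comp] at h2
  rw [Submodule.mkQ_map_self, sup_bot_eq, Set.image_eq_range] at h2
  exact h2

omit hS in
-- A relation in the quotient is an element of the ideal supported on irreducible monomials; if
-- nonzero, its leading monomial would be that of a normal polynomial.
theorem linearIndependent_irr (h : IsGroebnerShirshovBasis S (idealSpan S)) :
    LinearIndependent k fun W : Irr S => (idealSpan S).mkQ (W.1.1.eval k) := by
  have h0 : LinearIndependent k fun W : Irr S => W.1.1.eval k :=
    linearIndependent_eval.comp _ Subtype.val_injective
  refine h0.map ?_
  rw [Submodule.ker_mkQ, Submodule.disjoint_def]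
  intro f hf hI
  by_contra hne
  obtain ⟨g, hg, e⟩ := h.2 f hI hne
  obtain ⟨W, hW⟩ := lm_ne_bot hne
  have hf' : f ∈ supp k (Irr S) := by
    rw [supp_eq_span, Set.image_eq_range]
    exact hf
  exact mem_supp.mp hf' W (coords_lm hW) g hg (hW.symm.trans e)

/-- If the leading monomial W of an element of the ideal were irreducible, reducing the smaller
terms would express W in the quotient through smaller irreducible monomials. -/
theorem isGroebnerShirshovBasis_of_linearIndependent [WellFoundedLT X]
    (h : LinearIndependent k fun W : Irr S => (idealSpan S).mkQ (W.1.1.eval k)) :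
    IsGroebnerShirshovBasis S (idealSpan S) := by
  refine ⟨rfl, fun f hf hne => ?_⟩
  obtain ⟨W, hW⟩ := lm_ne_bot hne
  by_contra hex
  have hI : W ∈ Irr S := fun g hg e => hex ⟨g, hg, hW.trans e⟩
  have h1 := supp_Iio_le hS W (sub_smul_mem hW)
  have h2 : W.1.eval k ∈ supp k (Irr S ∩ Set.Iio W) ⊔ idealSpan S := by
    have h3 := Submodule.sub_mem _ (Submodule.mem_sup_right hf) h1
    rw [sub_sub_cancel] at h3
    exact (Submodule.smul_mem_iff _ (coords_lm hW)).mp h3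
  refine h.notMem_span_image (s := {V | V.1 < W}) (x := ⟨W, hI⟩) (lt_irrefl W) ?_
  have h4 := Submodule.mem_map_of_mem (f := (idealSpan S).mkQ) h2
  rw [Submodule.map_sup, Submodule.mkQ_map_self, sup_bot_eq, supp_eq_span, Submodule.map_span, ← Set.image_comp] at h4
  refine Submodule.span_mono ?_ h4
  rintro _ ⟨V, ⟨hV, hVW⟩, rfl⟩
  exact ⟨⟨V, hV⟩, hVW, rfl⟩

end MP

end MetabelianPoisson

theorem theorem3p15 {k : Type*} {X : Type*} [Field k] [LinearOrder X] [WellFoundedLT X]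
    (S : Set (MetabelianPoisson.MP k X)) (hS : ∀ s ∈ S, MetabelianPoisson.MP.IsMonic s) :
    List.TFAE [
      MetabelianPoisson.MP.TrivialUnderMulCompositions S ∧
        MetabelianPoisson.MP.TrivialUnderGenCompositions S,
      MetabelianPoisson.MP.IsGroebnerShirshovBasis S (MetabelianPoisson.MP.idealSpan S),
      MetabelianPoisson.MP.IsBasisOfQuotient (MetabelianPoisson.MP.Irr S)
        (MetabelianPoisson.MP.idealSpan S)] := by
  open MetabelianPoisson.MP in
  tfae_have 1 → 2 := fun h => isGroebnerShirshovBasis_of_trivial hS h.1 h.2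
  tfae_have 2 → 1 := fun h => ⟨trivialUnderMulCompositions hS h, trivialUnderGenCompositions hS h⟩
  tfae_have 2 → 3 := fun h => ⟨linearIndependent_irr h, span_irr_eq_top hS⟩
  -- Only independence is used: the irreducible monomials span the quotient for every monic S.
  tfae_have 3 → 2 := fun h => isGroebnerShirshovBasis_of_linearIndependent hS h.1
  tfae_finish
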